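/- **Setting.** Let $Q=Q(f,L)\ge 0$ be defined for $f,L\ge 0$, with $Q,\partial_fQ$ continuous on $[0,\infty)\times[0,\infty)$ and $\partial_f^2Q$ continuous on $(0,\infty)\times[0,\infty)$. Let $C_1,\dots,C_4>0$, $F_0>0$ and $0<\mu_1,\mu_2,\mu_3<3/2$ be constants such that - (Q1) $Q(f,L)\ge C_1 f^{1+1/\mu_1}$ for $f\ge F_0$, $L\ge 0$; - (Q2) $Q(f,L)\le C_2 f^{1+1/\mu_2}$ for $0\le f\le F_0$, $L\ge 0$; - (Q3) $Q(\lambda f,L)\ge \lambda^{1+1/\mu_3}Q(f,L)$ for $f\ge 0$, $0\le\lambda\le 1$, $L\ge 0$, and, if $\mu_3<1/2$, $Q(f,\cdot)$ is (weakly) decreasing on $[0,\infty)$ for every $f\ge 0$; - (Q4) $\partial_f^2Q(f,L)>0$ for $f>0$, $L\ge 0$, and $\partial_fQ(0,L)=0$ for $L\ge 0$; - (Q5) there is a neighborhood of $1$ such that $C_3\,\partial_f^2Q(f,L)\le \partial_f^2Q(\lambda f,L)\le C_4\,\partial_f^2Q(f,L)$ for all $\lambda$ in it and all $f>0$, $L\ge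 0$. For $x,v\in\mathbb R^3$ put $L(x,v)=|x|^2|v|^2-(x\cdot v)^2$. For $f=f(x,v)$ put $$\rho_f(x)=\int f(x,v)\,dv,\qquad U_f(x)=-\int\frac{\rho_f(y)}{|x-y|}\,dy,$$ $$J(f)=\iint Q(f,L)\,dv\,dx+\tfrac12\iint|v|^2f\,dv\,dx,\qquad \mathcal D(f)=J(f)-\frac1{8\pi}\int|\nabla U_f|^2\,dx .$$ For $M>0$ let $\mathcal F_M$ be the set of all $f\in L^1(\mathbb R^6)$ with $f\ge 0$, $\iint f\,dv\,dx=M$, $J(f)<\infty$, and $f(Ax,Av)=f(x,v)$ for all $A\in SO(3)$ (for a.e. $(x,v)$). Let $M>0$ and assume that $f_0$ is the unique (up to equality a.e.) minimizer of $\mathcal D$ over $\mathcal F_M$. Write $U_0=U_{f_0}$, $E(x,v)=\frac12|v|^2+U_0(x)$, $E_0=\frac1M\iint(\partial_fQ(f_0,L)+E)\,f_0\,dv\,dx$, and $$d(f,f_0)=\iint\Bigl[Q(f,L)-Q(f_0,L)+(E-E_0)(f-f_0)\Bigr]dv\,dx .$$ By a solution we mean a classical solution $f=f(t,x,v)\ge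 0$ on $[0,\infty)$ of the Vlasov–Poisson system $$\partial_tf+v\cdot\nabla_xf-\nabla_xU\cdot\nabla_vf=0,\qquad \Delta U=4\pi\rho,\qquad \rho(t,x)=\int f(t,x,v)\,dv,$$ with $U(t,\cdot)=U_{f(t)}$: $f$ is $C^1$ on $[0,\infty)\times\mathbb R^6$; $\rho$ and $U$ exist and are $C^1$ on $[0,\infty)\times\mathbb R^3$; the second derivatives of $U$ in $x$ exist and are continuous on $[0,\infty)\times\mathbb R^3$; and $\nabla_xU$ is bounded on $[0,T]\times\mathbb R^3$ for every $T>0$. **Theorem (nonlinear stability).** For every $f\in\mathcal F_M$ the integral defining $d(f,f_0)$ converges absolutely, $\nabla U_f-\nabla U_0\in L^2(\mathbb R^3)$, and $d(f,f_0)\ge 0$. Moreover, for every $\varepsilon>0$ there is $\delta>0$ such that for every solution $f(t)$ of the Vlasov–Poisson system with $f(0)\in C^1_c(\mathbb R^6)\cap\mathcal F_M$, $$d(f(0),f_0)+\frac1{8\pi}\|\nabla U_{f(0)}-\nabla U_0\|_2^2<\delta$$ implies, for all $t\ge 0$, that $f(t)\in\mathcal F_M$ and $$d(f(t),f_0)+\frac1{8\pi}\|\nabla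 U_{f(t)}-\nabla U_0\|_2^2<\varepsilon .$$ -/

import Mathlib

open MeasureTheory Set Filter Topology

noncomputable section

namespace VlasovPoisson

/-- Position space and velocity space, with the Euclidean norm. -/
abbrev E3 : Type := EuclideanSpace ℝ (Fin 3)

/-- Phase space: pairs `(x, v)` of a position and a velocity. -/
abbrev Phase : Type := E3 × E3

/-! ### The Casimir integrand `Q(f, L)` -/

/-- The partial derivative of `Q` in its first variable, on `[0,∞)` (one-sided at `0`). -/
def dQ (Q : ℝ → ℝ → ℝ) (f L : ℝ) : ℝ := derivWithin (fun s => Q s L) (Ici 0) f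

/-- The second partial derivative of `Q` in its first variable; it is used for `f > 0` only. -/
def ddQ (Q : ℝ → ℝ → ℝ) (f L : ℝ) : ℝ := deriv (fun s => dQ Q s L) f

/-- `Q ∈ C^{1,0}([0,∞) × [0,∞)) ∩ C^{2,0}((0,∞) × [0,∞))` and `Q ≥ 0`.  Only the values of `Q` on
`[0,∞) × [0,∞)` matter. -/
structure IsCasimirIntegrand (Q : ℝ → ℝ → ℝ) : Prop where
  continuousOn : ContinuousOn (fun p : ℝ × ℝ => Q p.1 p.2) (Ici 0 ×ˢ Ici 0)
  differentiableOn : ∀ L, 0 ≤ L → DifferentiableOn ℝ (fun s => Q s L) (Ici 0)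
  continuousOn_dQ : ContinuousOn (fun p : ℝ × ℝ => dQ Q p.1 p.2) (Ici 0 ×ˢ Ici 0)
  differentiableOn_dQ : ∀ L, 0 ≤ L → DifferentiableOn ℝ (fun s => dQ Q s L) (Ioi 0)
  continuousOn_ddQ : ContinuousOn (fun p : ℝ × ℝ => ddQ Q p.1 p.2) (Ioi 0 ×ˢ Ici 0)
  nonneg : ∀ f L, 0 ≤ f → 0 ≤ L → 0 ≤ Q f L

def Q1 (Q : ℝ → ℝ → ℝ) (C₁ F₀ μ₁ : ℝ) : Prop :=
  ∀ f L, F₀ ≤ f → 0 ≤ L → C₁ * f ^ (1 + 1 / μ₁) ≤ Q f L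

def Q2 (Q : ℝ → ℝ → ℝ) (C₂ F₀ μ₂ : ℝ) : Prop :=
  ∀ f L, 0 ≤ f → f ≤ F₀ → 0 ≤ L → Q f L ≤ C₂ * f ^ (1 + 1 / μ₂)

def Q3 (Q : ℝ → ℝ → ℝ) (μ₃ : ℝ) : Prop :=
  (∀ f L lam, 0 ≤ f → 0 ≤ L → 0 ≤ lam → lam ≤ 1 →
    lam ^ (1 + 1 / μ₃) * Q f L ≤ Q (lam * f) L) ∧
  (μ₃ < 1 / 2 → ∀ f, 0 ≤ f → AntitoneOn (Q f) (Ici 0))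

def Q4 (Q : ℝ → ℝ → ℝ) : Prop :=
  (∀ f L, 0 < f → 0 ≤ L → 0 < ddQ Q f L) ∧ ∀ L, 0 ≤ L → dQ Q 0 L = 0

/-- The neighbourhood of `1` in which `lam` ranges does not depend on `f` and `L`. -/
def Q5 (Q : ℝ → ℝ → ℝ) (C₃ C₄ : ℝ) : Prop :=
  ∀ᶠ lam in 𝓝 (1 : ℝ), ∀ f L, 0 < f → 0 ≤ L →
    C₃ * ddQ Q f L ≤ ddQ Q (lam * f) L ∧ ddQ Q (lam * f) L ≤ C₄ * ddQ Q f L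

/-! ### Density, potential, energy-Casimir functional -/

/-- `L(x, v) = |x × v|² = |x|²|v|² - (x · v)²`. -/
def angMom (z : Phase) : ℝ := ‖z.1‖ ^ 2 * ‖z.2‖ ^ 2 - (inner ℝ z.1 z.2) ^ 2

/-- The spatial density `ρ_f(x) = ∫ f(x, v) dv`. -/
def density (f : Phase → ℝ) (x : E3) : ℝ := ∫ v : E3, f (x, v)

/-- The induced potential `U_f = - (1/|·|) * ρ_f`, which vanishes at infinity. -/
def potential (f : Phase → ℝ) (x : E3) : ℝ := -∫ y : E3, density f y / ‖x - y‖

/-- The field `∇ U_f`.  For the functions considered below `U_f` is differentiable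
almost everywhere (at every `x ≠ 0`). -/
def gradPot (f : Phase → ℝ) (x : E3) : E3 := gradient (potential f) x

/-- `J(f) = ∬ Q(f, L) dv dx + 1/2 ∬ |v|² f dv dx`. -/
def J (Q : ℝ → ℝ → ℝ) (f : Phase → ℝ) : ℝ :=
  (∫ z : Phase, Q (f z) (angMom z)) + 1 / 2 * ∫ z : Phase, ‖z.2‖ ^ 2 * f z

/-- `𝒟(f) = J(f) - (1/8π) ∫ |∇ U_f|² dx`. -/
def energyCasimir (Q : ℝ → ℝ → ℝ) (f : Phase → ℝ) : ℝ :=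
  J Q f - 1 / (8 * Real.pi) * ∫ x : E3, ‖gradPot f x‖ ^ 2

/-- Spherical symmetry of (a class of) `f`: `f(Ax, Av) = f(x, v)` for every `A ∈ SO(3)`,
for almost every `(x, v)`. -/
def IsSphericallySymmetric (f : Phase → ℝ) : Prop :=
  ∀ A : E3 ≃ₗᵢ[ℝ] E3, LinearMap.det (A.toLinearEquiv : E3 →ₗ[ℝ] E3) = 1 →
    ∀ᵐ z : Phase, f (A z.1, A z.2) = f z

/-- The set `ℱ_M`, through representatives of `L¹` classes.  Both integrands of `J` are
nonnegative almost everywhere, so `J(f) < ∞` says that both of them are integrable. -/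
structure MemFM (Q : ℝ → ℝ → ℝ) (M : ℝ) (f : Phase → ℝ) : Prop where
  integrable : Integrable f
  nonneg : ∀ᵐ z : Phase, 0 ≤ f z
  mass : ∫ z : Phase, f z = M
  integrable_casimir : Integrable (fun z : Phase => Q (f z) (angMom z))
  integrable_kinetic : Integrable (fun z : Phase => ‖z.2‖ ^ 2 * f z)
  symmetric : IsSphericallySymmetric f

/-- `f` minimizes `𝒟` over `ℱ_M`. -/
def IsMinimizer (Q : ℝ → ℝ → ℝ) (M : ℝ) (f : Phase → ℝ) : Prop :=
  MemFM Q M f ∧ ∀ g : Phase → ℝ, MemFM Q M g → energyCasimir Q f ≤ energyCasimir Q g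

/-! ### The distance from `f₀` -/

/-- The particle energy `E(x, v) = |v|²/2 + U_{f₀}(x)`. -/
def particleEnergy (f₀ : Phase → ℝ) (z : Phase) : ℝ := 1 / 2 * ‖z.2‖ ^ 2 + potential f₀ z.1

/-- `E₀ = (1/M) ∬ (∂_f Q(f₀, L) + E) f₀ dv dx`. -/
def cutoffEnergy (Q : ℝ → ℝ → ℝ) (M : ℝ) (f₀ : Phase → ℝ) : ℝ :=
  1 / M * ∫ z : Phase, (dQ Q (f₀ z) (angMom z) + particleEnergy f₀ z) * f₀ z

/-- `Q(f, L) - Q(f₀, L) + (E - E₀)(f - f₀)`. -/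
def casimirDistIntegrand (Q : ℝ → ℝ → ℝ) (M : ℝ) (f f₀ : Phase → ℝ) (z : Phase) : ℝ :=
  Q (f z) (angMom z) - Q (f₀ z) (angMom z) +
    (particleEnergy f₀ z - cutoffEnergy Q M f₀) * (f z - f₀ z)

/-- `d(f, f₀) = ∬ [Q(f, L) - Q(f₀, L) + (E - E₀)(f - f₀)] dv dx`. -/
def casimirDist (Q : ℝ → ℝ → ℝ) (M : ℝ) (f f₀ : Phase → ℝ) : ℝ :=
  ∫ z : Phase, casimirDistIntegrand Q M f f₀ z

/-- `d(f, f₀) + (1/8π) ‖∇ U_f - ∇ U_{f₀}‖₂²`. -/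
def stabilityDist (Q : ℝ → ℝ → ℝ) (M : ℝ) (f f₀ : Phase → ℝ) : ℝ :=
  casimirDist Q M f f₀ + 1 / (8 * Real.pi) * ∫ x : E3, ‖gradPot f x - gradPot f₀ x‖ ^ 2

/-! ### Classical solutions -/

/-- Classical solutions on `[0,∞)` of the Vlasov-Poisson system
`∂_t f + v · ∇_x f - ∇_x U · ∇_v f = 0`, `Δ U = 4 π ρ`, `ρ = ∫ f dv`, `U → 0` at infinity:
`f ≥ 0` is `C¹`; the density and the potential exist and are `C¹`; the potential is `C²` in `x`;
the field is bounded on bounded time intervals; and the equations hold. -/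
structure IsClassicalSolution (f : ℝ → Phase → ℝ) : Prop where
  contDiffOn : ContDiffOn ℝ 1 (fun p : ℝ × Phase => f p.1 p.2) (Ici 0 ×ˢ univ)
  nonneg : ∀ t, 0 ≤ t → ∀ z, 0 ≤ f t z
  density_exists : ∀ t, 0 ≤ t → ∀ x : E3, Integrable (fun v : E3 => f t (x, v))
  potential_exists : ∀ t, 0 ≤ t → ∀ x : E3,
    Integrable (fun y : E3 => density (f t) y / ‖x - y‖)
  contDiffOn_density :
    ContDiffOn ℝ 1 (fun p : ℝ × E3 => density (f p.1) p.2) (Ici 0 ×ˢ univ)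
  contDiffOn_potential :
    ContDiffOn ℝ 1 (fun p : ℝ × E3 => potential (f p.1) p.2) (Ici 0 ×ˢ univ)
  contDiff_potential : ∀ t, 0 ≤ t → ContDiff ℝ 2 (potential (f t))
  continuousOn_hessian :
    ContinuousOn (fun p : ℝ × E3 => fderiv ℝ (gradPot (f p.1)) p.2) (Ici 0 ×ˢ univ)
  bounded_field : ∀ T : ℝ, ∃ C : ℝ, ∀ t, 0 ≤ t → t ≤ T → ∀ x, ‖gradPot (f t) x‖ ≤ C
  vlasov : ∀ t, 0 < t → ∀ x v : E3,
    deriv (fun s => f s (x, v)) t + inner ℝ v (gradient (fun y => f t (y, v)) x)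
      - inner ℝ (gradPot (f t) x) (gradient (fun w => f t (x, w)) v) = 0
  poisson : ∀ t, 0 ≤ t → ∀ x : E3,
    Laplacian.laplacian (potential (f t)) x = 4 * Real.pi * density (f t) x

end VlasovPoisson

end

open scoped ENNReal

/-! ### Integrals over the unit ball of functions of the polar angle. -/

namespace VlasovPoisson

/-! Write `m_f(r)` for the mass in `|x| < r` (`cumMass`). By Newton's shell theorem a spherically
symmetric `f` has `∇U_f(x) = m_f(|x|) x / |x|³` for `x ≠ 0`, so field energies become
one-dimensional integrals: `∫ |∇U_f|² = 4π ∫ m_f² / r² dr`, with polar form `interaction`. Expanding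
this quadratic form at `f₀` gives `𝒟(f) - 𝒟(f₀) = d(f, f₀) - ½ I(f - f₀)`, where `I(h) = interaction
h h` (`energyCasimir_sub_eq`). Hence the quantity to be controlled is `𝒟(f) - 𝒟(f₀) + I(f - f₀)`.
The first difference is conserved by the flow, so it remains to show that `I(f - f₀)` is small
whenever `𝒟(f)` is close to its minimum (`exists_delta_interaction_lt`). The inequality `d ≥ 0` is
the first-order condition at the minimizer along the segments from `f₀` to `f`.

Compactness. `I(f)` grows at most like a power of `1 + J(f)` with exponent below one, so along a
minimizing sequence `J` is bounded. The functions `m_n` are then equicontinuous and dominated near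
`0` and near infinity, so a subsequence has fields converging strongly in `L²`. Testing minimality
with midpoints of two members bounds the integrated convexity defect of `Q` by the excess of `𝒟` and
the distance of the fields (`integral_midGap_le`). Strict convexity turns this into almost
everywhere convergence of a further subsequence. By Fatou its limit `h` has mass at most `M` and
`𝒟(h) ≤ 𝒟(f₀) < 0`; a rescaling to mass `M` excludes any loss of mass. So `h` is a minimizer and
equals `f₀` (`cumMass_limit_eq`).

Conservation. No flow map is constructed. Maximum principles for the transport equation yield
compact support in phase space (`exists_support_radius`) and persistence of spherical symmetry
(`rotate_eq`). The field `(v, -∇U)` is divergence free, and `L` is constant along it because the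
force is central. So `∬ φ(f, L)` is conserved for `C¹` functions `φ` with `φ(0, ·) = 0`. As `Q` is
only continuous in `L`, the step to `∬ Q(f, L)` goes through characteristic functions, which show
that the joint law of `(f, L)` under `f dx dv` is conserved. The energy is conserved by reciprocity,
`∬ U_f g = ∬ U_g f`. -/

theorem lintegral_axial {G : ℝ × ℝ → ℝ≥0∞} (hG : Measurable G) :
    ∫⁻ x : E3, G (x 0, √(x 1 ^ 2 + x 2 ^ 2)) =
      ENNReal.ofReal (2 * Real.pi) *
        ∫⁻ a : ℝ, ∫⁻ ρ in Ioi (0 : ℝ), ENNReal.ofReal ρ * G (a, ρ) := by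
  have h1 : ∫⁻ x : E3, G (x 0, √(x 1 ^ 2 + x 2 ^ 2)) =
      ∫⁻ y : Fin 3 → ℝ, G (y 0, √(y 1 ^ 2 + y 2 ^ 2)) :=
    (PiLp.volume_preserving_ofLp (Fin 3)).lintegral_comp
      (f := fun y : Fin 3 → ℝ => G (y 0, √(y 1 ^ 2 + y 2 ^ 2))) (by fun_prop)
  have h2 : ∫⁻ y : Fin 3 → ℝ, G (y 0, √(y 1 ^ 2 + y 2 ^ 2)) =
      ∫⁻ p : ℝ × (Fin 2 → ℝ), G (p.1, √(p.2 0 ^ 2 + p.2 1 ^ 2)) :=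
    (volume_preserving_piFinSuccAbove (fun _ : Fin 3 => ℝ) 0).lintegral_comp
      (f := fun p : ℝ × (Fin 2 → ℝ) => G (p.1, √(p.2 0 ^ 2 + p.2 1 ^ 2))) (by fun_prop)
  have h3 (a : ℝ) : ∫⁻ q : Fin 2 → ℝ, G (a, √(q 0 ^ 2 + q 1 ^ 2)) =
      ENNReal.ofReal (2 * Real.pi) * ∫⁻ ρ in Ioi (0 : ℝ), ENNReal.ofReal ρ * G (a, ρ) := by
    have h4 : ∫⁻ q : Fin 2 → ℝ, G (a, √(q 0 ^ 2 + q 1 ^ 2)) =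
        ∫⁻ p : ℝ × ℝ, G (a, √(p.1 ^ 2 + p.2 ^ 2)) :=
      (volume_preserving_piFinTwo (fun _ : Fin 2 => ℝ)).lintegral_comp
        (f := fun p : ℝ × ℝ => G (a, √(p.1 ^ 2 + p.2 ^ 2))) (by fun_prop)
    rw [h4, ← lintegral_comp_polarCoord_symm]
    have h5 : ∀ p ∈ polarCoord.target,
        ENNReal.ofReal p.1 • G (a, √((polarCoord.symm p).1 ^ 2 + (polarCoord.symm p).2 ^ 2)) =
          ENNReal.ofReal p.1 * G (a, p.1) := by
      intro p hp
      rw [polarCoord_target] at hp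
      have hp1 : 0 < p.1 := hp.1
      have : (polarCoord.symm p).1 ^ 2 + (polarCoord.symm p).2 ^ 2 = p.1 ^ 2 := by
        simp only [polarCoord_symm_apply]
        nlinarith [Real.sin_sq_add_cos_sq p.2]
      rw [this, Real.sqrt_sq hp1.le, smul_eq_mul]
    rw [setLIntegral_congr_fun polarCoord.open_target.measurableSet h5, polarCoord_target,
      Measure.volume_eq_prod, ← Measure.prod_restrict, lintegral_prod _ (by fun_prop)]
    simp only [lintegral_const, Measure.restrict_apply_univ, Real.volume_Ioo]
    rw [lintegral_mul_const _ (by fun_prop), mul_comm]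
    congr 2
    ring
  rw [h1, h2, Measure.volume_eq_prod, lintegral_prod _ (by fun_prop)]
  simp_rw [h3]
  rw [lintegral_const_mul]
  exact Measurable.lintegral_prod_right'
    (f := fun p : ℝ × ℝ => ENNReal.ofReal p.2 * G (p.1, p.2)) (by fun_prop)

/-- Polar coordinates `(r, θ)` in the half-plane of cylindrical coordinates give the density `r² sin
θ`, and `1/3` is the radial integral. Averaging over the ball a function of the direction alone
replaces averaging over the sphere, so no surface measure is needed. -/
theorem lintegral_ball_axial {h : ℝ → ℝ≥0∞} (hh : Measurable h) :
    ∫⁻ x in Metric.ball (0 : E3) 1, h (x 0 / ‖x‖) =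
      ENNReal.ofReal (2 * Real.pi / 3) *
        ∫⁻ θ in Ioo 0 Real.pi, ENNReal.ofReal (Real.sin θ) * h (Real.cos θ) := by
  set G : ℝ × ℝ → ℝ≥0∞ := fun p =>
    {p : ℝ × ℝ | √(p.1 ^ 2 + p.2 ^ 2) < 1}.indicator (fun p => h (p.1 / √(p.1 ^ 2 + p.2 ^ 2))) p
    with hGdef
  have hS : MeasurableSet {p : ℝ × ℝ | √(p.1 ^ 2 + p.2 ^ 2) < 1} :=
    measurableSet_lt (by fun_prop) (by fun_prop)
  have hG : Measurable G := Measurable.indicator (by fun_prop) hS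
  have h1 : ∫⁻ x in Metric.ball (0 : E3) 1, h (x 0 / ‖x‖) =
      ∫⁻ x : E3, G (x 0, √(x 1 ^ 2 + x 2 ^ 2)) := by
    rw [← lintegral_indicator measurableSet_ball]
    congr 1
    ext x
    have hn : √(x 0 ^ 2 + √(x 1 ^ 2 + x 2 ^ 2) ^ 2) = ‖x‖ := by
      rw [Real.sq_sqrt (by positivity), EuclideanSpace.norm_eq, Fin.sum_univ_three]
      simp only [Real.norm_eq_abs, sq_abs]
      ring_nf
    simp only [hGdef, indicator, mem_ofPred_eq, hn, Metric.mem_ball, dist_zero_right]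
  rw [h1, lintegral_axial hG]
  have h2 : ∫⁻ a : ℝ, ∫⁻ ρ in Ioi (0 : ℝ), ENNReal.ofReal ρ * G (a, ρ) =
      ∫⁻ p : ℝ × ℝ, (Ioi (0 : ℝ)).indicator (fun ρ => ENNReal.ofReal ρ * G (p.1, ρ)) p.2 := by
    rw [Measure.volume_eq_prod, lintegral_prod]
    · congr 1; ext a
      exact (lintegral_indicator measurableSet_Ioi _).symm
    · have : (fun p : ℝ × ℝ => (Ioi (0 : ℝ)).indicator (fun ρ => ENNReal.ofReal ρ * G (p.1, ρ)) p.2)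
          = (Prod.snd ⁻¹' Ioi (0 : ℝ)).indicator
            (fun p : ℝ × ℝ => ENNReal.ofReal p.2 * G (p.1, p.2)) := by
        ext p; simp [indicator]
      rw [this]
      exact (Measurable.indicator (by fun_prop) (measurable_snd measurableSet_Ioi)).aemeasurable
  have hsin : MeasurableSet (Ioo 0 Real.pi) := measurableSet_Ioo
  rw [h2, ← lintegral_comp_polarCoord_symm]
  have h5 : ∀ p ∈ polarCoord.target,
      ENNReal.ofReal p.1 • (Ioi (0 : ℝ)).indicator
        (fun ρ => ENNReal.ofReal ρ * G ((polarCoord.symm p).1, ρ)) (polarCoord.symm p).2 =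
      (Ioo (0 : ℝ) 1).indicator (fun r => ENNReal.ofReal (r ^ 2)) p.1 *
        (Ioo 0 Real.pi).indicator
          (fun θ => ENNReal.ofReal (Real.sin θ) * h (Real.cos θ)) p.2 := by
    intro p hp
    rw [polarCoord_target] at hp
    have hp1 : 0 < p.1 := hp.1
    have hp2 : -Real.pi < p.2 := hp.2.1
    have hp3 : p.2 < Real.pi := hp.2.2
    simp only [polarCoord_symm_apply, hGdef, indicator, mem_ofPred_eq, mem_Ioi, mem_Ioo]
    have hn : √((p.1 * Real.cos p.2) ^ 2 + (p.1 * Real.sin p.2) ^ 2) = p.1 := by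
      rw [show (p.1 * Real.cos p.2) ^ 2 + (p.1 * Real.sin p.2) ^ 2 = p.1 ^ 2 by
        nlinarith [Real.sin_sq_add_cos_sq p.2], Real.sqrt_sq hp1.le]
    rw [hn, mul_div_cancel_left₀ _ hp1.ne']
    by_cases h0 : 0 < p.2
    · have hs : 0 < Real.sin p.2 := Real.sin_pos_of_pos_of_lt_pi h0 hp3
      by_cases h1 : p.1 < 1
      · simp only [mul_pos hp1 hs, h1, hp1, h0, hp3, and_self, if_true, smul_eq_mul]
        rw [ENNReal.ofReal_mul hp1.le, pow_two, ENNReal.ofReal_mul hp1.le]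
        ring
      · simp [h1]
    · have hs : ¬ 0 < p.1 * Real.sin p.2 := by
        have := Real.sin_nonpos_of_nonpos_of_neg_pi_le (not_lt.1 h0) hp2.le
        nlinarith
      simp [hs, h0]
  have hm1 : Measurable ((Ioo (0 : ℝ) 1).indicator (fun r => ENNReal.ofReal (r ^ 2))) :=
    Measurable.indicator (by fun_prop) measurableSet_Ioo
  have hm2 : Measurable ((Ioo 0 Real.pi).indicator
      (fun θ => ENNReal.ofReal (Real.sin θ) * h (Real.cos θ))) :=
    Measurable.indicator (by fun_prop) measurableSet_Ioo
  rw [setLIntegral_congr_fun polarCoord.open_target.measurableSet h5, polarCoord_target,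
      Measure.volume_eq_prod, ← Measure.prod_restrict, lintegral_prod_mul hm1.aemeasurable
        hm2.aemeasurable]
  rw [lintegral_indicator measurableSet_Ioo, lintegral_indicator measurableSet_Ioo,
    Measure.restrict_restrict measurableSet_Ioo, Measure.restrict_restrict measurableSet_Ioo]
  have e1 : Ioo (0 : ℝ) 1 ∩ Ioi 0 = Ioo 0 1 := by ext; simp; tauto
  have e2 : Ioo 0 Real.pi ∩ Ioo (-Real.pi) Real.pi = Ioo 0 Real.pi := by
    apply inter_eq_left.2
    exact Ioo_subset_Ioo (by linarith [Real.pi_pos]) le_rfl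
  rw [e1, e2]
  have e3 : ∫⁻ r in Ioo (0 : ℝ) 1, ENNReal.ofReal (r ^ 2) = ENNReal.ofReal (1 / 3) := by
    rw [← ofReal_integral_eq_lintegral_ofReal, ← integral_Ioc_eq_integral_Ioo,
      ← intervalIntegral.integral_of_le zero_le_one]
    · rw [integral_pow]; norm_num
    · exact (Continuous.integrableOn_Icc (by fun_prop)).mono_set Ioo_subset_Icc_self
    · exact Eventually.of_forall fun x => by positivity
  rw [e3, ← mul_assoc, ← ENNReal.ofReal_mul (by positivity)]
  congr 2
  ring

end VlasovPoisson

/-! ### Rotations, and spherical means of the Newtonian kernel. -/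

namespace VlasovPoisson

theorem det_reflection_span_singleton {w : E3} (hw : w ≠ 0) :
    LinearMap.det (((ℝ ∙ w).reflection).toLinearEquiv : E3 →ₗ[ℝ] E3) = 1 := by
  have : Fact (Module.finrank ℝ E3 = 2 + 1) := ⟨by simp⟩
  have h := (ℝ ∙ w).det_reflection
  rw [Submodule.finrank_orthogonal_span_singleton (n := 2) hw] at h
  simpa using h

/-- The half-turn about the axis `x + y` exchanges `x` and `y`; if `y = -x`, any axis orthogonal to
`x` serves. A half-turn is the reflection in a line, which in dimension three has determinant `(-1)²
= 1`. -/
theorem exists_rotation_apply_eq {x y : E3} (h : ‖x‖ = ‖y‖) :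
    ∃ A : E3 ≃ₗᵢ[ℝ] E3, LinearMap.det (A.toLinearEquiv : E3 →ₗ[ℝ] E3) = 1 ∧ A x = y := by
  by_cases hxy : x + y = 0
  · obtain rfl : y = -x := (neg_eq_of_add_eq_zero_right hxy).symm
    by_cases hx : x = 0
    · exact ⟨.refl ℝ E3, by simp [hx]⟩
    have : Fact (Module.finrank ℝ E3 = 2 + 1) := ⟨by simp⟩
    obtain ⟨w, hw, hw0⟩ : ∃ w ∈ (ℝ ∙ x)ᗮ, w ≠ 0 := by
      apply Submodule.exists_mem_ne_zero_of_ne_bot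
      intro hbot
      have := Submodule.finrank_orthogonal_span_singleton (𝕜 := ℝ) (n := 2) hx
      rw [hbot] at this
      simp at this
    refine ⟨_, det_reflection_span_singleton hw0, ?_⟩
    have : inner ℝ w x = 0 := by
      rw [real_inner_comm]; exact Submodule.mem_orthogonal_singleton_iff_inner_right.1 hw
    rw [Submodule.reflection_singleton_apply, this]
    simp
  · refine ⟨_, det_reflection_span_singleton hxy, ?_⟩
    have h0 : ‖x + y‖ ^ 2 ≠ 0 := by positivity
    have h1 : ‖x + y‖ ^ 2 = 2 * inner ℝ (x + y) x := by
      rw [norm_add_sq_real, inner_add_left, real_inner_self_eq_norm_sq, ← h, real_inner_comm]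
      ring
    have h2 : (2 : ℝ) * (inner ℝ (x + y) x / ‖x + y‖ ^ 2) = 1 := by
      field_simp; linarith
    rw [Submodule.reflection_singleton_apply, ← Nat.cast_smul_eq_nsmul ℝ, smul_smul]
    change ((2 : ℝ) * (inner ℝ (x + y) x / ‖x + y‖ ^ 2)) • (x + y) - x = y
    rw [h2]; simp

/-- The integrand is the derivative of `√(r² + s² - 2rs cos θ) / (rs)`, whose values at `π` and `0`
are `(r + s)/(rs)` and `|r - s|/(rs)`. The condition `s ≠ r` keeps the radicand positive. -/
theorem lintegral_sin_mul_inv_sqrt {r s : ℝ} (hr : 0 < r) (hs : 0 < s) (hrs : s ≠ r) :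
    ∫⁻ θ in Ioo 0 Real.pi, ENNReal.ofReal (Real.sin θ) *
      ENNReal.ofReal (1 / √(r ^ 2 + s ^ 2 - 2 * r * s * Real.cos θ)) =
      ENNReal.ofReal (2 / max r s) := by
  have hpos (θ : ℝ) : 0 < r ^ 2 + s ^ 2 - 2 * r * s * Real.cos θ := by
    have h1 : 0 < (r - s) ^ 2 := by
      have : r - s ≠ 0 := sub_ne_zero.2 hrs.symm
      positivity
    nlinarith [Real.cos_le_one θ, mul_pos hr hs]
  have hd (θ : ℝ) : HasDerivAt (fun θ => √(r ^ 2 + s ^ 2 - 2 * r * s * Real.cos θ) / (r * s))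
      (Real.sin θ * (1 / √(r ^ 2 + s ^ 2 - 2 * r * s * Real.cos θ))) θ := by
    have h1 : HasDerivAt (fun θ => r ^ 2 + s ^ 2 - 2 * r * s * Real.cos θ)
        (2 * r * s * Real.sin θ) θ := by
      exact (((Real.hasDerivAt_cos θ).const_mul (2 * r * s)).const_sub
        (r ^ 2 + s ^ 2)).congr_deriv (by ring)
    refine ((h1.sqrt (hpos θ).ne').div_const (r * s)).congr_deriv ?_
    have := (Real.sqrt_pos.2 (hpos θ)).ne'
    field_simp
  have hc : Continuous fun θ => Real.sin θ *
      (1 / √(r ^ 2 + s ^ 2 - 2 * r * s * Real.cos θ)) := by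
    refine Real.continuous_sin.mul (continuous_const.div (by fun_prop) fun θ => ?_)
    exact (Real.sqrt_pos.2 (hpos θ)).ne'
  have h1 : ∫⁻ θ in Ioo 0 Real.pi, ENNReal.ofReal (Real.sin θ) *
      ENNReal.ofReal (1 / √(r ^ 2 + s ^ 2 - 2 * r * s * Real.cos θ)) =
      ∫⁻ θ in Ioo 0 Real.pi, ENNReal.ofReal (Real.sin θ *
        (1 / √(r ^ 2 + s ^ 2 - 2 * r * s * Real.cos θ))) := by
    refine setLIntegral_congr_fun measurableSet_Ioo fun θ hθ => ?_
    rw [ENNReal.ofReal_mul (Real.sin_pos_of_mem_Ioo hθ).le]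
  rw [h1, ← ofReal_integral_eq_lintegral_ofReal, ← integral_Ioc_eq_integral_Ioo,
      ← intervalIntegral.integral_of_le Real.pi_pos.le,
      intervalIntegral.integral_eq_sub_of_hasDerivAt (fun θ _ => hd θ)
        (hc.intervalIntegrable _ _)]
  · congr 1
    simp only [Real.cos_pi, Real.cos_zero]
    rw [show r ^ 2 + s ^ 2 - 2 * r * s * -1 = (r + s) ^ 2 by ring,
      show r ^ 2 + s ^ 2 - 2 * r * s * 1 = (r - s) ^ 2 by ring,
      Real.sqrt_sq (by positivity), Real.sqrt_sq_eq_abs]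
    rcases le_total r s with h | h
    · rw [max_eq_right h, abs_of_nonpos (by linarith)]; field_simp; ring
    · rw [max_eq_left h, abs_of_nonneg (by linarith)]; field_simp; ring
  · exact hc.integrableOn_Icc.mono_set Ioo_subset_Icc_self
  · refine (ae_restrict_iff' measurableSet_Ioo).2 (Eventually.of_forall fun θ hθ => ?_)
    have := Real.sin_pos_of_mem_Ioo hθ
    positivity

/-- The mean of `1 / |x - y|` over the sphere `|x| = r`, written as an average over the unit
ball. -/
theorem lintegral_ball_inv_norm_sub {r : ℝ} (hr : 0 < r) {y : E3} (hy : y ≠ 0) (hyr : ‖y‖ ≠ r) :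
    ∫⁻ x in Metric.ball (0 : E3) 1, ENNReal.ofReal (1 / ‖(r / ‖x‖) • x - y‖) =
      ENNReal.ofReal (4 * Real.pi / 3) * ENNReal.ofReal (1 / max r ‖y‖) := by
  have hs : 0 < ‖y‖ := norm_pos_iff.2 hy
  set e : E3 := ‖y‖ • EuclideanSpace.single (0 : Fin 3) (1 : ℝ) with he
  have hen : ‖e‖ = ‖y‖ := by simp [he, norm_smul]
  obtain ⟨A, -, hA⟩ := exists_rotation_apply_eq hen
  have h1 : ∫⁻ x in Metric.ball (0 : E3) 1, ENNReal.ofReal (1 / ‖(r / ‖x‖) • x - y‖) =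
      ∫⁻ x in Metric.ball (0 : E3) 1, ENNReal.ofReal (1 / ‖(r / ‖x‖) • x - e‖) := by
    rw [← (LinearIsometryEquiv.measurePreserving A).setLIntegral_comp_preimage measurableSet_ball
      (by fun_prop)]
    have hb : A ⁻¹' Metric.ball (0 : E3) 1 = Metric.ball 0 1 := by
      ext x; simp
    rw [hb]
    congr 1
    ext x
    rw [LinearIsometryEquiv.norm_map, ← map_smul, ← hA, ← map_sub, LinearIsometryEquiv.norm_map]
  have h2 : ∫⁻ x in Metric.ball (0 : E3) 1, ENNReal.ofReal (1 / ‖(r / ‖x‖) • x - e‖) =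
      ∫⁻ x in Metric.ball (0 : E3) 1,
        (fun c => ENNReal.ofReal (1 / √(r ^ 2 + ‖y‖ ^ 2 - 2 * r * ‖y‖ * c))) (x 0 / ‖x‖) := by
    refine lintegral_congr_ae (ae_restrict_of_ae ?_)
    filter_upwards [Measure.ae_ne volume (0 : E3)] with x hx
    have hx' : ‖x‖ ≠ 0 := norm_ne_zero_iff.2 hx
    have hin : inner ℝ x e = ‖y‖ * x 0 := by
      rw [he, inner_smul_right, EuclideanSpace.inner_single_right]; simp
    have h3 : ‖(r / ‖x‖) • x - e‖ ^ 2 = r ^ 2 + ‖y‖ ^ 2 - 2 * r * ‖y‖ * (x 0 / ‖x‖) := by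
      rw [norm_sub_sq_real, hen, norm_smul, inner_smul_left, hin]
      simp only [norm_div, abs_norm, Real.norm_eq_abs, abs_of_pos hr, conj_trivial]
      field_simp
      ring
    simp only [← h3, Real.sqrt_sq (norm_nonneg _)]
  rw [h1, h2, lintegral_ball_axial
    (h := fun c => ENNReal.ofReal (1 / √(r ^ 2 + ‖y‖ ^ 2 - 2 * r * ‖y‖ * c))) (by fun_prop),
    lintegral_sin_mul_inv_sqrt hr hs hyr,
    ← ENNReal.ofReal_mul (by positivity), ← ENNReal.ofReal_mul (by positivity)]
  congr 1
  ring

end VlasovPoisson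

/-! ### Newton's shell theorem: potential and field of a spherically symmetric density. -/

namespace VlasovPoisson

/-- An integrable, nonnegative, spherically symmetric phase-space density. -/
structure IsSymmetricDensity (f : Phase → ℝ) : Prop where
  integrable : Integrable f
  nonneg : ∀ᵐ z : Phase, 0 ≤ f z
  symmetric : IsSphericallySymmetric f

/-- The mass `∬_{|x| < r} f dv dx`. -/
noncomputable def cumMass (f : Phase → ℝ) (r : ℝ) : ℝ := ∫ z in {z : Phase | ‖z.1‖ < r}, f z

theorem measurableSet_norm_fst_lt (r : ℝ) : MeasurableSet {z : Phase | ‖z.1‖ < r} :=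
  measurableSet_lt (by fun_prop) measurable_const

theorem measurePreserving_rotate (A : E3 ≃ₗᵢ[ℝ] E3) :
    MeasurePreserving (fun z : Phase => (A z.1, A z.2)) :=
  (LinearIsometryEquiv.measurePreserving A).prod (LinearIsometryEquiv.measurePreserving A)

theorem ae_norm_fst_ne (r : ℝ) : ∀ᵐ z : Phase, ‖z.1‖ ≠ r := by
  have h : ∀ᵐ x : E3, ‖x‖ ≠ r := by
    rw [ae_iff]
    simp only [not_not]
    have := Measure.addHaar_sphere (volume : Measure E3) 0 r
    convert this using 2
    ext x; simp
  exact Measure.quasiMeasurePreserving_fst.ae h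

namespace IsSymmetricDensity

variable {f g : Phase → ℝ}

theorem lintegral_comp_rotate (hf : IsSymmetricDensity f) {A : E3 ≃ₗᵢ[ℝ] E3}
    (hA : LinearMap.det (A.toLinearEquiv : E3 →ₗ[ℝ] E3) = 1) {k : E3 → ℝ≥0∞} (hk : Measurable k) :
    ∫⁻ z : Phase, ENNReal.ofReal (f z) * k (A z.1) =
      ∫⁻ z : Phase, ENNReal.ofReal (f z) * k z.1 := by
  have hmp := measurePreserving_rotate A
  have hm : AEMeasurable (fun z : Phase => ENNReal.ofReal (f z) * k z.1) :=
    hf.integrable.aemeasurable.ennreal_ofReal.mul (by fun_prop)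
  rw [← hmp.map_eq] at hm
  nth_rewrite 2 [← hmp.map_eq]
  rw [lintegral_map' hm hmp.aemeasurable]
  refine lintegral_congr_ae ?_
  filter_upwards [hf.symmetric A hA] with z hz
  rw [hz]

/-- The left side depends on `‖x‖` only, so it equals its own average over directions. Tonelli moves
that average onto the kernel, where the spherical mean of `1/‖x - y‖` is `1/max ‖x‖ ‖y‖` apart from
`y = 0` and `‖y‖ = ‖x‖`, both of measure zero. -/
theorem lintegral_newton (hf : IsSymmetricDensity f) {x : E3} (hx : x ≠ 0) :
    ∫⁻ z : Phase, ENNReal.ofReal (f z) * ENNReal.ofReal (1 / ‖x - z.1‖) =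
      ∫⁻ z : Phase, ENNReal.ofReal (f z) * ENNReal.ofReal (1 / max ‖x‖ ‖z.1‖) := by
  set I : E3 → ℝ≥0∞ := fun x =>
    ∫⁻ z : Phase, ENNReal.ofReal (f z) * ENNReal.ofReal (1 / ‖x - z.1‖) with hI
  have hr : 0 < ‖x‖ := norm_pos_iff.2 hx
  have hrot {x x' : E3} (h : ‖x‖ = ‖x'‖) : I x' = I x := by
    obtain ⟨A, hA, rfl⟩ := exists_rotation_apply_eq h
    simp only [hI]
    rw [← hf.lintegral_comp_rotate hA (k := fun y => ENNReal.ofReal (1 / ‖A x - y‖))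
      (by fun_prop)]
    simp_rw [← map_sub, LinearIsometryEquiv.norm_map]
  have hfm := hf.integrable.aemeasurable
  have h1 : ∫⁻ x' in Metric.ball (0 : E3) 1, I ((‖x‖ / ‖x'‖) • x') =
      ENNReal.ofReal (4 * Real.pi / 3) * I x := by
    have : ∀ᵐ x' ∂(volume.restrict (Metric.ball (0 : E3) 1)), I ((‖x‖ / ‖x'‖) • x') = I x := by
      refine ae_restrict_of_ae ?_
      filter_upwards [Measure.ae_ne volume (0 : E3)] with x' hx'
      have : ‖x'‖ ≠ 0 := norm_ne_zero_iff.2 hx'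
      refine hrot ?_
      rw [norm_smul, norm_div, norm_norm, norm_norm]
      field_simp
    rw [lintegral_congr_ae this, lintegral_const, Measure.restrict_apply_univ,
      EuclideanSpace.volume_ball_fin_three, mul_comm]
    simp [mul_comm, mul_div_assoc]
  have h2 : ∫⁻ x' in Metric.ball (0 : E3) 1, I ((‖x‖ / ‖x'‖) • x') =
      ENNReal.ofReal (4 * Real.pi / 3) *
        ∫⁻ z : Phase, ENNReal.ofReal (f z) * ENNReal.ofReal (1 / max ‖x‖ ‖z.1‖) := by
    simp only [hI]
    rw [lintegral_lintegral_swap]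
    · rw [← lintegral_const_mul'']
      · refine lintegral_congr_ae ?_
        filter_upwards [ae_norm_fst_ne 0, ae_norm_fst_ne ‖x‖] with z hz0 hzr
        rw [lintegral_const_mul _ (by fun_prop),
          lintegral_ball_inv_norm_sub hr (norm_ne_zero_iff.1 hz0) hzr]
        ring
      · exact hfm.ennreal_ofReal.mul (by fun_prop)
    · have h4 : Measurable fun p : E3 × Phase =>
          ENNReal.ofReal (1 / ‖(‖x‖ / ‖p.1‖) • p.1 - p.2.1‖) := by fun_prop
      exact (hfm.ennreal_ofReal.comp_quasiMeasurePreserving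
          Measure.quasiMeasurePreserving_snd).mul h4.aemeasurable
  have h3 : ENNReal.ofReal (4 * Real.pi / 3) ≠ 0 := by
    rw [Ne, ENNReal.ofReal_eq_zero, not_le]; positivity
  exact (ENNReal.mul_right_inj h3 ENNReal.ofReal_ne_top).1 (h1.symm.trans h2)

theorem integrable_div_max (hf : Integrable f) {s : ℝ} (hs : 0 < s) :
    Integrable fun z : Phase => f z / max s ‖z.1‖ := by
  refine (hf.div_const s).mono ?_ ?_
  · exact (hf.aemeasurable.div (by fun_prop)).aestronglyMeasurable
  · refine Eventually.of_forall fun z => ?_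
    rw [norm_div, norm_div]
    have : s ≤ max s ‖z.1‖ := le_max_left _ _
    rw [Real.norm_of_nonneg hs.le, Real.norm_of_nonneg (hs.le.trans this)]
    gcongr

theorem integrable_div_norm_sub (hf : IsSymmetricDensity f) {x : E3} (hx : x ≠ 0) :
    Integrable fun z : Phase => f z / ‖x - z.1‖ := by
  have hfm := hf.integrable.aemeasurable
  refine ⟨(hfm.div (by fun_prop)).aestronglyMeasurable, ?_⟩
  rw [hasFiniteIntegral_iff_ofReal]
  · have h1 : ∫⁻ z : Phase, ENNReal.ofReal (f z / ‖x - z.1‖) =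
        ∫⁻ z : Phase, ENNReal.ofReal (f z / max ‖x‖ ‖z.1‖) := by
      simp_rw [div_eq_mul_one_div (f _)]
      rw [lintegral_congr_ae (g := fun z =>
        ENNReal.ofReal (f z) * ENNReal.ofReal (1 / ‖x - z.1‖)), hf.lintegral_newton hx]
      · refine lintegral_congr_ae ?_
        filter_upwards [hf.nonneg] with z hz
        rw [ENNReal.ofReal_mul hz]
      · filter_upwards [hf.nonneg] with z hz
        rw [ENNReal.ofReal_mul hz]
    rw [h1]
    exact (integrable_div_max hf.integrable (norm_pos_iff.2 hx)).lintegral_lt_top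
  · filter_upwards [hf.nonneg] with z hz
    positivity

theorem integral_newton (hf : IsSymmetricDensity f) {x : E3} (hx : x ≠ 0) :
    ∫ z : Phase, f z / ‖x - z.1‖ = ∫ z : Phase, f z / max ‖x‖ ‖z.1‖ := by
  rw [integral_eq_lintegral_of_nonneg_ae, integral_eq_lintegral_of_nonneg_ae]
  · congr 1
    simp_rw [div_eq_mul_one_div (f _)]
    rw [lintegral_congr_ae (g := fun z =>
      ENNReal.ofReal (f z) * ENNReal.ofReal (1 / ‖x - z.1‖)), hf.lintegral_newton hx]
    · refine lintegral_congr_ae ?_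
      filter_upwards [hf.nonneg] with z hz
      rw [ENNReal.ofReal_mul hz]
    · filter_upwards [hf.nonneg] with z hz
      rw [ENNReal.ofReal_mul hz]
  · filter_upwards [hf.nonneg] with z hz
    simp only [Pi.zero_apply]; positivity
  · exact (integrable_div_max hf.integrable (norm_pos_iff.2 hx)).aestronglyMeasurable
  · filter_upwards [hf.nonneg] with z hz
    simp only [Pi.zero_apply]; positivity
  · exact (hf.integrable_div_norm_sub hx).aestronglyMeasurable

theorem potential_eq_neg_integral_div_max (hf : IsSymmetricDensity f) {x : E3} (hx : x ≠ 0) :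
    potential f x = -∫ z : Phase, f z / max ‖x‖ ‖z.1‖ := by
  rw [← hf.integral_newton hx, potential, Measure.volume_eq_prod,
    integral_prod _ (by rw [← Measure.volume_eq_prod]; exact hf.integrable_div_norm_sub hx)]
  simp only [density, integral_div]

end IsSymmetricDensity

theorem continuous_cumMass {f : Phase → ℝ} (hf : Integrable f) : Continuous (cumMass f) := by
  have h : cumMass f = fun r => ∫ z, {z : Phase | ‖z.1‖ < r}.indicator f z := by
    ext r; rw [cumMass, integral_indicator (measurableSet_norm_fst_lt r)]
  rw [h, continuous_iff_continuousAt]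
  intro r
  refine continuousAt_of_dominated (bound := fun z => ‖f z‖) ?_ ?_ hf.norm ?_
  · exact Eventually.of_forall fun s =>
      hf.aestronglyMeasurable.indicator (measurableSet_norm_fst_lt s)
  · exact Eventually.of_forall fun s => Eventually.of_forall fun z => norm_indicator_le_norm_self _ _
  · filter_upwards [ae_norm_fst_ne r] with z hz
    refine (continuousAt_const (y := ({z : Phase | ‖z.1‖ < r}.indicator f z))).congr ?_
    rcases lt_or_gt_of_ne hz with h | h
    · filter_upwards [lt_mem_nhds h] with s hs
      simp [indicator, h, hs]
    · filter_upwards [gt_mem_nhds h] with s hs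
      simp [indicator, h.not_gt, hs.not_gt]

theorem cumMass_nonneg {f : Phase → ℝ} (hf : ∀ᵐ z : Phase, 0 ≤ f z) (r : ℝ) : 0 ≤ cumMass f r :=
  setIntegral_nonneg_of_ae hf

theorem monotone_cumMass {f : Phase → ℝ} (hf : Integrable f) (h0 : ∀ᵐ z : Phase, 0 ≤ f z) :
    Monotone (cumMass f) := fun _ _ hrs =>
  setIntegral_mono_set hf.integrableOn (ae_restrict_of_ae h0)
    (Eventually.of_forall fun _ hz => lt_of_lt_of_le hz hrs)

theorem cumMass_le_integral {f : Phase → ℝ} (hf : Integrable f) (h0 : ∀ᵐ z : Phase, 0 ≤ f z)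
    (r : ℝ) : cumMass f r ≤ ∫ z, f z :=
  setIntegral_le_integral hf h0

theorem norm_cumMass_le {f : Phase → ℝ} (r : ℝ) (hf : Integrable f) :
    ‖cumMass f r‖ ≤ ∫ z, ‖f z‖ :=
  (norm_integral_le_integral_norm _).trans
    (setIntegral_le_integral hf.norm (Eventually.of_forall fun _ => norm_nonneg _))

theorem integral_Ioi_inv_sq {a : ℝ} (ha : 0 < a) :
    IntegrableOn (fun r : ℝ => 1 / r ^ 2) (Ioi a) ∧ ∫ r in Ioi a, 1 / r ^ 2 = 1 / a := by
  have h (r : ℝ) : 1 / r ^ 2 = r ^ (-2 : ℝ) := by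
    rw [Real.rpow_neg_ofNat, zpow_neg, one_div]; norm_cast
  simp_rw [h]
  refine ⟨integrableOn_Ioi_rpow_of_lt (by norm_num) ha, ?_⟩
  rw [integral_Ioi_rpow_of_lt (by norm_num) ha]
  norm_num [Real.rpow_neg_one]

/-- Fubini, after writing `1 / max s ‖x‖` as the integral of `1/r²` over `r > s`, `r > ‖x‖`. -/
theorem integral_div_max_eq {f : Phase → ℝ} (hf : Integrable f) {s : ℝ} (hs : 0 < s) :
    ∫ z : Phase, f z / max s ‖z.1‖ = ∫ r in Ioi s, cumMass f r / r ^ 2 := by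
  have hi := (integral_Ioi_inv_sq hs).1
  have hS : MeasurableSet {p : Phase × ℝ | ‖p.1.1‖ < p.2} :=
    measurableSet_lt (by fun_prop) (by fun_prop)
  have hint : Integrable (fun p : Phase × ℝ => {p : Phase × ℝ | ‖p.1.1‖ < p.2}.indicator
      (fun p => f p.1 * (1 / p.2 ^ 2)) p) (volume.prod (volume.restrict (Ioi s))) :=
    (hf.mul_prod hi).indicator hS
  have h1 (r : ℝ) : cumMass f r / r ^ 2 = ∫ z : Phase, {p : Phase × ℝ | ‖p.1.1‖ < p.2}.indicator
      (fun p => f p.1 * (1 / p.2 ^ 2)) (z, r) := by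
    rw [cumMass, ← integral_indicator (measurableSet_norm_fst_lt r), ← integral_div]
    congr 1; ext z
    by_cases h : ‖z.1‖ < r <;> simp [indicator, h, div_eq_mul_inv]
  simp_rw [h1]
  rw [← integral_integral_swap hint]
  congr 1; ext z
  have h2 : ∀ r ∈ Ioi s, {p : Phase × ℝ | ‖p.1.1‖ < p.2}.indicator
      (fun p => f p.1 * (1 / p.2 ^ 2)) (z, r) =
      (Ioi ‖z.1‖).indicator (fun r => f z * (1 / r ^ 2)) r := by
    intro r _
    by_cases h : ‖z.1‖ < r <;> simp [indicator, h]
  rw [setIntegral_congr_fun measurableSet_Ioi h2, setIntegral_indicator measurableSet_Ioi,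
    Ioi_inter_Ioi, integral_const_mul, (integral_Ioi_inv_sq (lt_sup_of_lt_left hs)).2]
  rw [div_eq_mul_one_div]

theorem IsSymmetricDensity.potential_eq {f : Phase → ℝ} (hf : IsSymmetricDensity f) {x : E3}
    (hx : x ≠ 0) : potential f x = -∫ r in Ioi ‖x‖, cumMass f r / r ^ 2 := by
  rw [hf.potential_eq_neg_integral_div_max hx,
    integral_div_max_eq hf.integrable (norm_pos_iff.2 hx)]

theorem integrableOn_cumMass_div_sq {f : Phase → ℝ} (hf : Integrable f) {a : ℝ} (ha : 0 < a) :
    IntegrableOn (fun r => cumMass f r / r ^ 2) (Ioi a) := by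
  refine Integrable.mono' ((integral_Ioi_inv_sq ha).1.const_mul (∫ z, ‖f z‖)) ?_ ?_
  · exact ((continuous_cumMass hf).measurable.div (by fun_prop)).aestronglyMeasurable
  · refine Eventually.of_forall fun r => ?_
    rw [norm_div, div_eq_mul_one_div, norm_pow, Real.norm_eq_abs r, sq_abs]
    exact mul_le_mul_of_nonneg_right (norm_cumMass_le r hf) (by positivity)

theorem hasDerivAt_integral_Ioi_cumMass {f : Phase → ℝ} (hf : Integrable f) {s : ℝ} (hs : 0 < s) :
    HasDerivAt (fun s => ∫ r in Ioi s, cumMass f r / r ^ 2) (-(cumMass f s / s ^ 2)) s := by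
  have hint := integrableOn_cumMass_div_sq hf (half_pos hs)
  have h1 : (fun s => ∫ r in Ioi s, cumMass f r / r ^ 2) =ᶠ[𝓝 s]
      fun t => (∫ r in Ioi (s / 2), cumMass f r / r ^ 2) -
        ∫ r in (s / 2)..t, cumMass f r / r ^ 2 := by
    filter_upwards [lt_mem_nhds (half_lt_self hs)] with t ht
    rw [eq_sub_iff_add_eq, add_comm]
    exact intervalIntegral.integral_interval_add_Ioi hint (hint.mono_set (Ioi_subset_Ioi ht.le))
  refine HasDerivAt.congr_of_eventuallyEq ?_ h1
  refine (intervalIntegral.integral_hasDerivAt_right ?_ ?_ ?_).const_sub _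
  · rw [intervalIntegrable_iff_integrableOn_Ioc_of_le (half_lt_self hs).le]
    exact hint.mono_set Ioc_subset_Ioi_self
  · exact ((continuous_cumMass hf).measurable.div
      (by fun_prop)).stronglyMeasurable.stronglyMeasurableAtFilter
  · exact (continuous_cumMass hf).continuousAt.div (by fun_prop) (by positivity)

theorem IsSymmetricDensity.gradPot_eq {f : Phase → ℝ} (hf : IsSymmetricDensity f) {x : E3}
    (hx : x ≠ 0) : gradPot f x = (cumMass f ‖x‖ / ‖x‖ ^ 3) • x := by
  have hs : 0 < ‖x‖ := norm_pos_iff.2 hx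
  have hq : 0 < ‖x‖ ^ 2 := by positivity
  -- The radius is written as `√(‖y‖²)` so that the chain rule meets only the smooth function `‖y‖²`
  -- and the square root at a positive point.
  have h1 : potential f =ᶠ[𝓝 x] fun y => -∫ r in Ioi √(‖y‖ ^ 2), cumMass f r / r ^ 2 := by
    filter_upwards [isOpen_ne.mem_nhds hx] with y hy
    rw [hf.potential_eq hy, Real.sqrt_sq (norm_nonneg _)]
  have h2 : HasDerivAt (fun q => -∫ r in Ioi √q, cumMass f r / r ^ 2)
      (cumMass f ‖x‖ / ‖x‖ ^ 2 * (1 / (2 * ‖x‖))) (‖x‖ ^ 2) := by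
    have h3 := (Real.hasDerivAt_sqrt hq.ne')
    have h4 : HasDerivAt (fun s => -∫ r in Ioi s, cumMass f r / r ^ 2)
      (cumMass f ‖x‖ / ‖x‖ ^ 2) (√(‖x‖ ^ 2)) := by
      rw [Real.sqrt_sq hs.le]
      exact (hasDerivAt_integral_Ioi_cumMass hf.integrable hs).neg.congr_deriv (neg_neg _)
    have := h4.comp _ h3
    rwa [Real.sqrt_sq hs.le] at this
  have h5 := h2.comp_hasFDerivAt x (hasStrictFDerivAt_norm_sq x).hasFDerivAt
  have h6 : HasGradientAt (potential f) ((cumMass f ‖x‖ / ‖x‖ ^ 3) • x) x := by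
    rw [hasGradientAt_iff_hasFDerivAt]
    refine (h5.congr_of_eventuallyEq h1).congr_fderiv ?_
    ext y
    simp
    field_simp
  exact h6.gradient

end VlasovPoisson

/-! ### The interaction form and the field energy. -/

namespace VlasovPoisson

/-- The mutual interaction energy of two radial mass distributions,
`∫_0^∞ m_f(r) m_g(r) / r² dr = ∬ f(z) g(z') / max(|x|, |x'|) dz dz'`. -/
noncomputable def interaction (f g : Phase → ℝ) : ℝ :=
  ∫ r in Ioi (0 : ℝ), cumMass f r * cumMass g r / r ^ 2

/-- The field `∇ U_f` is square integrable. -/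
def FiniteField (f : Phase → ℝ) : Prop :=
  IntegrableOn (fun r => cumMass f r ^ 2 / r ^ 2) (Ioi 0)

theorem cumMass_add {f g : Phase → ℝ} (hf : Integrable f) (hg : Integrable g) (r : ℝ) :
    cumMass (f + g) r = cumMass f r + cumMass g r :=
  integral_add hf.integrableOn hg.integrableOn

theorem cumMass_sub {f g : Phase → ℝ} (hf : Integrable f) (hg : Integrable g) (r : ℝ) :
    cumMass (f - g) r = cumMass f r - cumMass g r :=
  integral_sub hf.integrableOn hg.integrableOn

theorem cumMass_smul (c : ℝ) (f : Phase → ℝ) (r : ℝ) : cumMass (c • f) r = c * cumMass f r :=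
  integral_const_mul c _

theorem cumMass_congr {f g : Phase → ℝ} (h : f =ᵐ[volume] g) (r : ℝ) :
    cumMass f r = cumMass g r :=
  integral_congr_ae (ae_restrict_of_ae h)

theorem interaction_comm (f g : Phase → ℝ) : interaction f g = interaction g f := by
  simp only [interaction, mul_comm]

theorem interaction_self_nonneg (f : Phase → ℝ) : 0 ≤ interaction f f :=
  setIntegral_nonneg measurableSet_Ioi fun r _ => by
    have := mul_self_nonneg (cumMass f r); positivity

theorem FiniteField.integrableOn_mul {f g : Phase → ℝ} (hf : FiniteField f) (hg : FiniteField g)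
    (hfi : Integrable f) (hgi : Integrable g) :
    IntegrableOn (fun r => cumMass f r * cumMass g r / r ^ 2) (Ioi 0) := by
  refine Integrable.mono' (Integrable.add hf hg) ?_ (Eventually.of_forall fun r => ?_)
  · exact ((((continuous_cumMass hfi).mul (continuous_cumMass hgi)).measurable).div
      (by fun_prop)).aestronglyMeasurable
  · simp only [Pi.add_apply]
    rw [← add_div, norm_div, norm_mul, norm_pow, Real.norm_eq_abs r, sq_abs]
    gcongr
    rw [← sq_abs (cumMass f r), ← sq_abs (cumMass g r), Real.norm_eq_abs, Real.norm_eq_abs]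
    nlinarith [sq_nonneg (|cumMass f r| - |cumMass g r|), sq_nonneg (cumMass f r),
      sq_nonneg (cumMass g r), sq_abs (cumMass f r), sq_abs (cumMass g r)]

theorem FiniteField.add {f g : Phase → ℝ} (hf : FiniteField f) (hg : FiniteField g)
    (hfi : Integrable f) (hgi : Integrable g) : FiniteField (f + g) := by
  have h := (Integrable.add hf hg).add ((hf.integrableOn_mul hg hfi hgi).const_mul 2)
  refine h.congr (Eventually.of_forall fun r => ?_)
  simp only [Pi.add_apply, cumMass_add hfi hgi]
  ring

theorem FiniteField.smul {f : Phase → ℝ} (hf : FiniteField f) (c : ℝ) : FiniteField (c • f) := by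
  refine (Integrable.const_mul hf (c ^ 2)).congr (Eventually.of_forall fun r => ?_)
  simp only [cumMass_smul]
  ring

theorem FiniteField.sub {f g : Phase → ℝ} (hf : FiniteField f) (hg : FiniteField g)
    (hfi : Integrable f) (hgi : Integrable g) : FiniteField (f - g) := by
  rw [sub_eq_add_neg, ← neg_one_smul ℝ g]
  exact hf.add (hg.smul _) hfi (hgi.smul _)

theorem interaction_add_left {f g h : Phase → ℝ} (hf : FiniteField f) (hg : FiniteField g)
    (hh : FiniteField h) (hfi : Integrable f) (hgi : Integrable g) (hhi : Integrable h) :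
    interaction (f + g) h = interaction f h + interaction g h := by
  rw [interaction, interaction, interaction,
    ← integral_add (hf.integrableOn_mul hh hfi hhi) (hg.integrableOn_mul hh hgi hhi)]
  congr 1; ext r
  rw [cumMass_add hfi hgi]; ring

theorem interaction_smul_left (c : ℝ) (f h : Phase → ℝ) :
    interaction (c • f) h = c * interaction f h := by
  rw [interaction, interaction, ← integral_const_mul]
  congr 1; ext r
  rw [cumMass_smul]; ring

theorem interaction_sub_left {f g h : Phase → ℝ} (hf : FiniteField f) (hg : FiniteField g)
    (hh : FiniteField h) (hfi : Integrable f) (hgi : Integrable g) (hhi : Integrable h) :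
    interaction (f - g) h = interaction f h - interaction g h := by
  rw [sub_eq_add_neg, ← neg_one_smul ℝ g,
    interaction_add_left hf (hg.smul _) hh hfi (hgi.smul _) hhi, interaction_smul_left]
  ring

/-- The parallelogram-type expansion of the field energy. -/
theorem interaction_sub_self {f g : Phase → ℝ} (hf : FiniteField f) (hg : FiniteField g)
    (hfi : Integrable f) (hgi : Integrable g) :
    interaction (f - g) (f - g) =
      interaction f f - 2 * interaction f g + interaction g g := by
  rw [interaction_sub_left hf hg (hf.sub hg hfi hgi) hfi hgi (hfi.sub hgi),
    interaction_comm f, interaction_comm g, interaction_sub_left hf hg hf hfi hgi hfi,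
    interaction_sub_left hf hg hg hfi hgi hgi, interaction_comm g f]
  ring

theorem interaction_comb {f g : Phase → ℝ} (hf : FiniteField f) (hg : FiniteField g)
    (hfi : Integrable f) (hgi : Integrable g) (a b : ℝ) :
    interaction (a • f + b • g) (a • f + b • g) =
      a ^ 2 * interaction f f + 2 * a * b * interaction f g + b ^ 2 * interaction g g := by
  have hfa := hf.smul a
  have hgb := hg.smul b
  have hia := hfi.smul a
  have hib := hgi.smul b
  rw [interaction_add_left hfa hgb (hfa.add hgb hia hib) hia hib (hia.add hib),
    interaction_smul_left, interaction_smul_left, interaction_comm f, interaction_comm g,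
    interaction_add_left hfa hgb hf hia hib hfi, interaction_add_left hfa hgb hg hia hib hgi,
    interaction_smul_left, interaction_smul_left, interaction_smul_left, interaction_smul_left,
    interaction_comm g f]
  ring

section Field

variable {f g : Phase → ℝ}

theorem sq_norm_gradPot_sub_ae (hf : IsSymmetricDensity f) (hg : IsSymmetricDensity g) :
    ∀ᵐ x : E3, ‖gradPot f x - gradPot g x‖ ^ 2 = cumMass (f - g) ‖x‖ ^ 2 / ‖x‖ ^ 4 := by
  filter_upwards [Measure.ae_ne volume (0 : E3)] with x hx
  have hx' : ‖x‖ ≠ 0 := norm_ne_zero_iff.2 hx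
  rw [hf.gradPot_eq hx, hg.gradPot_eq hx, ← sub_smul, norm_smul, mul_pow, Real.norm_eq_abs, sq_abs,
    cumMass_sub hf.integrable hg.integrable]
  field_simp

theorem sq_norm_gradPot_ae (hf : IsSymmetricDensity f) :
    ∀ᵐ x : E3, ‖gradPot f x‖ ^ 2 = cumMass f ‖x‖ ^ 2 / ‖x‖ ^ 4 := by
  filter_upwards [Measure.ae_ne volume (0 : E3)] with x hx
  have hx' : ‖x‖ ≠ 0 := norm_ne_zero_iff.2 hx
  rw [hf.gradPot_eq hx, norm_smul, mul_pow, Real.norm_eq_abs, sq_abs]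
  field_simp

theorem integral_radial_field (f : Phase → ℝ) :
    ∫ x : E3, cumMass f ‖x‖ ^ 2 / ‖x‖ ^ 4 = 4 * Real.pi * interaction f f := by
  rw [integral_fun_norm_addHaar volume (fun r => cumMass f r ^ 2 / r ^ 4)]
  have hb : (volume : Measure E3).real (Metric.ball 0 1) = Real.pi * 4 / 3 := by
    rw [Measure.real, EuclideanSpace.volume_ball_fin_three]
    simp
    positivity
  have h1 : ∫ y in Ioi (0 : ℝ), y ^ (Module.finrank ℝ E3 - 1) • (cumMass f y ^ 2 / y ^ 4) =
      interaction f f := by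
    refine setIntegral_congr_fun measurableSet_Ioi fun r hr => ?_
    have : r ≠ 0 := (mem_Ioi.1 hr).ne'
    simp only [finrank_euclideanSpace, Fintype.card_fin, smul_eq_mul]
    field_simp
    norm_num
    ring
  rw [h1, hb]
  simp only [finrank_euclideanSpace, Fintype.card_fin, nsmul_eq_mul, smul_eq_mul]
  push_cast; ring

theorem integral_sq_norm_gradPot_sub (hf : IsSymmetricDensity f) (hg : IsSymmetricDensity g) :
    ∫ x : E3, ‖gradPot f x - gradPot g x‖ ^ 2 = 4 * Real.pi * interaction (f - g) (f - g) := by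
  rw [integral_congr_ae (sq_norm_gradPot_sub_ae hf hg), integral_radial_field]

theorem integral_sq_norm_gradPot (hf : IsSymmetricDensity f) :
    ∫ x : E3, ‖gradPot f x‖ ^ 2 = 4 * Real.pi * interaction f f := by
  rw [integral_congr_ae (sq_norm_gradPot_ae hf), integral_radial_field]

theorem memLp_gradPot_sub (hf : IsSymmetricDensity f) (hg : IsSymmetricDensity g)
    (hff : FiniteField f) (hgf : FiniteField g) :
    MemLp (fun x => gradPot f x - gradPot g x) 2 := by
  have hm : AEStronglyMeasurable (fun x => gradPot f x - gradPot g x) := by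
    have : Measurable fun x : E3 => (cumMass (f - g) ‖x‖ / ‖x‖ ^ 3) • x := by
      have := (continuous_cumMass (hf.integrable.sub hg.integrable)).measurable
      fun_prop
    refine this.aestronglyMeasurable.congr ?_
    filter_upwards [Measure.ae_ne volume (0 : E3)] with x hx
    rw [hf.gradPot_eq hx, hg.gradPot_eq hx, ← sub_smul, cumMass_sub hf.integrable hg.integrable,
      sub_div]
  rw [← integrable_norm_rpow_iff hm (by norm_num) (by norm_num)]
  have h2 : ∀ x, ‖gradPot f x - gradPot g x‖ ^ (2 : ℝ≥0∞).toReal =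
      ‖gradPot f x - gradPot g x‖ ^ 2 := fun x => by simp
  simp_rw [h2]
  rw [integrable_congr (sq_norm_gradPot_sub_ae hf hg),
    integrable_fun_norm_addHaar volume (f := fun r => cumMass (f - g) r ^ 2 / r ^ 4)]
  refine (hff.sub hgf hf.integrable hg.integrable).congr_fun (fun r hr => ?_) measurableSet_Ioi
  have : r ≠ 0 := (mem_Ioi.1 hr).ne'
  simp only [finrank_euclideanSpace, Fintype.card_fin, smul_eq_mul]
  field_simp

/-- `∬ U_f g dv dx = - ∬ f(z) g(z') / max(|x|, |x'|) dz dz'`, with absolute convergence. -/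
theorem integral_potential_mul (hf : IsSymmetricDensity f) (hg : IsSymmetricDensity g)
    (hff : FiniteField f) (hgf : FiniteField g) :
    Integrable (fun z : Phase => potential f z.1 * g z) ∧
      ∫ z : Phase, potential f z.1 * g z = -interaction f g := by
  set S : Set (Phase × ℝ) := {p : Phase × ℝ | ‖p.1.1‖ < p.2}
  have hS : MeasurableSet S := measurableSet_lt (by fun_prop) (by fun_prop)
  -- Integrating `F` over `r` gives `-U_f g`; integrating it over `z` gives `m_f m_g / r²`. Since `F
  -- ≥ 0` almost everywhere, integrability of the latter is what Fubini requires.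
  set F : Phase × ℝ → ℝ := S.indicator (fun p => g p.1 * (cumMass f p.2 / p.2 ^ 2)) with hF
  have hFm : AEStronglyMeasurable F (volume.prod (volume.restrict (Ioi 0))) := by
    refine AEStronglyMeasurable.indicator ?_ hS
    have : Measurable fun r => cumMass f r / r ^ 2 :=
      (continuous_cumMass hf.integrable).measurable.div (by fun_prop)
    exact (hg.integrable.aestronglyMeasurable.comp_quasiMeasurePreserving
      Measure.quasiMeasurePreserving_fst).mul
      (this.aestronglyMeasurable.comp_quasiMeasurePreserving
        Measure.quasiMeasurePreserving_snd)
  have hsec (r : ℝ) : (fun z : Phase => F (z, r)) = {z : Phase | ‖z.1‖ < r}.indicator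
      (fun z => g z * (cumMass f r / r ^ 2)) := by
    ext z
    by_cases h : ‖z.1‖ < r <;> simp [hF, S, indicator, h]
  have hsi (r : ℝ) : Integrable (fun z : Phase => F (z, r)) := by
    rw [hsec]
    exact (hg.integrable.mul_const _).indicator (measurableSet_norm_fst_lt r)
  have hint (r : ℝ) : ∫ z, F (z, r) = cumMass f r * cumMass g r / r ^ 2 := by
    rw [hsec, integral_indicator (measurableSet_norm_fst_lt r), integral_mul_const, ← cumMass]
    ring
  have hFi : Integrable F (volume.prod (volume.restrict (Ioi 0))) := by
    rw [integrable_prod_iff' hFm]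
    refine ⟨Eventually.of_forall hsi, ?_⟩
    refine (hff.integrableOn_mul hgf hf.integrable hg.integrable).congr ?_
    refine Eventually.of_forall fun r => ?_
    refine (hint r).symm.trans (integral_congr_ae ?_)
    filter_upwards [hg.nonneg] with z hz
    rw [Real.norm_of_nonneg]
    have := cumMass_nonneg hf.nonneg r
    rw [hF, indicator]
    split_ifs
    · positivity
    · exact le_rfl
  have hleft : (fun z : Phase => ∫ r in Ioi 0, F (z, r)) =ᵐ[volume]
      fun z => -(potential f z.1 * g z) := by
    filter_upwards [ae_norm_fst_ne 0] with z hz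
    have h2 : ∀ r, F (z, r) =
      (Ioi ‖z.1‖).indicator (fun r => g z * (cumMass f r / r ^ 2)) r := by
      intro r
      by_cases h : ‖z.1‖ < r <;> simp [hF, S, indicator, h]
    simp_rw [h2]
    rw [setIntegral_indicator measurableSet_Ioi, Ioi_inter_Ioi, max_eq_right (norm_nonneg _),
      integral_const_mul, hf.potential_eq (norm_ne_zero_iff.1 hz)]
    ring
  have h1 := hFi.integral_prod_left
  refine ⟨(h1.congr hleft).neg.congr (Eventually.of_forall fun z => neg_neg _), ?_⟩
  have h2 := integral_integral_swap (f := fun z r => F (z, r)) hFi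
  rw [integral_congr_ae hleft, integral_neg] at h2
  simp_rw [hint] at h2
  rw [interaction, ← h2, neg_neg]

end Field

end VlasovPoisson

/-! ### The Casimir integrand, and concentration of mass near the origin. -/

namespace VlasovPoisson

theorem angMom_nonneg (z : Phase) : 0 ≤ angMom z := by
  rw [angMom, sub_nonneg, ← mul_pow, sq_le_sq]
  rw [abs_of_nonneg (by positivity : 0 ≤ ‖z.1‖ * ‖z.2‖)]
  exact abs_real_inner_le_norm _ _

theorem continuous_angMom : Continuous angMom := by
  unfold angMom; fun_prop

theorem angMom_smul (b c : ℝ) (z : Phase) :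
    angMom (b • z.1, c • z.2) = (b * c) ^ 2 * angMom z := by
  simp only [angMom, norm_smul, inner_smul_left, inner_smul_right, mul_pow, Real.norm_eq_abs,
    sq_abs, conj_trivial]
  ring

variable {Q : ℝ → ℝ → ℝ}

theorem IsCasimirIntegrand.continuous_max (hQ : IsCasimirIntegrand Q) :
    Continuous fun p : ℝ × ℝ => Q (max p.1 0) (max p.2 0) :=
  hQ.continuousOn.comp_continuous (f := fun p : ℝ × ℝ => (max p.1 0, max p.2 0)) (by fun_prop)
    fun p => ⟨mem_Ici.2 (le_max_right p.1 0), mem_Ici.2 (le_max_right p.2 0)⟩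

theorem IsCasimirIntegrand.aestronglyMeasurable (hQ : IsCasimirIntegrand Q) {f : Phase → ℝ}
    (hf : AEStronglyMeasurable f) (h0 : ∀ᵐ z : Phase, 0 ≤ f z) :
    AEStronglyMeasurable fun z : Phase => Q (f z) (angMom z) := by
  have h1 : AEStronglyMeasurable (fun z : Phase => Q (max (f z) 0) (max (angMom z) 0)) :=
    hQ.continuous_max.comp_aestronglyMeasurable
      (hf.prodMk continuous_angMom.aestronglyMeasurable)
  refine h1.congr ?_
  filter_upwards [h0] with z hz
  rw [max_eq_left hz, max_eq_left (angMom_nonneg z)]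

theorem IsCasimirIntegrand.strictConvexOn (hQ : IsCasimirIntegrand Q) (hQ4 : Q4 Q) {L : ℝ}
    (hL : 0 ≤ L) : StrictConvexOn ℝ (Ici 0) fun s => Q s L := by
  refine strictConvexOn_of_deriv2_pos (convex_Ici 0) (hQ.differentiableOn L hL).continuousOn ?_
  intro x hx
  rw [interior_Ici] at hx
  have hx' : 0 < x := hx
  have h1 : deriv (fun s => Q s L) =ᶠ[𝓝 x] fun s => dQ Q s L := by
    filter_upwards [lt_mem_nhds hx'] with s hs
    rw [dQ, derivWithin_of_mem_nhds (Ici_mem_nhds hs)]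
  rw [Function.iterate_succ, Function.iterate_one, Function.comp_apply, h1.deriv_eq]
  exact hQ4.1 x L hx' hL

theorem casimir_zero (hQ : IsCasimirIntegrand Q) {C₂ F₀ μ₂ : ℝ} (hF₀ : 0 < F₀) (hμ₂ : 0 < μ₂)
    (hQ2 : Q2 Q C₂ F₀ μ₂) {L : ℝ} (hL : 0 ≤ L) : Q 0 L = 0 := by
  refine le_antisymm ?_ (hQ.nonneg 0 L le_rfl hL)
  have := hQ2 0 L le_rfl hF₀.le hL
  rwa [Real.zero_rpow (by positivity), mul_zero] at this

namespace MemFM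

variable {M : ℝ} {f g : Phase → ℝ}

theorem isSymmetricDensity (hf : MemFM Q M f) : IsSymmetricDensity f :=
  ⟨hf.integrable, hf.nonneg, hf.symmetric⟩

theorem casimir_nonneg (hf : MemFM Q M f) (hQ : IsCasimirIntegrand Q) :
    ∀ᵐ z : Phase, 0 ≤ Q (f z) (angMom z) := by
  filter_upwards [hf.nonneg] with z hz
  exact hQ.nonneg _ _ hz (angMom_nonneg z)

theorem kinetic_nonneg (hf : MemFM Q M f) : ∀ᵐ z : Phase, 0 ≤ ‖z.2‖ ^ 2 * f z := by
  filter_upwards [hf.nonneg] with z hz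
  positivity

theorem integral_casimir_le_J (hf : MemFM Q M f) : ∫ z : Phase, Q (f z) (angMom z) ≤ J Q f := by
  have := integral_nonneg_of_ae hf.kinetic_nonneg
  rw [J]; linarith

theorem integral_kinetic_le_J (hf : MemFM Q M f) (hQ : IsCasimirIntegrand Q) :
    ∫ z : Phase, ‖z.2‖ ^ 2 * f z ≤ 2 * J Q f := by
  have := integral_nonneg_of_ae (hf.casimir_nonneg hQ)
  rw [J]; linarith

theorem J_nonneg (hf : MemFM Q M f) (hQ : IsCasimirIntegrand Q) : 0 ≤ J Q f :=
  (integral_nonneg_of_ae (hf.casimir_nonneg hQ)).trans hf.integral_casimir_le_J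

theorem mass_nonneg (hf : MemFM Q M f) : 0 ≤ M :=
  hf.mass ▸ integral_nonneg_of_ae hf.nonneg

theorem cumMass_nonneg (hf : MemFM Q M f) (r : ℝ) : 0 ≤ cumMass f r :=
  VlasovPoisson.cumMass_nonneg hf.nonneg r

theorem cumMass_le (hf : MemFM Q M f) (r : ℝ) : cumMass f r ≤ M :=
  hf.mass ▸ cumMass_le_integral hf.integrable hf.nonneg r

end MemFM

/-- Pointwise splitting of a density into a bounded part, a fast part and a part controlled by the
Casimir integrand. -/
theorem le_truncation {C₁ F₀ μ₁ : ℝ} (hC₁ : 0 < C₁) (hF₀ : 0 < F₀) (hμ₁ : 0 < μ₁)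
    (hQ : IsCasimirIntegrand Q) (hQ1 : Q1 Q C₁ F₀ μ₁) {A w s : ℝ} (hA : F₀ ≤ A) (hw : 0 < w)
    (hs : 0 ≤ s) (z : Phase) :
    s ≤ (if ‖z.2‖ < w then min s A else 0) + 1 / w ^ 2 * (‖z.2‖ ^ 2 * s) +
      A ^ (-(1 / μ₁)) / C₁ * Q s (angMom z) := by
  have hA0 : 0 < A := hF₀.trans_le hA
  have hQn := hQ.nonneg s _ hs (angMom_nonneg z)
  have hApos : 0 < A ^ (-(1 / μ₁)) := Real.rpow_pos_of_pos hA0 _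
  split_ifs with h
  · have h2 : 0 ≤ 1 / w ^ 2 * (‖z.2‖ ^ 2 * s) := by positivity
    rcases le_total s A with hsA | hsA
    · rw [min_eq_left hsA]
      have : 0 ≤ A ^ (-(1 / μ₁)) / C₁ * Q s (angMom z) := by positivity
      linarith
    · rw [min_eq_right hsA]
      have hs0 : 0 < s := hA0.trans_le hsA
      have h3 := hQ1 s (angMom z) (hA.trans hsA) (angMom_nonneg z)
      have h4 : s = s ^ (-(1 / μ₁)) * s ^ (1 + 1 / μ₁) := by
        rw [← Real.rpow_add hs0]; simp
      have h5 : s ^ (-(1 / μ₁)) ≤ A ^ (-(1 / μ₁)) :=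
        Real.rpow_le_rpow_of_nonpos hA0 hsA (by rw [neg_nonpos]; positivity)
      have h6 : s ≤ A ^ (-(1 / μ₁)) / C₁ * Q s (angMom z) := by
        calc s = s ^ (-(1 / μ₁)) * s ^ (1 + 1 / μ₁) := h4
          _ ≤ A ^ (-(1 / μ₁)) * (Q s (angMom z) / C₁) := by
            have : s ^ (1 + 1 / μ₁) ≤ Q s (angMom z) / C₁ := by
              rw [le_div_iff₀ hC₁]; linarith
            gcongr
          _ = _ := by ring
      linarith
  · have h2 : s ≤ 1 / w ^ 2 * (‖z.2‖ ^ 2 * s) := by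
      have : w ^ 2 ≤ ‖z.2‖ ^ 2 := by gcongr; exact not_lt.1 h
      rw [← mul_assoc, one_div_mul_eq_div]
      refine le_mul_of_one_le_left hs ?_
      rwa [one_le_div (by positivity)]
    have : 0 ≤ A ^ (-(1 / μ₁)) / C₁ * Q s (angMom z) := by positivity
    linarith

theorem measureReal_prod_ball_lt (S : Set E3) (w : ℝ) :
    volume.real (S ×ˢ Metric.ball (0 : E3) w : Set Phase) =
      volume.real S * volume.real (Metric.ball (0 : E3) w) := by
  rw [Measure.volume_eq_prod, Measure.real, Measure.prod_prod, ENNReal.toReal_mul]; rfl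

theorem volume_real_ball (r : ℝ) (hr : 0 ≤ r) :
    volume.real (Metric.ball (0 : E3) r) = 4 * Real.pi / 3 * r ^ 3 := by
  rw [Measure.real, EuclideanSpace.volume_ball_fin_three, ENNReal.toReal_mul, ← ENNReal.ofReal_pow hr,
    ENNReal.toReal_ofReal (by positivity), ENNReal.toReal_ofReal (by positivity)]
  ring

theorem MemFM.setIntegral_le {M : ℝ} {f : Phase → ℝ} (hf : MemFM Q M f)
    {C₁ F₀ μ₁ : ℝ} (hC₁ : 0 < C₁) (hF₀ : 0 < F₀) (hμ₁ : 0 < μ₁)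
    (hQ : IsCasimirIntegrand Q) (hQ1 : Q1 Q C₁ F₀ μ₁) {A w : ℝ} (hA : F₀ ≤ A) (hw : 0 < w)
    {S : Set E3} (hS : MeasurableSet S) (hSf : volume S ≠ ∞) :
    ∫ z in {z : Phase | z.1 ∈ S}, f z ≤
      A * (volume.real S * (4 * Real.pi / 3 * w ^ 3)) + 1 / w ^ 2 * (2 * J Q f) +
        A ^ (-(1 / μ₁)) / C₁ * J Q f := by
  have hA0 : 0 < A := hF₀.trans_le hA
  have hAp : 0 < A ^ (-(1 / μ₁)) := Real.rpow_pos_of_pos hA0 _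
  have hT : MeasurableSet (S ×ˢ Metric.ball (0 : E3) w : Set Phase) := hS.prod measurableSet_ball
  have hTf : volume (S ×ˢ Metric.ball (0 : E3) w : Set Phase) ≠ ∞ := by
    rw [Measure.volume_eq_prod, Measure.prod_prod]
    exact ENNReal.mul_ne_top hSf measure_ball_lt_top.ne
  have hmS : MeasurableSet {z : Phase | z.1 ∈ S} := measurable_fst hS
  have hi1 : Integrable ((S ×ˢ Metric.ball (0 : E3) w : Set Phase).indicator fun _ => A) :=
    (integrableOn_const hTf).integrable_indicator hT
  have hi2 := hf.integrable_kinetic.const_mul (1 / w ^ 2)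
  have hi3 := hf.integrable_casimir.const_mul (A ^ (-(1 / μ₁)) / C₁)
  have hi12 : Integrable fun z => (S ×ˢ Metric.ball (0 : E3) w : Set Phase).indicator
      (fun _ => A) z + 1 / w ^ 2 * (‖z.2‖ ^ 2 * f z) := hi1.add hi2
  calc ∫ z in {z : Phase | z.1 ∈ S}, f z
      = ∫ z, {z : Phase | z.1 ∈ S}.indicator f z := (integral_indicator hmS).symm
    _ ≤ ∫ z, ((S ×ˢ Metric.ball (0 : E3) w : Set Phase).indicator (fun _ => A) z +
          1 / w ^ 2 * (‖z.2‖ ^ 2 * f z)) + A ^ (-(1 / μ₁)) / C₁ * Q (f z) (angMom z) := by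
        refine integral_mono_ae (hf.integrable.indicator hmS) (hi12.add hi3) ?_
        filter_upwards [hf.nonneg] with z hz
        have h1 := le_truncation hC₁ hF₀ hμ₁ hQ hQ1 hA hw hz z
        have h2 := hQ.nonneg _ _ hz (angMom_nonneg z)
        by_cases hzS : z.1 ∈ S
        · refine (le_of_eq ?_).trans (h1.trans ?_)
          · simp [indicator, hzS]
          · gcongr
            split_ifs with h
            · simp [indicator, hzS, h]
            · exact indicator_nonneg (fun _ _ => hA0.le) _
        · have h3 : 0 ≤ (S ×ˢ Metric.ball (0 : E3) w : Set Phase).indicator (fun _ => A) z :=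
            indicator_nonneg (fun _ _ => hA0.le) _
          simp only [indicator, mem_ofPred_eq, hzS, if_false] at h3 ⊢
          positivity
    _ = A * (volume.real S * (4 * Real.pi / 3 * w ^ 3)) +
          1 / w ^ 2 * (∫ z : Phase, ‖z.2‖ ^ 2 * f z) +
          A ^ (-(1 / μ₁)) / C₁ * ∫ z : Phase, Q (f z) (angMom z) := by
        rw [integral_add hi12 hi3, integral_add hi1 hi2, integral_const_mul,
          integral_const_mul, integral_indicator_const _ hT, measureReal_prod_ball_lt,
          volume_real_ball w hw.le, smul_eq_mul]
        ring
    _ ≤ _ := by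
        gcongr
        · exact hf.integral_kinetic_le_J hQ
        · exact hf.integral_casimir_le_J

/-- Apply the truncation bound on the ball of radius `r` and optimize the cutoffs. With `Y = 1 + J`
and `X = Y / r³`, taking `w = X^(θ/2)` and `A` proportional to `X^(θ μ₁)` makes the fast part and
the high part of order `Y X^(-θ)`. The bulk term `A r³ w³` has the same order exactly when `θ (μ₁ +
5/2) = 1`, which determines `θ`. -/
theorem exists_cumMass_le {C₁ F₀ μ₁ : ℝ} (hC₁ : 0 < C₁) (hF₀ : 0 < F₀) (hμ₁ : 0 < μ₁)
    (hQ : IsCasimirIntegrand Q) (hQ1 : Q1 Q C₁ F₀ μ₁) :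
    ∃ C, 0 < C ∧ ∀ (M : ℝ) (f : Phase → ℝ), MemFM Q M f → ∀ r, 0 < r → r ≤ 1 →
      cumMass f r ≤ C * (1 + J Q f) ^ (1 - 2 / (2 * μ₁ + 5)) * r ^ (3 * (2 / (2 * μ₁ + 5))) := by
  set θ := 2 / (2 * μ₁ + 5) with hθ
  have hθ0 : 0 < θ := by positivity
  -- At least `F₀`, so that the lower bound on `Q` applies above the cutoff; at least `1`, so that
  -- `F₁ ^ (-(1/μ₁)) ≤ 1`.
  set F₁ := max F₀ 1
  have hF₁ : 1 ≤ F₁ := le_max_right _ _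
  refine ⟨F₁ * (4 * Real.pi / 3) ^ 2 + 2 + 1 / C₁, by positivity, fun M f hf r hr hr1 => ?_⟩
  have hJ := hf.J_nonneg hQ
  set Y := 1 + J Q f with hY
  have hY1 : 1 ≤ Y := by linarith
  have hY0 : 0 < Y := by linarith
  set X := Y / r ^ 3 with hX
  have hX1 : 1 ≤ X := by
    rw [hX, one_le_div (by positivity)]
    exact (pow_le_one₀ hr.le hr1).trans hY1
  have hX0 : 0 < X := by linarith
  have hw : 0 < X ^ (θ / 2) := Real.rpow_pos_of_pos hX0 _
  have hXA : 1 ≤ X ^ (θ * μ₁) := Real.one_le_rpow hX1 (by positivity)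
  have hA : F₀ ≤ F₁ * X ^ (θ * μ₁) :=
    (le_max_left _ _).trans (le_mul_of_one_le_right (by positivity) hXA)
  have h1 := hf.setIntegral_le hC₁ hF₀ hμ₁ hQ hQ1 hA hw (S := Metric.ball 0 r) measurableSet_ball
    measure_ball_lt_top.ne
  have h2 : {z : Phase | z.1 ∈ Metric.ball (0 : E3) r} = {z : Phase | ‖z.1‖ < r} := by
    ext z; simp
  rw [h2, ← cumMass, volume_real_ball r hr.le] at h1
  have hw2 : 1 / (X ^ (θ / 2)) ^ 2 = X ^ (-θ) := by
    rw [← Real.rpow_natCast, ← Real.rpow_mul hX0.le, Real.rpow_neg hX0.le, one_div]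
    congr 2; push_cast; ring
  have hA2 : (F₁ * X ^ (θ * μ₁)) ^ (-(1 / μ₁)) ≤ X ^ (-θ) := by
    rw [Real.mul_rpow (by positivity) (by positivity), ← Real.rpow_mul hX0.le,
      show θ * μ₁ * -(1 / μ₁) = -θ by field_simp]
    refine mul_le_of_le_one_left (by positivity) ?_
    exact Real.rpow_le_one_of_one_le_of_nonpos hF₁ (by rw [neg_nonpos]; positivity)
  have hw3 : X ^ (θ * μ₁) * (X ^ (θ / 2)) ^ 3 * r ^ 3 = Y * X ^ (-θ) := by
    have h3 : Y = X * r ^ 3 := by rw [hX]; field_simp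
    rw [h3, ← Real.rpow_natCast (X ^ (θ / 2)) 3, ← Real.rpow_mul hX0.le, ← Real.rpow_add hX0,
      show θ * μ₁ + θ / 2 * (3 : ℕ) = 1 + -θ by rw [hθ]; push_cast; field_simp; ring,
      Real.rpow_add hX0, Real.rpow_one]
    ring
  have hXθ : Y * X ^ (-θ) = Y ^ (1 - θ) * r ^ (3 * θ) := by
    rw [hX, Real.div_rpow hY0.le (by positivity), Real.rpow_neg hY0.le,
      Real.rpow_neg (by positivity), Real.rpow_sub hY0, Real.rpow_one,
      ← Real.rpow_natCast r 3, ← Real.rpow_mul hr.le]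
    push_cast
    field_simp
  rw [mul_assoc, ← hXθ]
  refine h1.trans ?_
  rw [hw2]
  have hXp : 0 < X ^ (-θ) := Real.rpow_pos_of_pos hX0 _
  have e1 : F₁ * X ^ (θ * μ₁) * (4 * Real.pi / 3 * r ^ 3 * (4 * Real.pi / 3 * (X ^ (θ / 2)) ^ 3)) =
      F₁ * (4 * Real.pi / 3) ^ 2 * (Y * X ^ (-θ)) := by rw [← hw3]; ring
  rw [e1]
  have e2 : X ^ (-θ) * (2 * J Q f) ≤ 2 * (Y * X ^ (-θ)) := by
    have : J Q f ≤ Y := by linarith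
    nlinarith
  have e3 : (F₁ * X ^ (θ * μ₁)) ^ (-(1 / μ₁)) / C₁ * J Q f ≤ 1 / C₁ * (Y * X ^ (-θ)) := by
    have : J Q f ≤ Y := by linarith
    calc _ ≤ X ^ (-θ) / C₁ * Y := by gcongr
      _ = _ := by ring
  linarith

end VlasovPoisson

/-! ### Field energy bounds, coercivity, and nonnegativity of the distance. -/

namespace VlasovPoisson

/-- A majorant of `m(r)² / r²` for `m(r) ≤ min (D r^α) M`. -/
noncomputable def fieldBound (D M α r : ℝ) : ℝ :=
  if r ≤ 1 then D ^ 2 * r ^ (2 * α - 2) else M ^ 2 * (1 / r ^ 2)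

theorem integrableOn_fieldBound (D M : ℝ) {α : ℝ} (hα : 1 / 2 < α) :
    IntegrableOn (fieldBound D M α) (Ioi 0) := by
  rw [← Ioc_union_Ioi_eq_Ioi (zero_le_one' ℝ)]
  refine IntegrableOn.union ?_ ?_
  · have h : IntegrableOn (fun r : ℝ => D ^ 2 * r ^ (2 * α - 2)) (Ioc 0 1) := by
      refine Integrable.const_mul ?_ _
      exact (intervalIntegrable_iff_integrableOn_Ioc_of_le zero_le_one).1
        (intervalIntegral.intervalIntegrable_rpow' (by linarith))
    refine h.congr_fun (fun r hr => ?_) measurableSet_Ioc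
    simp [fieldBound, hr.2]
  · refine IntegrableOn.congr_fun (((integral_Ioi_inv_sq zero_lt_one).1).const_mul (M ^ 2))
      (fun r hr => ?_) measurableSet_Ioi
    simp [fieldBound, (mem_Ioi.1 hr).not_ge]

theorem sq_div_sq_le_fieldBound {D M α r m : ℝ} (hr : 0 < r) (hm : |m| ≤ M)
    (h : r ≤ 1 → |m| ≤ D * r ^ α) : m ^ 2 / r ^ 2 ≤ fieldBound D M α r := by
  rw [fieldBound]
  split_ifs with h1
  · have h2 : (D * r ^ α) ^ 2 / r ^ 2 = D ^ 2 * r ^ (2 * α - 2) := by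
      rw [Real.rpow_sub hr, mul_comm 2 α, Real.rpow_mul hr.le]
      norm_cast
      ring
    rw [← h2, ← sq_abs m]
    have := h h1
    gcongr
  · rw [← sq_abs m, div_eq_mul_one_div]
    gcongr

theorem integral_sq_div_sq_le {D M α R : ℝ} (hα : 1 / 2 < α) (hR : 0 < R) (hR1 : R ≤ 1)
    {m : ℝ → ℝ} (hint : IntegrableOn (fun r => m r ^ 2 / r ^ 2) (Ioi 0)) (hm : ∀ r, |m r| ≤ M)
    (h : ∀ r, 0 < r → r ≤ 1 → |m r| ≤ D * r ^ α) :
    ∫ r in Ioi (0 : ℝ), m r ^ 2 / r ^ 2 ≤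
      D ^ 2 * (R ^ (2 * α - 1) / (2 * α - 1)) + M ^ 2 / R := by
  rw [← Ioc_union_Ioi_eq_Ioi hR.le, setIntegral_union (Ioc_disjoint_Ioi le_rfl)
    measurableSet_Ioi (hint.mono_set Ioc_subset_Ioi_self) (hint.mono_set (Ioi_subset_Ioi hR.le))]
  refine add_le_add ?_ ?_
  · have hi : IntegrableOn (fun r : ℝ => D ^ 2 * r ^ (2 * α - 2)) (Ioc 0 R) := by
      refine Integrable.const_mul ?_ _
      exact (intervalIntegrable_iff_integrableOn_Ioc_of_le hR.le).1
        (intervalIntegral.intervalIntegrable_rpow' (by linarith))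
    calc ∫ r in Ioc 0 R, m r ^ 2 / r ^ 2 ≤ ∫ r in Ioc 0 R, D ^ 2 * r ^ (2 * α - 2) := by
          refine setIntegral_mono_on (hint.mono_set Ioc_subset_Ioi_self) hi measurableSet_Ioc
            fun r hr => ?_
          have := sq_div_sq_le_fieldBound (M := M) hr.1 (hm r) (h r hr.1)
          rwa [fieldBound, if_pos (hr.2.trans hR1)] at this
      _ = D ^ 2 * (R ^ (2 * α - 1) / (2 * α - 1)) := by
          rw [integral_const_mul, ← intervalIntegral.integral_of_le hR.le,
            integral_rpow (Or.inl (by linarith))]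
          rw [show 2 * α - 2 + 1 = 2 * α - 1 by ring, Real.zero_rpow (by linarith), sub_zero]
  · calc ∫ r in Ioi R, m r ^ 2 / r ^ 2 ≤ ∫ r in Ioi R, M ^ 2 * (1 / r ^ 2) := by
          refine setIntegral_mono_on (hint.mono_set (Ioi_subset_Ioi hR.le))
            ((integral_Ioi_inv_sq hR).1.const_mul _) measurableSet_Ioi fun r hr => ?_
          rw [← sq_abs, div_eq_mul_one_div]
          have := hm r
          gcongr
      _ = M ^ 2 / R := by
          rw [integral_const_mul, (integral_Ioi_inv_sq hR).2, mul_one_div]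

variable {Q : ℝ → ℝ → ℝ} {M C₁ F₀ μ₁ : ℝ} {f g : Phase → ℝ}

/-- Here `μ₁ < 3/2` is used. The bound `1/4 < θ` is equivalent to `(1 - θ)/(3θ) < 1`, the sublinear
growth of the field energy in `J`; it also gives `3θ > 1/2`, hence integrability of `m²/r²` at the
origin. -/
theorem theta_bounds (hμ₁ : 0 < μ₁) (hμ₁' : μ₁ < 3 / 2) :
    1 / 4 < 2 / (2 * μ₁ + 5) ∧ 2 / (2 * μ₁ + 5) < 1 := by
  constructor
  · rw [lt_div_iff₀ (by positivity)]; linarith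
  · rw [div_lt_one (by positivity)]; linarith

theorem MemFM.finiteField (hf : MemFM Q M f) (hC₁ : 0 < C₁) (hF₀ : 0 < F₀) (hμ₁ : 0 < μ₁)
    (hμ₁' : μ₁ < 3 / 2) (hQ : IsCasimirIntegrand Q) (hQ1 : Q1 Q C₁ F₀ μ₁) : FiniteField f := by
  obtain ⟨C, -, hC⟩ := exists_cumMass_le hC₁ hF₀ hμ₁ hQ hQ1
  have hθ := (theta_bounds hμ₁ hμ₁').1
  refine Integrable.mono' (integrableOn_fieldBound (C * (1 + J Q f) ^ (1 - 2 / (2 * μ₁ + 5))) M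
    (α := 3 * (2 / (2 * μ₁ + 5))) (by linarith)) ?_ ?_
  · exact (((continuous_cumMass hf.integrable).measurable.pow_const 2).div
      (by fun_prop)).aestronglyMeasurable
  · refine (ae_restrict_iff' measurableSet_Ioi).2 (Eventually.of_forall fun r hr => ?_)
    rw [Real.norm_of_nonneg (by positivity)]
    have h0 := abs_of_nonneg (hf.cumMass_nonneg r)
    exact sq_div_sq_le_fieldBound hr (h0.trans_le (hf.cumMass_le r))
      fun h1 => h0.trans_le (hC M f hf r hr h1)

/-- Split the radial integral at `R`, with `m ≤ C Y^(1-θ) r^(3θ)` inside and `m ≤ M` outside. The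
inner term of order `Y^(2-2θ) R^(6θ-1)` and the outer term `M²/R` balance for `R = Y^(-κ)` with `κ =
(1 - θ)/(3θ)`; both are then of order `Y^κ`. -/
theorem exists_interaction_le (hC₁ : 0 < C₁) (hF₀ : 0 < F₀) (hμ₁ : 0 < μ₁)
    (hμ₁' : μ₁ < 3 / 2) (hQ : IsCasimirIntegrand Q) (hQ1 : Q1 Q C₁ F₀ μ₁) (M : ℝ) :
    ∃ C κ : ℝ, 0 < C ∧ 0 < κ ∧ κ < 1 ∧ ∀ f : Phase → ℝ, MemFM Q M f →
      interaction f f ≤ C * (1 + J Q f) ^ κ := by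
  obtain ⟨C, hC0, hC⟩ := exists_cumMass_le hC₁ hF₀ hμ₁ hQ hQ1
  obtain ⟨hθ, hθ1⟩ := theta_bounds hμ₁ hμ₁'
  set θ := 2 / (2 * μ₁ + 5)
  have hκ0 : 0 < (1 - θ) / (3 * θ) := div_pos (by linarith) (by linarith)
  refine ⟨C ^ 2 / (2 * (3 * θ) - 1) + M ^ 2, (1 - θ) / (3 * θ), ?_, hκ0, ?_, fun f hf => ?_⟩
  · have : 0 < 2 * (3 * θ) - 1 := by linarith
    positivity
  · rw [div_lt_one (by linarith)]; linarith
  have hY1 : 1 ≤ 1 + J Q f := by linarith [hf.J_nonneg hQ]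
  set Y := 1 + J Q f
  set κ := (1 - θ) / (3 * θ) with hκ
  have hY0 : 0 < Y := by linarith
  have h1 := integral_sq_div_sq_le (α := 3 * θ) (R := Y ^ (-κ)) (D := C * Y ^ (1 - θ)) (M := M)
    (m := cumMass f) (by linarith) (Real.rpow_pos_of_pos hY0 _)
    (Real.rpow_le_one_of_one_le_of_nonpos hY1 (by linarith))
    (hf.finiteField hC₁ hF₀ hμ₁ hμ₁' hQ hQ1)
    (fun r => (abs_of_nonneg (hf.cumMass_nonneg r)).trans_le (hf.cumMass_le r))
    fun r hr h1 => (abs_of_nonneg (hf.cumMass_nonneg r)).trans_le (hC M f hf r hr h1)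
  have h2 : interaction f f = ∫ r in Ioi (0 : ℝ), cumMass f r ^ 2 / r ^ 2 := by
    simp only [interaction, pow_two]
  rw [h2]
  refine h1.trans (le_of_eq ?_)
  have h3 : (Y ^ (1 - θ)) ^ 2 * (Y ^ (-κ)) ^ (2 * (3 * θ) - 1) = Y ^ κ := by
    rw [← Real.rpow_natCast, ← Real.rpow_mul hY0.le, ← Real.rpow_mul hY0.le, ← Real.rpow_add hY0]
    congr 1
    have : 3 * θ ≠ 0 := by linarith
    rw [hκ]; push_cast; field_simp; ring
  rw [Real.rpow_neg hY0.le κ, div_inv_eq_mul, ← Real.rpow_neg hY0.le, add_mul, ← h3]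
  ring

theorem energyCasimir_eq (hf : IsSymmetricDensity f) :
    energyCasimir Q f = J Q f - 1 / 2 * interaction f f := by
  rw [energyCasimir, integral_sq_norm_gradPot hf]
  have := Real.pi_pos
  field_simp
  ring

/-- A bound on the energy-Casimir functional bounds `J`. -/
theorem exists_J_le (hC₁ : 0 < C₁) (hF₀ : 0 < F₀) (hμ₁ : 0 < μ₁)
    (hμ₁' : μ₁ < 3 / 2) (hQ : IsCasimirIntegrand Q) (hQ1 : Q1 Q C₁ F₀ μ₁) (M d : ℝ) :
    ∃ B, ∀ f : Phase → ℝ, MemFM Q M f → energyCasimir Q f ≤ d → J Q f ≤ B := by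
  obtain ⟨C, κ, hC, hκ, hκ1, hint⟩ := exists_interaction_le hC₁ hF₀ hμ₁ hμ₁' hQ hQ1 M
  refine ⟨max (C ^ (1 / (1 - κ))) (2 * (1 + d)), fun f hf hd => ?_⟩
  by_contra! hlt
  have h1 : C ^ (1 / (1 - κ)) < 1 + J Q f := by
    linarith [(le_max_left _ _).trans_lt hlt]
  have h2 : 2 * (1 + d) < J Q f := (le_max_right _ _).trans_lt hlt
  have h3 := hint f hf
  rw [energyCasimir_eq hf.isSymmetricDensity] at hd
  have hY0 : 0 < 1 + J Q f := by linarith [hf.J_nonneg hQ]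
  have hk : 0 < 1 - κ := by linarith
  -- Above this threshold the sublinear bound on the interaction is at most `1 + J`; half of it is
  -- absorbed in `J = 𝒟 + ½ I`, leaving `J ≤ 2d + 1`.
  have h4 : C ≤ (1 + J Q f) ^ (1 - κ) := by
    calc C = (C ^ (1 / (1 - κ))) ^ (1 - κ) := by
          rw [← Real.rpow_mul hC.le, one_div_mul_cancel hk.ne', Real.rpow_one]
      _ ≤ _ := by gcongr
  have h5 : C * (1 + J Q f) ^ κ ≤ 1 + J Q f := by
    calc C * (1 + J Q f) ^ κ ≤ (1 + J Q f) ^ (1 - κ) * (1 + J Q f) ^ κ := by gcongr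
      _ = 1 + J Q f := by rw [← Real.rpow_add hY0]; simp
  linarith

section Dist

variable {f₀ : Phase → ℝ}

/-- The masses agree, so the constant `E₀` is multiplied by `∫ (f - f₀) = 0` and drops out; the
potential part of `E` contributes interaction terms. -/
theorem integrable_casimirDistIntegrand (hf : MemFM Q M f) (hf₀ : MemFM Q M f₀)
    (hff : FiniteField f) (hff₀ : FiniteField f₀) :
    Integrable (casimirDistIntegrand Q M f f₀) ∧
      casimirDist Q M f f₀ = J Q f - J Q f₀ - interaction f₀ f + interaction f₀ f₀ := by
  obtain ⟨i1, e1⟩ := integral_potential_mul hf₀.isSymmetricDensity hf.isSymmetricDensity hff₀ hff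
  obtain ⟨i2, e2⟩ := integral_potential_mul hf₀.isSymmetricDensity hf₀.isSymmetricDensity hff₀ hff₀
  set E₀ := cutoffEnergy Q M f₀
  have k1 := (hf.integrable_kinetic.sub hf₀.integrable_kinetic).const_mul (1 / 2)
  have k2 := i1.sub i2
  have k3 := (hf.integrable.sub hf₀.integrable).const_mul E₀
  have k0 := hf.integrable_casimir.sub hf₀.integrable_casimir
  have h : casimirDistIntegrand Q M f f₀ = fun z =>
      (((fun z => Q (f z) (angMom z)) - fun z => Q (f₀ z) (angMom z)) z +
        1 / 2 * ((fun z => ‖z.2‖ ^ 2 * f z) - fun z => ‖z.2‖ ^ 2 * f₀ z) z +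
        ((fun z => potential f₀ z.1 * f z) - fun z => potential f₀ z.1 * f₀ z) z) -
        E₀ * (f - f₀) z := by
    ext z
    simp only [casimirDistIntegrand, particleEnergy, Pi.sub_apply]
    ring
  have k01 := k0.add k1
  have k012 := k01.add k2
  refine ⟨h ▸ k012.sub k3, ?_⟩
  rw [casimirDist, h, integral_sub (by exact k012) k3, integral_add (by exact k01) k2,
    integral_add k0 k1, integral_const_mul, integral_const_mul, integral_sub' hf.integrable_casimir
    hf₀.integrable_casimir, integral_sub' hf.integrable_kinetic hf₀.integrable_kinetic,
    integral_sub' i1 i2, integral_sub' hf.integrable hf₀.integrable, hf.mass, hf₀.mass, e1, e2, J, J]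
  ring

/-- The central identity: `d` contains the part of the field energy that is linear in `f - f₀`, and
the quadratic remainder is the energy of the difference of the fields. -/
theorem energyCasimir_sub_eq (hf : MemFM Q M f) (hf₀ : MemFM Q M f₀)
    (hff : FiniteField f) (hff₀ : FiniteField f₀) :
    energyCasimir Q f - energyCasimir Q f₀ =
      casimirDist Q M f f₀ - 1 / 2 * interaction (f - f₀) (f - f₀) := by
  rw [(integrable_casimirDistIntegrand hf hf₀ hff hff₀).2,
    energyCasimir_eq hf.isSymmetricDensity, energyCasimir_eq hf₀.isSymmetricDensity,
    interaction_sub_self hff hff₀ hf.integrable hf₀.integrable, interaction_comm f f₀]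
  ring

theorem stabilityDist_eq (hf : MemFM Q M f) (hf₀ : MemFM Q M f₀) :
    stabilityDist Q M f f₀ =
      casimirDist Q M f f₀ + 1 / 2 * interaction (f - f₀) (f - f₀) := by
  rw [stabilityDist, integral_sq_norm_gradPot_sub hf.isSymmetricDensity hf₀.isSymmetricDensity]
  have := Real.pi_pos
  field_simp
  ring

theorem MemFM.comb (hf : MemFM Q M f) (hg : MemFM Q M g) (hQ : IsCasimirIntegrand Q)
    (hQ4 : Q4 Q) {a b : ℝ} (ha : 0 ≤ a) (hb : 0 ≤ b) (hab : a + b = 1) :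
    MemFM Q M (a • f + b • g) ∧
      (∀ᵐ z : Phase, Q ((a • f + b • g) z) (angMom z) ≤
        a * Q (f z) (angMom z) + b * Q (g z) (angMom z)) ∧
      J Q (a • f + b • g) ≤ a * J Q f + b * J Q g := by
  have hi : Integrable (a • f + b • g) := (hf.integrable.smul a).add (hg.integrable.smul b)
  have h0 : ∀ᵐ z : Phase, 0 ≤ (a • f + b • g) z := by
    filter_upwards [hf.nonneg, hg.nonneg] with z h1 h2
    simp only [Pi.add_apply, Pi.smul_apply, smul_eq_mul]; positivity
  have hconv : ∀ᵐ z : Phase, Q ((a • f + b • g) z) (angMom z) ≤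
      a * Q (f z) (angMom z) + b * Q (g z) (angMom z) := by
    filter_upwards [hf.nonneg, hg.nonneg] with z h1 h2
    exact (hQ.strictConvexOn hQ4 (angMom_nonneg z)).convexOn.2 h1 h2 ha hb hab
  have hQi := (hf.integrable_casimir.const_mul a).add (hg.integrable_casimir.const_mul b)
  have hQ0 : ∀ᵐ z : Phase, 0 ≤ Q ((a • f + b • g) z) (angMom z) := by
    filter_upwards [h0] with z hz
    exact hQ.nonneg _ _ hz (angMom_nonneg z)
  have hic : Integrable fun z => Q ((a • f + b • g) z) (angMom z) := by
    refine hQi.mono' (hQ.aestronglyMeasurable hi.aestronglyMeasurable h0) ?_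
    filter_upwards [hconv, hQ0] with z h1 h2
    rwa [Real.norm_of_nonneg h2]
  have hkin : (fun z : Phase => ‖z.2‖ ^ 2 * (a • f + b • g) z) =
      fun z => a * (‖z.2‖ ^ 2 * f z) + b * (‖z.2‖ ^ 2 * g z) := by
    ext z; simp only [Pi.add_apply, Pi.smul_apply, smul_eq_mul]; ring
  have hki : Integrable fun z : Phase => a * (‖z.2‖ ^ 2 * f z) + b * (‖z.2‖ ^ 2 * g z) :=
    (hf.integrable_kinetic.const_mul a).add (hg.integrable_kinetic.const_mul b)
  refine ⟨⟨hi, h0, ?_, hic, hkin ▸ hki, ?_⟩, hconv, ?_⟩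
  · rw [integral_add' (hf.integrable.smul a) (hg.integrable.smul b)]
    simp only [Pi.smul_apply, smul_eq_mul]
    rw [integral_const_mul, integral_const_mul, hf.mass, hg.mass, ← add_mul, hab, one_mul]
  · intro A hA
    filter_upwards [hf.symmetric A hA, hg.symmetric A hA] with z h1 h2
    simp only [Pi.add_apply, Pi.smul_apply, h1, h2]
  · have h1 := integral_mono_ae hic hQi hconv
    rw [integral_add' (hf.integrable_casimir.const_mul a) (hg.integrable_casimir.const_mul b),
      integral_const_mul, integral_const_mul] at h1
    rw [J, J, J, hkin, integral_add (hf.integrable_kinetic.const_mul a)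
      (hg.integrable_kinetic.const_mul b), integral_const_mul, integral_const_mul]
    linarith

/-- First-order optimality along the segment `(1 - t) f₀ + t f`: minimality and convexity of `J`
give `0 ≤ t (X - t K/2)` with `X = d(f, f₀)`. Divide by `t` and let `t → 0`. Only competitors in
`ℱ_M` are used, so no Euler-Lagrange equation is needed. -/
theorem casimirDist_nonneg (hC₁ : 0 < C₁) (hF₀ : 0 < F₀) (hμ₁ : 0 < μ₁)
    (hμ₁' : μ₁ < 3 / 2) (hQ : IsCasimirIntegrand Q) (hQ1 : Q1 Q C₁ F₀ μ₁) (hQ4 : Q4 Q)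
    (hf₀ : IsMinimizer Q M f₀) (hf : MemFM Q M f) : 0 ≤ casimirDist Q M f f₀ := by
  have hff := hf.finiteField hC₁ hF₀ hμ₁ hμ₁' hQ hQ1
  have hff₀ := hf₀.1.finiteField hC₁ hF₀ hμ₁ hμ₁' hQ hQ1
  rw [(integrable_casimirDistIntegrand hf hf₀.1 hff hff₀).2]
  set X := J Q f - J Q f₀ - interaction f₀ f + interaction f₀ f₀ with hX
  set K := interaction f₀ f₀ - 2 * interaction f₀ f + interaction f f with hK
  have key : ∀ t : ℝ, 0 < t → t ≤ 1 → 0 ≤ X - t * (1 / 2 * K) := by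
    intro t ht ht1
    obtain ⟨hm, -, hJ⟩ := hf₀.1.comb hf hQ hQ4 (a := 1 - t) (b := t) (by linarith) ht.le (by ring)
    have h1 := hf₀.2 _ hm
    rw [energyCasimir_eq hm.isSymmetricDensity, energyCasimir_eq hf₀.1.isSymmetricDensity,
      interaction_comb hff₀ hff hf₀.1.integrable hf.integrable] at h1
    have h2 : 0 ≤ t * (X - t * (1 / 2 * K)) := by
      rw [hX, hK]; nlinarith
    exact nonneg_of_mul_nonneg_right h2 ht
  have hlim : Tendsto (fun t : ℝ => X - t * (1 / 2 * K)) (𝓝[>] 0) (𝓝 X) := by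
    have : ContinuousAt (fun t : ℝ => X - t * (1 / 2 * K)) 0 := by fun_prop
    have h := this.tendsto.mono_left (nhdsWithin_le_nhds (s := Ioi 0))
    simpa using h
  refine ge_of_tendsto hlim ?_
  filter_upwards [Ioc_mem_nhdsGT (zero_lt_one' ℝ)] with t ht
  exact key t ht.1 ht.2

end Dist

end VlasovPoisson

/-! ### Scaling of the functional, and negativity of its infimum. -/

namespace VlasovPoisson

section Scale

variable {b c : ℝ}

theorem measurableEmbedding_scale (hb : b ≠ 0) (hc : c ≠ 0) :
    MeasurableEmbedding fun z : Phase => (b • z.1, c • z.2) :=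
  ((Homeomorph.smulOfNeZero b hb).prodCongr (Homeomorph.smulOfNeZero c hc)).measurableEmbedding

theorem measurePreserving_scale (hb : 0 < b) (hc : 0 < c) :
    MeasurePreserving (fun z : Phase => (b • z.1, c • z.2)) volume
      (ENNReal.ofReal ((b * c) ^ 3)⁻¹ • volume) := by
  refine ⟨(measurableEmbedding_scale hb.ne' hc.ne').measurable, ?_⟩
  have h : Measure.map (fun z : Phase => (b • z.1, c • z.2)) volume =
      (Measure.map (b • ·) (volume : Measure E3)).prod (Measure.map (c • ·) volume) := by
    rw [Measure.map_prod_map _ _ (by fun_prop) (by fun_prop)]; rfl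
  rw [h, Measure.map_addHaar_smul _ hb.ne', Measure.map_addHaar_smul _ hc.ne',
    Measure.prod_smul_left, Measure.prod_smul_right, smul_smul]
  congr 1
  rw [← ENNReal.ofReal_mul (abs_nonneg _)]
  congr 1
  simp only [finrank_euclideanSpace, Fintype.card_fin]
  rw [abs_of_pos (by positivity), abs_of_pos (by positivity), ← mul_inv, mul_pow]

theorem integral_comp_scale (hb : 0 < b) (hc : 0 < c) (F : Phase → ℝ) :
    ∫ z : Phase, F (b • z.1, c • z.2) = ((b * c) ^ 3)⁻¹ * ∫ z, F z := by
  rw [(measurePreserving_scale hb hc).integral_comp (measurableEmbedding_scale hb.ne' hc.ne') F,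
    integral_smul_measure, ENNReal.toReal_ofReal (by positivity), smul_eq_mul]

theorem integrable_comp_scale (hb : 0 < b) (hc : 0 < c) {F : Phase → ℝ} (hF : Integrable F) :
    Integrable fun z : Phase => F (b • z.1, c • z.2) :=
  ((measurePreserving_scale hb hc).integrable_comp_emb
    (measurableEmbedding_scale hb.ne' hc.ne')).2 (hF.smul_measure ENNReal.ofReal_ne_top)

theorem ae_comp_scale (hb : 0 < b) (hc : 0 < c) {p : Phase → Prop} (h : ∀ᵐ z : Phase, p z) :
    ∀ᵐ z : Phase, p (b • z.1, c • z.2) :=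
  (measurePreserving_scale hb hc).quasiMeasurePreserving.ae (Measure.smul_absolutelyContinuous.ae_le h)

theorem cumMass_scale (hb : 0 < b) (hc : 0 < c) (a : ℝ) (f : Phase → ℝ) (r : ℝ) :
    cumMass (fun z : Phase => a * f (b • z.1, c • z.2)) r =
      a * ((b * c) ^ 3)⁻¹ * cumMass f (b * r) := by
  rw [cumMass, cumMass, ← integral_indicator (measurableSet_norm_fst_lt _),
    ← integral_indicator (measurableSet_norm_fst_lt _), mul_assoc, ← integral_comp_scale hb hc,
    ← integral_const_mul]
  congr 1; ext z
  have : ‖z.1‖ < r ↔ ‖b • z.1‖ < b * r := by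
    rw [norm_smul, Real.norm_of_nonneg hb.le, mul_lt_mul_iff_right₀ hb]
  by_cases h : ‖z.1‖ < r
  · simp [indicator, h, this.1 h]
  · simp [indicator, h, mt this.2 h]

theorem interaction_scale (hb : 0 < b) (hc : 0 < c) (a : ℝ) (f : Phase → ℝ) :
    interaction (fun z : Phase => a * f (b • z.1, c • z.2))
      (fun z : Phase => a * f (b • z.1, c • z.2)) =
      (a * ((b * c) ^ 3)⁻¹) ^ 2 * b * interaction f f := by
  have h := integral_comp_mul_left_Ioi (fun r => cumMass f r * cumMass f r / r ^ 2) 0 hb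
  rw [mul_zero] at h
  rw [interaction, interaction]
  have h2 : ∫ r in Ioi (0 : ℝ), cumMass f r * cumMass f r / r ^ 2 =
      b * ∫ r in Ioi (0 : ℝ), cumMass f (b * r) * cumMass f (b * r) / (b * r) ^ 2 := by
    rw [h, smul_eq_mul, ← mul_assoc, mul_inv_cancel₀ hb.ne', one_mul]
  rw [h2, ← integral_const_mul, ← integral_const_mul]
  refine setIntegral_congr_fun measurableSet_Ioi fun r hr => ?_
  have : r ≠ 0 := (mem_Ioi.1 hr).ne'
  simp only [cumMass_scale hb hc]
  field_simp

end Scale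

variable {Q : ℝ → ℝ → ℝ}

/-- Rescaling `f(x, v) ↦ a f(bx, cv)`. -/
theorem MemFM.scale {M : ℝ} {f : Phase → ℝ} (hf : MemFM Q M f) (hQ : IsCasimirIntegrand Q)
    {a b c q : ℝ} (ha : 0 < a) (hb : 0 < b) (hc : 0 < c)
    (hq : ∀ s L, 0 ≤ s → 0 ≤ L → Q (a * s) L ≤ q * Q s ((b * c) ^ 2 * L))
    (h1 : q ≤ a ^ 2 * ((b * c) ^ 3)⁻¹ * b) (h2 : (c ^ 2)⁻¹ ≤ a * ((b * c) ^ 3)⁻¹ * b) :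
    MemFM Q (a * ((b * c) ^ 3)⁻¹ * M) (fun z : Phase => a * f (b • z.1, c • z.2)) ∧
      energyCasimir Q (fun z : Phase => a * f (b • z.1, c • z.2)) ≤
        (a * ((b * c) ^ 3)⁻¹) ^ 2 * b * energyCasimir Q f := by
  set N := ((b * c) ^ 3)⁻¹ with hN
  have hN0 : 0 < N := by positivity
  set g : Phase → ℝ := fun z : Phase => a * f (b • z.1, c • z.2) with hg
  have hgi : Integrable g := (integrable_comp_scale hb hc hf.integrable).const_mul a
  have hg0 : ∀ᵐ z : Phase, 0 ≤ g z := by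
    filter_upwards [ae_comp_scale hb hc hf.nonneg] with z hz
    positivity
  have hQle : ∀ᵐ z : Phase, Q (g z) (angMom z) ≤
      q * Q (f (b • z.1, c • z.2)) (angMom (b • z.1, c • z.2)) := by
    filter_upwards [ae_comp_scale hb hc hf.nonneg] with z hz
    rw [angMom_smul]
    exact hq _ _ hz (angMom_nonneg z)
  have hQ0 : ∀ᵐ z : Phase, 0 ≤ Q (g z) (angMom z) := by
    filter_upwards [hg0] with z hz
    exact hQ.nonneg _ _ hz (angMom_nonneg z)
  have hci := (integrable_comp_scale hb hc hf.integrable_casimir).const_mul q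
  have hgc : Integrable fun z => Q (g z) (angMom z) := by
    refine hci.mono' (hQ.aestronglyMeasurable hgi.aestronglyMeasurable hg0) ?_
    filter_upwards [hQle, hQ0] with z h1 h2
    rwa [Real.norm_of_nonneg h2]
  have hkin : (fun z : Phase => ‖z.2‖ ^ 2 * g z) = fun z : Phase =>
      (a * (c ^ 2)⁻¹) * (fun z : Phase => ‖z.2‖ ^ 2 * f z) (b • z.1, c • z.2) := by
    ext z
    simp only [hg, norm_smul, Real.norm_of_nonneg hc.le]
    field_simp
  have hgk : Integrable fun z : Phase => ‖z.2‖ ^ 2 * g z := by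
    rw [hkin]; exact (integrable_comp_scale hb hc hf.integrable_kinetic).const_mul _
  have hm : MemFM Q (a * N * M) g := by
    refine ⟨hgi, hg0, ?_, hgc, hgk, fun A hA => ?_⟩
    · rw [hg, integral_const_mul, integral_comp_scale hb hc, hf.mass]; ring
    · filter_upwards [ae_comp_scale hb hc (hf.symmetric A hA)] with z hz
      simp only [hg, ← map_smul, hz]
  refine ⟨hm, ?_⟩
  have e1 : ∫ z, Q (g z) (angMom z) ≤ q * (N * ∫ z : Phase, Q (f z) (angMom z)) := by
    refine (integral_mono_ae hgc hci hQle).trans (le_of_eq ?_)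
    rw [integral_const_mul, integral_comp_scale hb hc (fun z => Q (f z) (angMom z))]
  have e2 : ∫ z : Phase, ‖z.2‖ ^ 2 * g z =
      a * (c ^ 2)⁻¹ * (N * ∫ z : Phase, ‖z.2‖ ^ 2 * f z) := by
    rw [hkin, integral_const_mul, integral_comp_scale hb hc (fun z : Phase => ‖z.2‖ ^ 2 * f z)]
  rw [energyCasimir_eq hm.isSymmetricDensity, energyCasimir_eq hf.isSymmetricDensity,
    interaction_scale hb hc, J, J, e2, ← hN]
  have k1 : 0 ≤ ∫ z : Phase, Q (f z) (angMom z) := integral_nonneg_of_ae (hf.casimir_nonneg hQ)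
  have k2 : 0 ≤ ∫ z : Phase, ‖z.2‖ ^ 2 * f z := integral_nonneg_of_ae hf.kinetic_nonneg
  -- The field energy scales exactly by `(aN)² b`. The hypotheses `h1` and `h2` say that the Casimir
  -- and kinetic terms, which enter with the opposite sign, grow by at most this factor.
  have l1 : q * (N * ∫ z : Phase, Q (f z) (angMom z)) ≤
      (a ^ 2 * N * b) * (N * ∫ z : Phase, Q (f z) (angMom z)) := by gcongr
  have l2 : a * (c ^ 2)⁻¹ * (N * ∫ z : Phase, ‖z.2‖ ^ 2 * f z) ≤
      a * (a * N * b) * (N * ∫ z : Phase, ‖z.2‖ ^ 2 * f z) := by gcongr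
  nlinarith

/-- Mass can be added at the price of lowering the energy-Casimir functional by a factor. -/
theorem MemFM.exists_rescale {M M' μ₃ : ℝ} {f : Phase → ℝ} (hf : MemFM Q M' f)
    (hQ : IsCasimirIntegrand Q) (hμ₃ : 0 < μ₃) (hQ3 : Q3 Q μ₃) (hM' : 0 < M') (hMM : M' ≤ M) :
    ∃ (g : Phase → ℝ) (k : ℝ), MemFM Q M g ∧ energyCasimir Q g ≤ k * energyCasimir Q f ∧
      1 ≤ k ∧ (k = 1 → M' = M) := by
  have hM : 0 < M := hM'.trans_le hMM
  have ht1 : 1 ≤ M / M' := (one_le_div hM').2 hMM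
  have ht0 : 0 < M / M' := by positivity
  rcases lt_or_ge μ₃ (1 / 2) with hμ | hμ
  -- Dilate in space alone (`a = c = 1`, `b ≤ 1`): this lowers the argument `L` to `b² L`, and `Q`
  -- is decreasing in `L`. The mass grows by `b⁻³ = M/M'`, and `k = b⁻⁵`.
  · set b := (M' / M) ^ (1 / 3 : ℝ) with hb
    have hb0 : 0 < b := by positivity
    have hb3 : b ^ 3 = M' / M := by
      rw [hb, ← Real.rpow_natCast, ← Real.rpow_mul (by positivity)]; norm_num
    have hb1 : b ≤ 1 := Real.rpow_le_one (by positivity) ((div_le_one hM).2 hMM) (by norm_num)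
    have hb2 : b ^ 2 ≤ 1 := pow_le_one₀ hb0.le hb1
    have hbc : 1 ≤ (b ^ 3)⁻¹ * b := by
      rw [show (b ^ 3)⁻¹ * b = (b ^ 2)⁻¹ by field_simp]
      exact (one_le_inv₀ (by positivity)).2 hb2
    obtain ⟨h1, h2⟩ := hf.scale hQ (a := 1) (b := b) (c := 1) (q := 1) one_pos hb0 one_pos
      (fun s L hs hL => by
        rw [one_mul, one_mul, mul_one]
        exact hQ3.2 hμ s hs (mem_Ici.2 (by positivity)) (mem_Ici.2 hL)
          (mul_le_of_le_one_left hL hb2))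
      (by simpa using hbc) (by simpa using hbc)
    rw [mul_one, one_mul] at h1 h2
    refine ⟨_, _, ?_, h2, ?_, fun hk => ?_⟩
    · convert h1 using 1
      rw [hb3]; field_simp
    · have : 1 ≤ (b ^ 3)⁻¹ := by rw [hb3, inv_div]; exact ht1
      nlinarith
    · have h3 : 1 ≤ (b ^ 3)⁻¹ := by rw [hb3, inv_div]; exact ht1
      have h4 : (b ^ 3)⁻¹ = 1 := by nlinarith
      rw [hb3, inv_div, div_eq_one_iff_eq hM'.ne'] at h4
      exact h4.symm
  -- With `a = b = t` and `c = 1/t` one has `bc = 1`, so `L` is preserved. The Casimir condition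
  -- becomes `t^(1 + 1/μ₃) ≤ t³`, which is where `μ₃ ≥ 1/2` enters; here `k = t³`.
  · set t := M / M' with ht
    have hbc : t * (1 / t) = 1 := by field_simp
    obtain ⟨h1, h2⟩ := hf.scale hQ (a := t) (b := t) (c := 1 / t) (q := t ^ (1 + 1 / μ₃)) ht0 ht0
      (by positivity) (fun s L hs hL => by
        have h := hQ3.1 (t * s) L (1 / t) (by positivity) hL (by positivity)
          ((div_le_one ht0).2 ht1)
        rw [← mul_assoc, one_div_mul_cancel ht0.ne', one_mul, one_div, Real.inv_rpow ht0.le,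
          inv_mul_le_iff₀ (by positivity)] at h
        rwa [hbc, one_pow, one_mul])
      (by
        rw [hbc, one_pow, inv_one, mul_one, ← pow_succ, ← Real.rpow_natCast]
        refine Real.rpow_le_rpow_of_exponent_le ht1 ?_
        have : 1 / μ₃ ≤ 2 := by rw [div_le_iff₀ hμ₃]; linarith
        push_cast; linarith)
      (by rw [hbc, one_pow, inv_one, mul_one]; field_simp; exact le_rfl)
    rw [hbc, one_pow, inv_one, mul_one] at h1 h2
    refine ⟨_, _, ?_, h2, ?_, fun hk => ?_⟩
    · convert h1 using 1
      rw [ht]; field_simp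
    · rw [← pow_succ]; exact one_le_pow₀ ht1
    · have h3 : t = 1 := by nlinarith [mul_nonneg (sub_nonneg.2 ht1) (sub_nonneg.2 ht1)]
      rw [ht, div_eq_one_iff_eq hM'.ne'] at h3
      exact h3.symm

/-- The infimum of the energy-Casimir functional is negative. -/
theorem exists_energyCasimir_neg {C₁ C₂ F₀ μ₁ μ₂ M : ℝ} (hM : 0 < M) (hC₁ : 0 < C₁)
    (hF₀ : 0 < F₀) (hμ₁ : 0 < μ₁) (hμ₁' : μ₁ < 3 / 2) (hμ₂ : 0 < μ₂)
    (hμ₂' : μ₂ < 3 / 2) (hQ : IsCasimirIntegrand Q) (hQ1 : Q1 Q C₁ F₀ μ₁) (hQ2 : Q2 Q C₂ F₀ μ₂) :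
    ∃ g : Phase → ℝ, MemFM Q M g ∧ energyCasimir Q g < 0 := by
  set V := 4 * Real.pi / 3 with hV
  have hV0 : 0 < V := by positivity
  -- The trial function is constant on `|x| < R = s²`, `|v| < w₀/s`, with height `c/s³` fixed by the
  -- mass. Its field energy satisfies `½ I ≥ M²/(2R)`. The choice of `w₀` bounds the kinetic energy
  -- by `M²/(8R)`. The Casimir term is of order `s^(-3/μ₂)`, which for large `s` is below `M²/(4R)`
  -- because `μ₂ < 3/2`.
  set w₀ := √(M / 4) with hw₀
  have hw0 : 0 < w₀ := Real.sqrt_pos.2 (by positivity)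
  have hw2 : w₀ ^ 2 = M / 4 := Real.sq_sqrt (by positivity)
  set c := M / (V ^ 2 * w₀ ^ 3) with hc
  have hc0 : 0 < c := by positivity
  -- parameters of the trial function
  obtain ⟨s, hs0, hs1, hs2⟩ : ∃ s : ℝ, 0 < s ∧ c / s ^ 3 ≤ F₀ ∧
      C₂ * (c / s ^ 3) ^ (1 / μ₂) < M / (4 * s ^ 2) := by
    have h1 : Tendsto (fun s : ℝ => c / s ^ 3) atTop (𝓝 0) :=
      tendsto_const_nhds.div_atTop (tendsto_pow_atTop (by norm_num))
    have h2 : Tendsto (fun s : ℝ => C₂ * c ^ (1 / μ₂) * s ^ (-(3 / μ₂ - 2))) atTop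
        (𝓝 (C₂ * c ^ (1 / μ₂) * 0)) := by
      refine (tendsto_rpow_neg_atTop ?_).const_mul _
      rw [sub_pos, lt_div_iff₀ hμ₂]; linarith
    rw [mul_zero] at h2
    have h3 := h1.eventually (gt_mem_nhds hF₀)
    have h4 := h2.eventually (gt_mem_nhds (show 0 < M / 4 by positivity))
    obtain ⟨s, hs, k1, k2⟩ := ((eventually_gt_atTop (0 : ℝ)).and (h3.and h4)).exists
    refine ⟨s, hs, k1.le, ?_⟩
    have h5 : C₂ * c ^ (1 / μ₂) * s ^ (-(3 / μ₂ - 2)) =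
        C₂ * (c / s ^ 3) ^ (1 / μ₂) * s ^ 2 := by
      rw [Real.div_rpow hc0.le (by positivity), ← Real.rpow_natCast s 3, ← Real.rpow_mul hs.le,
        neg_sub, Real.rpow_sub hs]
      have : ((3 : ℕ) : ℝ) * (1 / μ₂) = 3 / μ₂ := by push_cast; ring
      rw [this]
      norm_cast
      ring
    rw [h5] at k2
    rw [lt_div_iff₀ (by positivity)]
    linarith
  set l := c / s ^ 3 with hl
  have hl0 : 0 < l := by positivity
  set R := s ^ 2 with hR
  have hR0 : 0 < R := by positivity
  set w := w₀ / s with hw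
  have hwp : 0 < w := by positivity
  set S : Set Phase := Metric.ball (0 : E3) R ×ˢ Metric.ball (0 : E3) w with hS
  have hSm : MeasurableSet S := measurableSet_ball.prod measurableSet_ball
  have hSv : volume.real S = V ^ 2 * R ^ 3 * w ^ 3 := by
    rw [hS, measureReal_prod_ball_lt, volume_real_ball R hR0.le, volume_real_ball w hwp.le]; ring
  have hSf : volume S ≠ ∞ := by
    rw [hS, Measure.volume_eq_prod, Measure.prod_prod]
    exact ENNReal.mul_ne_top measure_ball_lt_top.ne measure_ball_lt_top.ne
  have hlS : l * volume.real S = M := by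
    rw [hSv, hl, hR, hw, hc]; field_simp
  set g : Phase → ℝ := S.indicator fun _ => l with hg
  have hi (k : ℝ) : Integrable (S.indicator fun _ : Phase => k) :=
    (integrableOn_const hSf).integrable_indicator hSm
  have hik (k : ℝ) : ∫ z, (S.indicator fun _ : Phase => k) z = volume.real S * k := by
    rw [integral_indicator_const _ hSm, smul_eq_mul]
  have hg0 : ∀ z, 0 ≤ g z := fun z => indicator_nonneg (fun _ _ => hl0.le) z
  have hQg (z : Phase) : Q (g z) (angMom z) ≤ S.indicator (fun _ => C₂ * l ^ (1 + 1 / μ₂)) z := by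
    by_cases hz : z ∈ S
    · rw [hg, indicator_of_mem hz, indicator_of_mem hz]
      exact hQ2 _ _ hl0.le hs1 (angMom_nonneg z)
    · rw [hg, indicator_of_notMem hz, indicator_of_notMem hz,
        casimir_zero hQ hF₀ hμ₂ hQ2 (angMom_nonneg z)]
  have hKg (z : Phase) : ‖z.2‖ ^ 2 * g z ≤ S.indicator (fun _ => w ^ 2 * l) z := by
    by_cases hz : z ∈ S
    · rw [hg, indicator_of_mem hz, indicator_of_mem hz]
      have : ‖z.2‖ < w := by simpa using hz.2
      gcongr
    · rw [hg, indicator_of_notMem hz, indicator_of_notMem hz, mul_zero]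
  have hm : MemFM Q M g := by
    refine ⟨hi l, Eventually.of_forall hg0, ?_, ?_, ?_, ?_⟩
    · rw [hg, hik, mul_comm, hlS]
    · refine (hi (C₂ * l ^ (1 + 1 / μ₂))).mono'
        (hQ.aestronglyMeasurable (hi l).aestronglyMeasurable (Eventually.of_forall hg0))
        (Eventually.of_forall fun z => ?_)
      rw [Real.norm_of_nonneg (hQ.nonneg _ _ (hg0 z) (angMom_nonneg z))]
      exact hQg z
    · refine (hi (w ^ 2 * l)).mono' ?_ (Eventually.of_forall fun z => ?_)
      · exact ((by fun_prop : Measurable fun z : Phase => ‖z.2‖ ^ 2).aestronglyMeasurable).mul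
          (hi l).aestronglyMeasurable
      · rw [Real.norm_of_nonneg (mul_nonneg (by positivity) (hg0 z))]
        exact hKg z
    · refine fun A _ => Eventually.of_forall fun z => ?_
      simp [hg, hS, indicator, mem_prod]
  refine ⟨g, hm, ?_⟩
  have e1 : ∫ z, Q (g z) (angMom z) ≤ C₂ * l ^ (1 / μ₂) * M := by
    refine (integral_mono hm.integrable_casimir (hi _) hQg).trans (le_of_eq ?_)
    rw [hik, Real.rpow_add hl0, Real.rpow_one, ← hlS]; ring
  have e2 : ∫ z : Phase, ‖z.2‖ ^ 2 * g z ≤ w ^ 2 * M := by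
    refine (integral_mono hm.integrable_kinetic (hi _) hKg).trans (le_of_eq ?_)
    rw [hik, ← hlS]; ring
  have hcm : ∀ r ∈ Ioi R, cumMass g r * cumMass g r / r ^ 2 = M ^ 2 * (1 / r ^ 2) := by
    intro r hr
    have : cumMass g r = M := by
      rw [cumMass, ← integral_indicator (measurableSet_norm_fst_lt _), ← hm.mass]
      congr 1; ext z
      by_cases hz : ‖z.1‖ < r
      · simp [indicator, hz]
      · have : z ∉ S := fun h => hz ((by simpa using h.1 : ‖z.1‖ < R).trans hr)
        simp [hg, indicator, hz, this]
    rw [this]; ring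
  have e3 : M ^ 2 / R ≤ interaction g g := by
    have hff := hm.finiteField hC₁ hF₀ hμ₁ hμ₁' hQ hQ1
    have hint := hff.integrableOn_mul hff hm.integrable hm.integrable
    calc M ^ 2 / R = ∫ r in Ioi R, cumMass g r * cumMass g r / r ^ 2 := by
          rw [setIntegral_congr_fun measurableSet_Ioi hcm, integral_const_mul,
            (integral_Ioi_inv_sq hR0).2, mul_one_div]
      _ ≤ _ := by
          refine setIntegral_mono_set hint (Eventually.of_forall fun r => ?_)
            (Ioi_subset_Ioi hR0.le).eventuallyLE
          have := mul_self_nonneg (cumMass g r)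
          simp only [Pi.zero_apply]; positivity
  rw [energyCasimir_eq hm.isSymmetricDensity, J]
  have e4 : w ^ 2 * M = M ^ 2 / (4 * R) := by rw [hw, div_pow, hw2, hR]; field_simp
  have e5 : C₂ * l ^ (1 / μ₂) * M < M / (4 * R) * M := by gcongr
  have e6 : M ^ 2 / R = 4 * (M ^ 2 / (4 * R)) := by field_simp
  have e7 : M / (4 * R) * M = M ^ 2 / (4 * R) := by ring
  have e8 : 0 < M ^ 2 / (4 * R) := by positivity
  linarith

end VlasovPoisson

/-! ### Compactness of minimizing sequences. -/

namespace VlasovPoisson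

/-- Fatou's lemma for integrals bounded by a constant. -/
theorem integrable_and_integral_le_of_tendsto {α : Type*} [MeasurableSpace α] {μ : Measure α}
    {u : ℕ → α → ℝ} {v : α → ℝ} {c : ℝ} (hu : ∀ n, Integrable (u n) μ)
    (h0 : ∀ n, ∀ᵐ x ∂μ, 0 ≤ u n x) (hc : ∀ᶠ n in atTop, ∫ x, u n x ∂μ ≤ c)
    (hlim : ∀ᵐ x ∂μ, Tendsto (fun n => u n x) atTop (𝓝 (v x))) :
    Integrable v μ ∧ ∫ x, v x ∂μ ≤ c := by
  have hv : AEStronglyMeasurable v μ :=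
    aestronglyMeasurable_of_tendsto_ae atTop (fun n => (hu n).aestronglyMeasurable) hlim
  have hv0 : ∀ᵐ x ∂μ, 0 ≤ v x := by
    filter_upwards [hlim, ae_all_iff.2 h0] with x h1 h2
    exact ge_of_tendsto' h1 h2
  have hc0 : 0 ≤ c := by
    obtain ⟨n, hn⟩ := hc.exists
    exact (integral_nonneg_of_ae (h0 n)).trans hn
  have hF : ∫⁻ x, ENNReal.ofReal (v x) ∂μ ≤ ENNReal.ofReal c := by
    calc ∫⁻ x, ENNReal.ofReal (v x) ∂μ
        = ∫⁻ x, liminf (fun n => ENNReal.ofReal (u n x)) atTop ∂μ := by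
          refine lintegral_congr_ae ?_
          filter_upwards [hlim] with x hx
          exact ((ENNReal.tendsto_ofReal hx).liminf_eq).symm
      _ ≤ liminf (fun n => ∫⁻ x, ENNReal.ofReal (u n x) ∂μ) atTop :=
          lintegral_liminf_le' fun n => (hu n).aemeasurable.ennreal_ofReal
      _ ≤ ENNReal.ofReal c := by
          refine liminf_le_of_le (by isBoundedDefault) fun b hb => ?_
          obtain ⟨n, h1, h2⟩ := (hb.and hc).exists
          refine h1.trans ?_
          rw [← ofReal_integral_eq_lintegral_ofReal (hu n) (h0 n)]
          exact ENNReal.ofReal_le_ofReal h2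
  have hvi : Integrable v μ := by
    refine ⟨hv, ?_⟩
    rw [hasFiniteIntegral_iff_ofReal hv0]
    exact hF.trans_lt ENNReal.ofReal_lt_top
  refine ⟨hvi, ?_⟩
  rw [integral_eq_lintegral_of_nonneg_ae hv0 hv]
  exact ENNReal.toReal_le_of_le_ofReal hc0 hF

variable {Q : ℝ → ℝ → ℝ} {M C₁ F₀ μ₁ : ℝ}

theorem exists_truncation_parameters (F₀ C₁ : ℝ) (hμ₁ : 0 < μ₁) (B : ℝ) {ε : ℝ}
    (hε : 0 < ε) :
    ∃ A w, F₀ ≤ A ∧ 0 < w ∧ 1 / w ^ 2 * (2 * B) + A ^ (-(1 / μ₁)) / C₁ * B ≤ ε := by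
  have h1 : Tendsto (fun w : ℝ => 1 / w ^ 2 * (2 * B)) atTop (𝓝 (0 * (2 * B))) :=
    (tendsto_const_nhds.div_atTop (tendsto_pow_atTop (by norm_num))).mul_const _
  have h2 : Tendsto (fun A : ℝ => A ^ (-(1 / μ₁)) / C₁ * B) atTop (𝓝 (0 / C₁ * B)) :=
    ((tendsto_rpow_neg_atTop (by positivity)).div_const _).mul_const _
  rw [zero_mul] at h1
  rw [zero_div, zero_mul] at h2
  obtain ⟨w, hw1, hw⟩ := ((h1.eventually (gt_mem_nhds (half_pos hε))).and
    (eventually_gt_atTop 0)).exists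
  obtain ⟨A, hA1, hA⟩ := ((h2.eventually (gt_mem_nhds (half_pos hε))).and
    (eventually_ge_atTop F₀)).exists
  exact ⟨A, w, hA, hw, by linarith⟩

theorem exists_volume_shell_lt (r : ℝ) {ε : ℝ} (hε : 0 < ε) :
    ∃ δ, 0 < δ ∧ volume {x : E3 | |‖x‖ - r| ≤ δ} ≠ ∞ ∧
      volume.real {x : E3 | |‖x‖ - r| ≤ δ} < ε := by
  set S : ℕ → Set E3 := fun k => {x : E3 | |‖x‖ - r| ≤ 1 / ((k : ℝ) + 1)} with hS
  have hSm (k : ℕ) : MeasurableSet (S k) := measurableSet_le (by fun_prop) measurable_const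
  have hfin (k : ℕ) : volume (S k) ≠ ∞ := by
    refine ne_top_of_le_ne_top (measure_ball_lt_top (μ := volume) (x := (0 : E3)) (r := r + 2)).ne
      (measure_mono fun x hx => ?_)
    have h1 : |‖x‖ - r| ≤ 1 / ((k : ℝ) + 1) := hx
    have h2 : 1 / ((k : ℝ) + 1) ≤ 1 := by
      rw [div_le_one (by positivity)]; linarith [(Nat.cast_nonneg k : (0 : ℝ) ≤ k)]
    rw [mem_ball_zero_iff]
    linarith [abs_le.1 h1]
  have hanti : Antitone S := fun i j hij x hx => by
    have : 1 / ((j : ℝ) + 1) ≤ 1 / ((i : ℝ) + 1) := by gcongr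
    exact le_trans hx this
  have h1 := tendsto_measure_iInter_atTop (μ := volume) (fun k => (hSm k).nullMeasurableSet) hanti
    ⟨0, hfin 0⟩
  have h2 : ⋂ k, S k = Metric.sphere 0 r := by
    ext x
    simp only [hS, mem_iInter, mem_ofPred_eq, mem_sphere_zero_iff_norm]
    constructor
    · intro h
      have h3 : |‖x‖ - r| ≤ 0 :=
        ge_of_tendsto' tendsto_one_div_add_atTop_nhds_zero_nat h
      linarith [abs_eq_zero.1 (le_antisymm h3 (abs_nonneg _))]
    · intro h k
      rw [h, sub_self, abs_zero]; positivity
  rw [h2, Measure.addHaar_sphere] at h1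
  have h3 := h1.eventually (gt_mem_nhds (ENNReal.ofReal_pos.2 hε))
  obtain ⟨k, hk⟩ := h3.exists
  refine ⟨1 / ((k : ℝ) + 1), by positivity, hfin k, ?_⟩
  rw [Measure.real, ← ENNReal.toReal_ofReal hε.le]
  exact (ENNReal.toReal_lt_toReal (hfin k) ENNReal.ofReal_ne_top).2 hk

/-- The mass distributions of densities with bounded `J` are equicontinuous. -/
theorem cumMass_equicontinuous (hC₁ : 0 < C₁) (hF₀ : 0 < F₀) (hμ₁ : 0 < μ₁)
    (hQ : IsCasimirIntegrand Q) (hQ1 : Q1 Q C₁ F₀ μ₁) (B r : ℝ) {ε : ℝ} (hε : 0 < ε) :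
    ∃ δ, 0 < δ ∧ ∀ (M : ℝ) (f : Phase → ℝ), MemFM Q M f → J Q f ≤ B → ∀ q, |q - r| < δ →
      |cumMass f q - cumMass f r| ≤ ε := by
  obtain ⟨A, w, hA, hw, hAw⟩ := exists_truncation_parameters F₀ C₁ hμ₁ B (half_pos hε)
  have hA0 : 0 < A := hF₀.trans_le hA
  set c := A * (4 * Real.pi / 3 * w ^ 3) with hc
  have hc0 : 0 < c := by positivity
  obtain ⟨δ, hδ, hfin, hvol⟩ := exists_volume_shell_lt r (ε := ε / 2 / c) (by positivity)
  refine ⟨δ, hδ, fun M f hf hJ q hq => ?_⟩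
  set S := {x : E3 | |‖x‖ - r| ≤ δ} with hS
  have hSm : MeasurableSet S := measurableSet_le (by fun_prop) measurable_const
  have h1 := hf.setIntegral_le hC₁ hF₀ hμ₁ hQ hQ1 hA hw hSm hfin
  have hAp : 0 < A ^ (-(1 / μ₁)) := Real.rpow_pos_of_pos hA0 _
  have h2 : ∫ z in {z : Phase | z.1 ∈ S}, f z ≤ ε := by
    have e1 : A * (volume.real S * (4 * Real.pi / 3 * w ^ 3)) ≤ ε / 2 := by
      rw [lt_div_iff₀ hc0] at hvol
      rw [hc] at hvol; linarith
    have e2 : 1 / w ^ 2 * (2 * J Q f) + A ^ (-(1 / μ₁)) / C₁ * J Q f ≤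
        1 / w ^ 2 * (2 * B) + A ^ (-(1 / μ₁)) / C₁ * B := by gcongr
    linarith
  have h3 (a b : ℝ) (hab : a ≤ b) (ha : |a - r| ≤ δ) (hb : |b - r| ≤ δ) :
      cumMass f b - cumMass f a ≤ ε := by
    have hd : {z : Phase | ‖z.1‖ < b} = {z : Phase | ‖z.1‖ < a} ∪
        {z : Phase | a ≤ ‖z.1‖ ∧ ‖z.1‖ < b} := by
      ext z; simp only [mem_ofPred_eq, mem_union]
      constructor
      · intro h
        rcases lt_or_ge ‖z.1‖ a with h1 | h1
        · exact Or.inl h1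
        · exact Or.inr ⟨h1, h⟩
      · rintro (h | h)
        · exact h.trans_le hab
        · exact h.2
    have hm2 : MeasurableSet {z : Phase | a ≤ ‖z.1‖ ∧ ‖z.1‖ < b} :=
      (by fun_prop : Measurable fun z : Phase => ‖z.1‖) measurableSet_Ico
    rw [cumMass, hd, setIntegral_union _ hm2 hf.integrable.integrableOn hf.integrable.integrableOn,
      cumMass, add_sub_cancel_left]
    · refine le_trans ?_ h2
      refine setIntegral_mono_set hf.integrable.integrableOn (ae_restrict_of_ae hf.nonneg)
        (Eventually.of_forall fun z hz => ?_)
      have hz' : a ≤ ‖z.1‖ ∧ ‖z.1‖ < b := hz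
      change |‖z.1‖ - r| ≤ δ
      rw [abs_le] at ha hb ⊢
      constructor <;> linarith
    · exact Set.disjoint_left.2 fun z h1 h2 => absurd h1 (not_lt.2 h2.1)
  have hr : |r - r| ≤ δ := by simpa using hδ.le
  have hmono := monotone_cumMass hf.integrable hf.nonneg
  rcases le_total q r with h | h
  · rw [abs_sub_comm, abs_of_nonneg (sub_nonneg.2 (hmono h))]
    exact h3 q r h hq.le hr
  · rw [abs_of_nonneg (sub_nonneg.2 (hmono h))]
    exact h3 r q h hr hq.le

/-- Helly selection for the mass distributions. -/
theorem exists_subseq_cumMass (hC₁ : 0 < C₁) (hF₀ : 0 < F₀) (hμ₁ : 0 < μ₁)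
    (hQ : IsCasimirIntegrand Q) (hQ1 : Q1 Q C₁ F₀ μ₁) (B : ℝ) {g : ℕ → Phase → ℝ}
    (hg : ∀ n, MemFM Q M (g n)) (hB : ∀ n, J Q (g n) ≤ B) :
    ∃ φ : ℕ → ℕ, StrictMono φ ∧ ∃ m : ℝ → ℝ, ∀ r,
      Tendsto (fun n => cumMass (g (φ n)) r) atTop (𝓝 (m r)) := by
  -- Compactness of `[0, M]^ℚ` yields convergence at all rational radii at once; equicontinuity
  -- extends it to every real radius.
  have hK : IsCompact (Set.pi univ fun _ : ℚ => Icc (0 : ℝ) M) :=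
    isCompact_univ_pi fun _ => isCompact_Icc
  obtain ⟨a, -, φ, hφ, ha⟩ := hK.tendsto_subseq (x := fun n (q : ℚ) => cumMass (g n) q)
    fun n q _ => ⟨(hg n).cumMass_nonneg q, (hg n).cumMass_le q⟩
  rw [tendsto_pi_nhds] at ha
  refine ⟨φ, hφ, ?_⟩
  have hlim : ∀ r : ℝ, ∃ l, Tendsto (fun n => cumMass (g (φ n)) r) atTop (𝓝 l) := by
    intro r
    refine cauchySeq_tendsto_of_complete (Metric.cauchySeq_iff'.2 fun ε hε => ?_)
    obtain ⟨δ, hδ, h⟩ := cumMass_equicontinuous hC₁ hF₀ hμ₁ hQ hQ1 B r (ε := ε / 4) (by positivity)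
    obtain ⟨q, hq1, hq2⟩ := exists_rat_btwn (show r - δ < r by linarith)
    have hq : |(q : ℝ) - r| < δ := by rw [abs_lt]; constructor <;> linarith
    obtain ⟨N, hN⟩ := Metric.cauchySeq_iff'.1 (ha q).cauchySeq (ε / 4) (by positivity)
    refine ⟨N, fun n hn => ?_⟩
    have e1 := abs_le.1 (h M _ (hg (φ n)) (hB _) q hq)
    have e2 := abs_le.1 (h M _ (hg (φ N)) (hB _) q hq)
    have e3 := abs_lt.1 (hN n hn)
    rw [Real.dist_eq, abs_lt]
    simp only [Function.comp_apply] at e3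
    constructor <;> linarith
  choose m hm using hlim
  exact ⟨m, hm⟩

/-- The convexity defect of `Q(·, L)` at the midpoint. -/
noncomputable def midGap (Q : ℝ → ℝ → ℝ) (s t L : ℝ) : ℝ :=
  1 / 2 * Q s L + 1 / 2 * Q t L - Q (1 / 2 * s + 1 / 2 * t) L

theorem midGap_nonneg (hQ : IsCasimirIntegrand Q) (hQ4 : Q4 Q) {s t L : ℝ} (hs : 0 ≤ s)
    (ht : 0 ≤ t) (hL : 0 ≤ L) : 0 ≤ midGap Q s t L :=
  sub_nonneg.2 ((hQ.strictConvexOn hQ4 hL).convexOn.2 hs ht (by norm_num) (by norm_num)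
    (by norm_num))

theorem midGap_pos (hQ : IsCasimirIntegrand Q) (hQ4 : Q4 Q) {s t L : ℝ} (hs : 0 ≤ s)
    (ht : 0 ≤ t) (hL : 0 ≤ L) (hst : s ≠ t) : 0 < midGap Q s t L :=
  sub_pos.2 ((hQ.strictConvexOn hQ4 hL).2 hs ht hst (by norm_num) (by norm_num)
    (by norm_num))

/-- Strict convexity made uniform: the defect is continuous and positive on a compact set, on which
the bound on `z` also bounds `L`. Small defects then force closeness in measure. -/
theorem exists_midGap_ge (hQ : IsCasimirIntegrand Q) (hQ4 : Q4 Q) (R A : ℝ) {η : ℝ} (hη : 0 < η) :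
    ∃ c, 0 < c ∧ ∀ (z : Phase) (s t : ℝ), ‖z‖ ≤ R → 0 ≤ s → s ≤ A → 0 ≤ t → t ≤ A → η ≤ |s - t| →
      c ≤ midGap Q s t (angMom z) := by
  set K : Set (Phase × ℝ × ℝ) := (Metric.closedBall 0 R ×ˢ Icc 0 A ×ˢ Icc 0 A) ∩
    {p | η ≤ |p.2.1 - p.2.2|} with hK
  have hKc : IsCompact K := by
    refine ((isCompact_closedBall _ _).prod (isCompact_Icc.prod isCompact_Icc)).inter_right ?_
    exact isClosed_le continuous_const (by fun_prop)
  have hcont : ContinuousOn (fun p : Phase × ℝ × ℝ => midGap Q p.2.1 p.2.2 (angMom p.1)) K := by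
    have haux {u : Phase × ℝ × ℝ → ℝ} (hu : Continuous u) (h0 : ∀ p ∈ K, 0 ≤ u p) :
        ContinuousOn (fun p : Phase × ℝ × ℝ => Q (u p) (angMom p.1)) K :=
      hQ.continuousOn.comp (f := fun p : Phase × ℝ × ℝ => (u p, angMom p.1))
        ((hu.prodMk (continuous_angMom.comp continuous_fst)).continuousOn)
        fun p hp => ⟨h0 p hp, angMom_nonneg _⟩
    have h1 := haux (u := fun p => p.2.1) (by fun_prop) fun p hp => hp.1.2.1.1
    have h2 := haux (u := fun p => p.2.2) (by fun_prop) fun p hp => hp.1.2.2.1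
    have h3 := haux (u := fun p => 1 / 2 * p.2.1 + 1 / 2 * p.2.2) (by fun_prop) fun p hp => by
      have := hp.1.2.1.1; have := hp.1.2.2.1; positivity
    exact ((continuousOn_const.mul h1).add (continuousOn_const.mul h2)).sub h3
  have hpos : ∀ p ∈ K, 0 < midGap Q p.2.1 p.2.2 (angMom p.1) := fun p hp => by
    refine midGap_pos hQ hQ4 hp.1.2.1.1 hp.1.2.2.1 (angMom_nonneg _) fun h => ?_
    have : η ≤ |p.2.1 - p.2.2| := hp.2
    rw [h, sub_self, abs_zero] at this
    linarith
  obtain ⟨c, hc, h⟩ := hKc.exists_forall_le' hcont hpos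
  exact ⟨c, hc, fun z s t hz hs hsA ht htA hst =>
    h (z, s, t) ⟨⟨mem_closedBall_zero_iff.2 hz, ⟨hs, hsA⟩, ⟨ht, htA⟩⟩, hst⟩⟩

theorem integral_midGap {f g : Phase → ℝ} (hf : MemFM Q M f) (hg : MemFM Q M g)
    (hQ : IsCasimirIntegrand Q) (hQ4 : Q4 Q) :
    Integrable (fun z => midGap Q (f z) (g z) (angMom z)) ∧
      ∫ z, midGap Q (f z) (g z) (angMom z) = 1 / 2 * J Q f + 1 / 2 * J Q g -
        J Q ((1 / 2 : ℝ) • f + (1 / 2 : ℝ) • g) := by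
  obtain ⟨hm, -, -⟩ := hf.comb hg hQ hQ4 (a := 1 / 2) (b := 1 / 2) (by norm_num) (by norm_num)
    (by norm_num)
  have k1 := hf.integrable_casimir.const_mul (1 / 2)
  have k2 := hg.integrable_casimir.const_mul (1 / 2)
  have k12 : Integrable fun z => 1 / 2 * Q (f z) (angMom z) + 1 / 2 * Q (g z) (angMom z) :=
    k1.add k2
  have e : (fun z => midGap Q (f z) (g z) (angMom z)) = fun z =>
      1 / 2 * Q (f z) (angMom z) + 1 / 2 * Q (g z) (angMom z) -
        Q (((1 / 2 : ℝ) • f + (1 / 2 : ℝ) • g) z) (angMom z) := rfl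
  have hkin : (fun z : Phase => ‖z.2‖ ^ 2 * ((1 / 2 : ℝ) • f + (1 / 2 : ℝ) • g) z) =
      fun z => 1 / 2 * (‖z.2‖ ^ 2 * f z) + 1 / 2 * (‖z.2‖ ^ 2 * g z) := by
    ext z; simp only [Pi.add_apply, Pi.smul_apply, smul_eq_mul]; ring
  rw [e]
  refine ⟨k12.sub hm.integrable_casimir, ?_⟩
  rw [integral_sub k12 hm.integrable_casimir, integral_add k1 k2, integral_const_mul,
    integral_const_mul, J, J, J, hkin, integral_add (hf.integrable_kinetic.const_mul _)
    (hg.integrable_kinetic.const_mul _), integral_const_mul, integral_const_mul]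
  ring

/-- The midpoint of `f` and `g` is a competitor for the minimum. The kinetic term is linear, so the
defect of `𝒟` at the midpoint is that of `Q` minus half the defect of the quadratic form, which the
parallelogram identity gives as `¼ I(f - g)`. -/
theorem integral_midGap_le {f f₀ g : Phase → ℝ} (hf₀ : IsMinimizer Q M f₀) (hf : MemFM Q M f)
    (hg : MemFM Q M g) (hff : FiniteField f) (hgf : FiniteField g)
    (hQ : IsCasimirIntegrand Q) (hQ4 : Q4 Q) :
    ∫ z, midGap Q (f z) (g z) (angMom z) ≤
      1 / 2 * (energyCasimir Q f - energyCasimir Q f₀) +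
        1 / 2 * (energyCasimir Q g - energyCasimir Q f₀) +
        1 / 8 * interaction (f - g) (f - g) := by
  obtain ⟨hm, -, -⟩ := hf.comb hg hQ hQ4 (a := 1 / 2) (b := 1 / 2) (by norm_num) (by norm_num)
    (by norm_num)
  have h := hf₀.2 _ hm
  rw [(integral_midGap hf hg hQ hQ4).2, energyCasimir_eq hf.isSymmetricDensity,
    energyCasimir_eq hg.isSymmetricDensity, interaction_sub_self hff hgf hf.integrable hg.integrable]
  rw [energyCasimir_eq hm.isSymmetricDensity,
    interaction_comb hff hgf hf.integrable hg.integrable] at h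
  linarith

/-- A sequence whose mutual convexity defects tend to zero has an a.e. convergent subsequence. -/
theorem exists_subseq_ae_tendsto (hM : 0 < M) (hQ : IsCasimirIntegrand Q) (hQ4 : Q4 Q)
    {g : ℕ → Phase → ℝ} (hg : ∀ n, MemFM Q M (g n))
    (hgap : ∀ c > 0, ∃ N, ∀ n ≥ N, ∀ k ≥ N, ∫ z, midGap Q (g n z) (g k z) (angMom z) ≤ c) :
    ∃ ψ : ℕ → ℕ, StrictMono ψ ∧ ∃ h : Phase → ℝ, ∀ᵐ z : Phase,
      Tendsto (fun n => g (ψ n) z) atTop (𝓝 (h z)) := by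
  set S : ℕ → ℕ → ℕ → Set Phase := fun j n k =>
    {z | ‖z‖ ≤ j ∧ (1 / 2 : ℝ) ^ j ≤ |g n z - g k z|} with hS
  have hmeas : ∀ j, ∀ᶠ n in atTop, ∀ k ≥ n, volume (S j n k) ≤ ENNReal.ofReal ((1 / 2) ^ j) := by
    intro j
    set η : ℝ := (1 / 2) ^ j with hη
    have hη0 : 0 < η := by positivity
    -- By Chebyshev's inequality each set `{g i ≥ A}` has measure at most `η/4`, which leaves `η/2`
    -- for the set where the defect is at least `c`.
    set A := 4 * M / η with hA
    have hA0 : 0 < A := by positivity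
    obtain ⟨c, hc, hcg⟩ := exists_midGap_ge hQ hQ4 j A hη0
    obtain ⟨N, hN⟩ := hgap (c * (η / 2)) (by positivity)
    filter_upwards [eventually_ge_atTop N] with n hn k hk
    have htail (i : ℕ) : volume {z | A ≤ g i z} ≤ ENNReal.ofReal (η / 4) := by
      have h1 := mul_meas_ge_le_integral_of_nonneg (hg i).nonneg (hg i).integrable A
      rw [(hg i).mass] at h1
      have h2 : volume {z | A ≤ g i z} ≠ ∞ := ((hg i).integrable.measure_ge_lt_top hA0).ne
      rw [ENNReal.le_ofReal_iff_toReal_le h2 (by positivity), ← Measure.real]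
      have h3 : A * (η / 4) = M := by rw [hA]; field_simp
      exact le_of_mul_le_mul_left (h1.trans_eq h3.symm) hA0
    have hbulk : volume {z | c ≤ midGap Q (g n z) (g k z) (angMom z)} ≤ ENNReal.ofReal (η / 2) := by
      have hgi := (integral_midGap (hg n) (hg k) hQ hQ4).1
      have hg0 : ∀ᵐ z, 0 ≤ midGap Q (g n z) (g k z) (angMom z) := by
        filter_upwards [(hg n).nonneg, (hg k).nonneg] with z h1 h2
        exact midGap_nonneg hQ hQ4 h1 h2 (angMom_nonneg z)
      have h1 := mul_meas_ge_le_integral_of_nonneg hg0 hgi c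
      have h2 := (hgi.measure_ge_lt_top hc).ne
      rw [ENNReal.le_ofReal_iff_toReal_le h2 (by positivity), ← Measure.real]
      exact le_of_mul_le_mul_left (h1.trans (hN n hn k (hn.trans hk))) hc
    have hsub : volume (S j n k) ≤ volume (({z | A ≤ g n z} ∪ {z | A ≤ g k z}) ∪
        {z | c ≤ midGap Q (g n z) (g k z) (angMom z)}) := by
      refine measure_mono_ae ?_
      filter_upwards [(hg n).nonneg, (hg k).nonneg] with z h1 h2 hz
      by_cases hn' : A ≤ g n z
      · exact Or.inl (Or.inl hn')
      by_cases hk' : A ≤ g k z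
      · exact Or.inl (Or.inr hk')
      exact Or.inr (hcg z _ _ hz.1 h1 (not_le.1 hn').le h2 (not_le.1 hk').le hz.2)
    calc volume (S j n k) ≤ _ := hsub
      _ ≤ (volume {z | A ≤ g n z} + volume {z | A ≤ g k z}) +
          volume {z | c ≤ midGap Q (g n z) (g k z) (angMom z)} :=
        (measure_union_le _ _).trans (add_le_add_left (measure_union_le _ _) _)
      _ ≤ (ENNReal.ofReal (η / 4) + ENNReal.ofReal (η / 4)) + ENNReal.ofReal (η / 2) := by
        gcongr
        · exact htail n
        · exact htail k
      _ = ENNReal.ofReal η := by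
        rw [← ENNReal.ofReal_add (by positivity) (by positivity),
          ← ENNReal.ofReal_add (by positivity) (by positivity)]
        congr 1; ring
  obtain ⟨ψ, hψ, hψS⟩ := extraction_forall_of_eventually hmeas
  refine ⟨ψ, hψ, ?_⟩
  -- Borel-Cantelli: almost every `z` lies in finitely many of these sets. Once `j ≥ ‖z‖` as well,
  -- consecutive terms of the subsequence differ by less than `2^(-j)`.
  have hsum : ∑' j, volume (S j (ψ j) (ψ (j + 1))) ≠ ∞ := by
    refine ne_top_of_le_ne_top ?_ (ENNReal.tsum_le_tsum fun j =>
      hψS j (ψ (j + 1)) (hψ.monotone (Nat.le_succ j)))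
    rw [← ENNReal.ofReal_tsum_of_nonneg (fun _ => by positivity) summable_geometric_two]
    exact ENNReal.ofReal_ne_top
  have hconv : ∀ᵐ z : Phase, ∃ l, Tendsto (fun n => g (ψ n) z) atTop (𝓝 l) := by
    filter_upwards [ae_eventually_notMem hsum] with z hz
    obtain ⟨j₁, hj₁⟩ := exists_nat_ge ‖z‖
    obtain ⟨j₂, hj₂⟩ := eventually_atTop.1 hz
    set j₀ := max j₁ j₂
    have hc : CauchySeq fun n => g (ψ (n + j₀)) z := by
      refine cauchySeq_of_le_geometric (1 / 2) 1 (by norm_num) fun n => ?_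
      have h1 := hj₂ (n + j₀) ((le_max_right _ _).trans (Nat.le_add_left _ _))
      have h2 : ‖z‖ ≤ ((n + j₀ : ℕ) : ℝ) :=
        hj₁.trans (Nat.cast_le.2 ((le_max_left _ _).trans (Nat.le_add_left _ _)))
      have h3 : |g (ψ (n + j₀)) z - g (ψ (n + j₀ + 1)) z| < (1 / 2) ^ (n + j₀) := by
        by_contra! hcon
        exact h1 ⟨h2, hcon⟩
      rw [Real.dist_eq, one_mul, show n + 1 + j₀ = n + j₀ + 1 by ring]
      refine h3.le.trans ?_
      exact pow_le_pow_of_le_one (by norm_num) (by norm_num) (Nat.le_add_right _ _)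
    obtain ⟨l, hl⟩ := cauchySeq_tendsto_of_complete hc
    exact ⟨l, (tendsto_add_atTop_iff_nat j₀).1 hl⟩
  classical
  refine ⟨fun z => if h : ∃ l, Tendsto (fun n => g (ψ n) z) atTop (𝓝 l) then h.choose else 0, ?_⟩
  filter_upwards [hconv] with z hz
  rw [dif_pos hz]
  exact hz.choose_spec

end VlasovPoisson

/-! ### Passage to the limit, and convergence of the fields to that of the minimizer. -/

namespace VlasovPoisson

variable {Q : ℝ → ℝ → ℝ} {M C₁ C₂ F₀ μ₁ μ₂ μ₃ : ℝ}

theorem MemFM.abs_cumMass_sub_truncation_le {M B A w : ℝ} {f : Phase → ℝ} (hf : MemFM Q M f)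
    (hC₁ : 0 < C₁) (hF₀ : 0 < F₀) (hμ₁ : 0 < μ₁) (hQ : IsCasimirIntegrand Q) (hQ1 : Q1 Q C₁ F₀ μ₁)
    (hJ : J Q f ≤ B) (hA : F₀ ≤ A) (hw : 0 < w) (r : ℝ) :
    |cumMass f r - ∫ z in {z : Phase | ‖z.1‖ < r}, (if ‖z.2‖ < w then min (f z) A else 0)| ≤
      1 / w ^ 2 * (2 * B) + A ^ (-(1 / μ₁)) / C₁ * B := by
  have hA0 : 0 < A := hF₀.trans_le hA
  have hAp : 0 < A ^ (-(1 / μ₁)) := Real.rpow_pos_of_pos hA0 _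
  have hT : MeasurableSet {z : Phase | ‖z.2‖ < w} := measurableSet_lt (by fun_prop) (by fun_prop)
  have hφ : Integrable fun z : Phase => if ‖z.2‖ < w then min (f z) A else 0 := by
    have h1 : AEStronglyMeasurable fun z : Phase => if ‖z.2‖ < w then min (f z) A else 0 :=
      (hf.integrable.aestronglyMeasurable.inf aestronglyMeasurable_const).indicator hT
    refine hf.integrable.mono' h1 ?_
    filter_upwards [hf.nonneg] with z hz
    split_ifs
    · rw [Real.norm_of_nonneg (le_min hz hA0.le)]; exact min_le_left _ _
    · simpa using hz
  have k2 := hf.integrable_kinetic.const_mul (1 / w ^ 2)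
  have k3 := hf.integrable_casimir.const_mul (A ^ (-(1 / μ₁)) / C₁)
  have k23 : Integrable fun z : Phase => 1 / w ^ 2 * (‖z.2‖ ^ 2 * f z) +
      A ^ (-(1 / μ₁)) / C₁ * Q (f z) (angMom z) := k2.add k3
  rw [cumMass, ← integral_sub hf.integrable.integrableOn hφ.integrableOn]
  have hlow : ∀ᵐ z : Phase, 0 ≤ f z - (if ‖z.2‖ < w then min (f z) A else 0) := by
    filter_upwards [hf.nonneg] with z hz
    split_ifs
    · exact sub_nonneg.2 (min_le_left _ _)
    · simpa using hz
  rw [abs_of_nonneg (setIntegral_nonneg_of_ae hlow)]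
  refine (setIntegral_le_integral (hf.integrable.sub hφ) hlow).trans ?_
  calc ∫ z : Phase, (f z - if ‖z.2‖ < w then min (f z) A else 0)
      ≤ ∫ z : Phase, (1 / w ^ 2 * (‖z.2‖ ^ 2 * f z) +
          A ^ (-(1 / μ₁)) / C₁ * Q (f z) (angMom z)) := by
        refine integral_mono_ae (hf.integrable.sub hφ) k23 ?_
        filter_upwards [hf.nonneg] with z hz
        have := le_truncation hC₁ hF₀ hμ₁ hQ hQ1 hA hw hz z
        linarith
    _ = 1 / w ^ 2 * (∫ z : Phase, ‖z.2‖ ^ 2 * f z) +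
          A ^ (-(1 / μ₁)) / C₁ * ∫ z : Phase, Q (f z) (angMom z) := by
        rw [integral_add k2 k3, integral_const_mul, integral_const_mul]
    _ ≤ _ := by
        gcongr
        · exact (hf.integral_kinetic_le_J hQ).trans (by linarith)
        · exact hf.integral_casimir_le_J.trans hJ

/-- Fatou alone would allow loss of mass. Truncated in value and velocity, the densities are bounded
and live on a bounded set over `|x| < r`, so dominated convergence applies; the truncation error is
uniform because `J` is bounded. The limit may have another total mass `M'`, since mass could still
escape to large `|x|`. -/
theorem tendsto_cumMass_of_ae (hC₁ : 0 < C₁) (hF₀ : 0 < F₀) (hμ₁ : 0 < μ₁)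
    (hQ : IsCasimirIntegrand Q) (hQ1 : Q1 Q C₁ F₀ μ₁) {B M' : ℝ} {g : ℕ → Phase → ℝ}
    {h : Phase → ℝ} (hg : ∀ n, MemFM Q M (g n)) (hB : ∀ n, J Q (g n) ≤ B)
    (hh : MemFM Q M' h) (hhB : J Q h ≤ B)
    (hlim : ∀ᵐ z : Phase, Tendsto (fun n => g n z) atTop (𝓝 (h z))) (r : ℝ) :
    Tendsto (fun n => cumMass (g n) r) atTop (𝓝 (cumMass h r)) := by
  rw [Metric.tendsto_atTop]
  intro ε hε
  obtain ⟨A, w, hA, hw, hAw⟩ := exists_truncation_parameters F₀ C₁ hμ₁ B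
    (show 0 < ε / 4 by positivity)
  have hA0 : 0 < A := hF₀.trans_le hA
  set T : Set Phase := Metric.ball (0 : E3) r ×ˢ Metric.ball (0 : E3) w with hT
  have hTm : MeasurableSet T := measurableSet_ball.prod measurableSet_ball
  have hTf : volume T ≠ ∞ := by
    rw [hT, Measure.volume_eq_prod, Measure.prod_prod]
    exact ENNReal.mul_ne_top measure_ball_lt_top.ne measure_ball_lt_top.ne
  have hw' : MeasurableSet {z : Phase | ‖z.2‖ < w} := measurableSet_lt (by fun_prop) (by fun_prop)
  set φ : (Phase → ℝ) → Phase → ℝ := fun f z => if ‖z.2‖ < w then min (f z) A else 0 with hφ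
  have h1 : Tendsto (fun n => ∫ z in {z : Phase | ‖z.1‖ < r}, φ (g n) z) atTop
      (𝓝 (∫ z in {z : Phase | ‖z.1‖ < r}, φ h z)) := by
    refine tendsto_integral_of_dominated_convergence (T.indicator fun _ => A) (fun n => ?_) ?_
      (fun n => ?_) ?_
    · exact (((hg n).integrable.aestronglyMeasurable.inf aestronglyMeasurable_const).indicator
        hw').restrict
    · exact ((integrableOn_const hTf).integrable_indicator hTm).integrableOn
    · refine (ae_restrict_iff' (measurableSet_norm_fst_lt r)).2 ?_
      filter_upwards [(hg n).nonneg] with z hz hzr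
      have hzr' : ‖z.1‖ < r := hzr
      by_cases hzw : ‖z.2‖ < w
      · have hzT : z ∈ T := ⟨mem_ball_zero_iff.2 hzr', mem_ball_zero_iff.2 hzw⟩
        simp only [hφ, hzw, if_true, indicator_of_mem hzT]
        rw [Real.norm_of_nonneg (le_min hz hA0.le)]
        exact min_le_right _ _
      · simp only [hφ, hzw, if_false, norm_zero]
        exact indicator_nonneg (fun _ _ => hA0.le) _
    · refine ae_restrict_of_ae ?_
      filter_upwards [hlim] with z hz
      simp only [hφ]
      split_ifs
      · exact hz.min tendsto_const_nhds
      · exact tendsto_const_nhds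
  obtain ⟨N, hN⟩ := Metric.tendsto_atTop.1 h1 (ε / 4) (by positivity)
  refine ⟨N, fun n hn => ?_⟩
  have e1 := abs_le.1 ((hg n).abs_cumMass_sub_truncation_le hC₁ hF₀ hμ₁ hQ hQ1 (hB n) hA hw r)
  have e2 := abs_le.1 (hh.abs_cumMass_sub_truncation_le hC₁ hF₀ hμ₁ hQ hQ1 hhB hA hw r)
  have e3 := hN n hn
  rw [Real.dist_eq, abs_lt] at e3 ⊢
  simp only [hφ] at e3
  constructor <;> linarith

theorem tendsto_integral_sq_sub {m : ℕ → ℝ → ℝ} {l b : ℝ → ℝ} (hb : IntegrableOn b (Ioi 0))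
    (hm : ∀ n, Measurable (m n)) (hmb : ∀ n, ∀ r > 0, m n r ^ 2 / r ^ 2 ≤ b r)
    (hlim : ∀ r > 0, Tendsto (fun n => m n r) atTop (𝓝 (l r))) :
    (∀ n, IntegrableOn (fun r => (m n r - l r) ^ 2 / r ^ 2) (Ioi 0)) ∧
    Tendsto (fun n => ∫ r in Ioi (0 : ℝ), (m n r - l r) ^ 2 / r ^ 2) atTop (𝓝 0) := by
  have hl : AEStronglyMeasurable l (volume.restrict (Ioi 0)) :=
    aestronglyMeasurable_of_tendsto_ae atTop (fun n => (hm n).aestronglyMeasurable)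
      ((ae_restrict_iff' measurableSet_Ioi).2 (Eventually.of_forall hlim))
  have hlb : ∀ r > 0, l r ^ 2 / r ^ 2 ≤ b r := fun r hr =>
    le_of_tendsto' (((hlim r hr).pow 2).div_const _) fun n => hmb n r hr
  have hmeas (n : ℕ) : AEStronglyMeasurable (fun r => (m n r - l r) ^ 2 / r ^ 2)
      (volume.restrict (Ioi 0)) := by
    have h1 : Measurable fun r : ℝ => (r ^ 2)⁻¹ := by fun_prop
    simp_rw [div_eq_mul_inv]
    exact (((hm n).aestronglyMeasurable.sub hl).pow 2).mul h1.aestronglyMeasurable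
  have hbd (n : ℕ) : ∀ᵐ r ∂volume.restrict (Ioi (0 : ℝ)),
      ‖(m n r - l r) ^ 2 / r ^ 2‖ ≤ 4 * b r := by
    refine (ae_restrict_iff' measurableSet_Ioi).2 (Eventually.of_forall fun r hr => ?_)
    rw [Real.norm_of_nonneg (by positivity)]
    have h1 : (m n r - l r) ^ 2 / r ^ 2 ≤ 2 * (m n r ^ 2 / r ^ 2) + 2 * (l r ^ 2 / r ^ 2) := by
      rw [← mul_div_assoc, ← mul_div_assoc, ← add_div]
      gcongr
      nlinarith [sq_nonneg (m n r + l r)]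
    linarith [hmb n r hr, hlb r hr]
  refine ⟨fun n => (hb.const_mul 4).mono' (hmeas n) (hbd n), ?_⟩
  have h := tendsto_integral_of_dominated_convergence (f := fun _ => 0)
    (fun r => 4 * b r) hmeas (hb.const_mul 4) hbd ?_
  · simpa using h
  · refine (ae_restrict_iff' measurableSet_Ioi).2 (Eventually.of_forall fun r hr => ?_)
    have h1 : Tendsto (fun n => (m n r - l r) ^ 2 / r ^ 2) atTop (𝓝 ((l r - l r) ^ 2 / r ^ 2)) :=
      (((hlim r hr).sub tendsto_const_nhds).pow 2).div_const _
    simpa using h1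

theorem interaction_self_eq (f : Phase → ℝ) :
    interaction f f = ∫ r in Ioi (0 : ℝ), cumMass f r ^ 2 / r ^ 2 := by
  simp only [interaction, pow_two]

theorem IsSphericallySymmetric.of_tendsto {g : ℕ → Phase → ℝ} {h : Phase → ℝ}
    (hg : ∀ n, IsSphericallySymmetric (g n))
    (hlim : ∀ᵐ z : Phase, Tendsto (fun n => g n z) atTop (𝓝 (h z))) :
    IsSphericallySymmetric h := fun A hA => by
  filter_upwards [hlim, (measurePreserving_rotate A).quasiMeasurePreserving.ae hlim,
    ae_all_iff.2 fun n => hg n A hA] with z h1 h2 h3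
  refine tendsto_nhds_unique h2 ?_
  simpa only [h3] using h1

/-- Every minimizing sequence in `ℱ_M` whose mass distributions converge has its field converge to
the field of the minimizer. -/
theorem cumMass_limit_eq (hC₁ : 0 < C₁) (hF₀ : 0 < F₀) (hμ₁ : 0 < μ₁)
    (hμ₁' : μ₁ < 3 / 2) (hμ₂ : 0 < μ₂) (hμ₂' : μ₂ < 3 / 2) (hμ₃ : 0 < μ₃)
    (hQ : IsCasimirIntegrand Q) (hQ1 : Q1 Q C₁ F₀ μ₁) (hQ2 : Q2 Q C₂ F₀ μ₂) (hQ3 : Q3 Q μ₃)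
    (hQ4 : Q4 Q) (hM : 0 < M) {f₀ : Phase → ℝ} (hf₀ : IsMinimizer Q M f₀)
    (huniq : ∀ g : Phase → ℝ, IsMinimizer Q M g → g =ᵐ[volume] f₀) {g : ℕ → Phase → ℝ}
    (hg : ∀ n, MemFM Q M (g n))
    (hmin : Tendsto (fun n => energyCasimir Q (g n)) atTop (𝓝 (energyCasimir Q f₀)))
    {B : ℝ} (hB : ∀ n, J Q (g n) ≤ B) {b m : ℝ → ℝ} (hb : IntegrableOn b (Ioi 0))
    (hgb : ∀ n, ∀ r > 0, cumMass (g n) r ^ 2 / r ^ 2 ≤ b r)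
    (hm : ∀ r, Tendsto (fun n => cumMass (g n) r) atTop (𝓝 (m r))) :
    ∀ r, m r = cumMass f₀ r := by
  have hff (n : ℕ) := (hg n).finiteField hC₁ hF₀ hμ₁ hμ₁' hQ hQ1
  obtain ⟨hmi, hm0⟩ := tendsto_integral_sq_sub hb
    (fun n => (continuous_cumMass (hg n).integrable).measurable) hgb fun r _ => hm r
  -- mutual distances of the fields
  have hcauchy (n k : ℕ) : interaction (g n - g k) (g n - g k) ≤
      2 * (∫ r in Ioi (0 : ℝ), (cumMass (g n) r - m r) ^ 2 / r ^ 2) +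
        2 * ∫ r in Ioi (0 : ℝ), (cumMass (g k) r - m r) ^ 2 / r ^ 2 := by
    rw [interaction_self_eq, ← integral_const_mul, ← integral_const_mul,
      ← integral_add ((hmi n).const_mul 2) ((hmi k).const_mul 2)]
    refine integral_mono ((hff n).sub (hff k) (hg n).integrable (hg k).integrable)
      (((hmi n).const_mul 2).add ((hmi k).const_mul 2)) fun r => ?_
    simp only [cumMass_sub (hg n).integrable (hg k).integrable]
    rw [← mul_div_assoc, ← mul_div_assoc, ← add_div]
    gcongr
    nlinarith [sq_nonneg (cumMass (g n) r - m r + (cumMass (g k) r - m r))]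
  have hgap : ∀ c > 0, ∃ N, ∀ n ≥ N, ∀ k ≥ N, ∫ z, midGap Q (g n z) (g k z) (angMom z) ≤ c := by
    intro c hc
    obtain ⟨N, hN⟩ := eventually_atTop.1 ((hmin.eventually (gt_mem_nhds
      (show energyCasimir Q f₀ < energyCasimir Q f₀ + c / 2 by linarith))).and
      (hm0.eventually (gt_mem_nhds (show 0 < c by positivity))))
    refine ⟨N, fun n hn k hk => ?_⟩
    have h1 := integral_midGap_le hf₀ (hg n) (hg k) (hff n) (hff k) hQ hQ4
    have h2 := hcauchy n k
    linarith [(hN n hn).1, (hN n hn).2, (hN k hk).1, (hN k hk).2]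
  obtain ⟨ψ, hψ, h, hlim⟩ := exists_subseq_ae_tendsto hM hQ hQ4 hg hgap
  have hψt := hψ.tendsto_atTop
  have hh0 : ∀ᵐ z : Phase, 0 ≤ h z := by
    filter_upwards [hlim, ae_all_iff.2 fun n => (hg n).nonneg] with z h1 h2
    exact ge_of_tendsto' h1 fun n => h2 (ψ n)
  obtain ⟨hhi, hhM⟩ := integrable_and_integral_le_of_tendsto (fun n => (hg (ψ n)).integrable)
    (fun n => (hg (ψ n)).nonneg) (Eventually.of_forall fun n => (hg (ψ n)).mass.le) hlim
  have hQlim : ∀ᵐ z : Phase, Tendsto (fun n => Q (g (ψ n) z) (angMom z)) atTop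
      (𝓝 (Q (h z) (angMom z))) := by
    filter_upwards [hlim, hh0, ae_all_iff.2 fun n => (hg n).nonneg] with z h1 h2 h3
    have hc := hQ.continuous_max
    have h4 : Tendsto (fun n => Q (max (g (ψ n) z) 0) (max (angMom z) 0)) atTop
        (𝓝 (Q (max (h z) 0) (max (angMom z) 0))) :=
      (hc.tendsto (h z, angMom z)).comp (h1.prodMk_nhds tendsto_const_nhds)
    rw [max_eq_left h2, max_eq_left (angMom_nonneg z)] at h4
    refine h4.congr fun n => ?_
    rw [max_eq_left (h3 (ψ n))]
  have hKlim : ∀ᵐ z : Phase, Tendsto (fun n => ‖z.2‖ ^ 2 * g (ψ n) z) atTop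
      (𝓝 (‖z.2‖ ^ 2 * h z)) := by
    filter_upwards [hlim] with z h1
    exact h1.const_mul _
  have hhQ := (integrable_and_integral_le_of_tendsto (fun n => (hg (ψ n)).integrable_casimir)
    (fun n => (hg (ψ n)).casimir_nonneg hQ)
    (Eventually.of_forall fun n => (hg (ψ n)).integral_casimir_le_J.trans (hB _)) hQlim).1
  have hhK := (integrable_and_integral_le_of_tendsto (fun n => (hg (ψ n)).integrable_kinetic)
    (fun n => (hg (ψ n)).kinetic_nonneg) (Eventually.of_forall fun n =>
      ((hg (ψ n)).integral_kinetic_le_J hQ).trans (mul_le_mul_of_nonneg_left (hB _) two_pos.le))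
      hKlim).1
  set M' := ∫ z, h z with hM'
  have hh : MemFM Q M' h := ⟨hhi, hh0, rfl, hhQ, hhK,
    IsSphericallySymmetric.of_tendsto (fun n => (hg (ψ n)).symmetric) hlim⟩
  have hhf := hh.finiteField hC₁ hF₀ hμ₁ hμ₁' hQ hQ1
  -- lower semicontinuity of `J`
  have hJle : ∀ c, (∀ᶠ n in atTop, J Q (g (ψ n)) ≤ c) → J Q h ≤ c := by
    intro c hc
    have h1 (n : ℕ) := (hg (ψ n)).integrable_casimir.add
      ((hg (ψ n)).integrable_kinetic.const_mul (1 / 2))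
    have h2 := integrable_and_integral_le_of_tendsto (c := c) h1 (fun n => ?_) ?_
      (v := (fun z => Q (h z) (angMom z)) + fun z => 1 / 2 * (‖z.2‖ ^ 2 * h z)) ?_
    · have h3 := h2.2
      rwa [integral_add' hhQ (hhK.const_mul _), integral_const_mul] at h3
    · filter_upwards [(hg (ψ n)).casimir_nonneg hQ, (hg (ψ n)).kinetic_nonneg] with z k1 k2
      simp only [Pi.add_apply]; positivity
    · filter_upwards [hc] with n hn
      rwa [integral_add' (hg (ψ n)).integrable_casimir
        ((hg (ψ n)).integrable_kinetic.const_mul _), integral_const_mul]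
    · filter_upwards [hQlim, hKlim] with z k1 k2
      exact k1.add (k2.const_mul _)
  have hhB : J Q h ≤ B := hJle B (Eventually.of_forall fun n => hB _)
  have hcum (r : ℝ) : m r = cumMass h r :=
    tendsto_nhds_unique ((hm r).comp hψt)
      (tendsto_cumMass_of_ae hC₁ hF₀ hμ₁ hQ hQ1 (fun n => hg (ψ n)) (fun n => hB _) hh hhB hlim r)
  have hint : Tendsto (fun n => interaction (g n) (g n)) atTop (𝓝 (interaction h h)) := by
    simp_rw [interaction_self_eq]
    refine tendsto_integral_of_dominated_convergence b (fun n => ?_) hb (fun n => ?_) ?_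
    · exact (((continuous_cumMass (hg n).integrable).measurable.pow_const 2).div
        (by fun_prop)).aestronglyMeasurable
    · refine (ae_restrict_iff' measurableSet_Ioi).2 (Eventually.of_forall fun r hr => ?_)
      rw [Real.norm_of_nonneg (by positivity)]
      exact hgb n r hr
    · refine Eventually.of_forall fun r => ?_
      rw [← hcum]
      exact ((hm r).pow 2).div_const _
  -- `J` is lower semicontinuous by Fatou while the field energy converges, so the sign of the field
  -- term does no harm. The mass of `h` is still unknown.
  have hDle : energyCasimir Q h ≤ energyCasimir Q f₀ := by
    refine le_of_forall_pos_le_add fun η hη => ?_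
    rw [energyCasimir_eq hh.isSymmetricDensity]
    have h1 : J Q h ≤ energyCasimir Q f₀ + 1 / 2 * interaction h h + η := by
      refine hJle _ ?_
      have h2 := (hmin.add (hint.const_mul (1 / 2))).comp hψt
      filter_upwards [h2.eventually (gt_mem_nhds (lt_add_of_pos_right _ hη))] with n hn
      simp only [Function.comp_apply] at hn
      rw [energyCasimir_eq (hg (ψ n)).isSymmetricDensity] at hn
      linarith
    linarith
  -- no mass is lost
  obtain ⟨gn, hgn, hgneg⟩ := exists_energyCasimir_neg hM hC₁ hF₀ hμ₁ hμ₁' hμ₂ hμ₂' hQ hQ1 hQ2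
  have hneg : energyCasimir Q f₀ < 0 := (hf₀.2 gn hgn).trans_lt hgneg
  -- With zero mass there would be no field, and `𝒟(h) = J(h) ≥ 0` would contradict `𝒟(h) ≤ 𝒟(f₀) <
  -- 0`.
  have hM'0 : 0 < M' := by
    refine lt_of_le_of_ne hh.mass_nonneg fun h0 => ?_
    have hc0 (r : ℝ) : cumMass h r = 0 :=
      le_antisymm ((hh.cumMass_le r).trans h0.symm.le) (hh.cumMass_nonneg r)
    have hi0 : interaction h h = 0 := by simp [interaction, hc0]
    have := hh.J_nonneg hQ
    rw [energyCasimir_eq hh.isSymmetricDensity, hi0] at hDle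
    linarith
  obtain ⟨p, k, hp, hpk, hk1, hkM⟩ := hh.exists_rescale hQ hμ₃ hQ3 hM'0 hhM
  -- From `𝒟(f₀) ≤ 𝒟(p) ≤ k 𝒟(h) ≤ k 𝒟(f₀)` and `𝒟(f₀) < 0` follows `k ≤ 1`.
  have hk : k = 1 := by
    have h1 := hf₀.2 p hp
    have h2 : k * energyCasimir Q h ≤ k * energyCasimir Q f₀ := by gcongr
    nlinarith
  have hMM := hkM hk
  rw [hMM] at hh
  have hhmin : IsMinimizer Q M h := ⟨hh, fun q hq => hDle.trans (hf₀.2 q hq)⟩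
  intro r
  rw [hcum, cumMass_congr (huniq h hhmin)]

/-- By contradiction: a minimizing sequence with fields at distance at least `ε` has a subsequence
whose mass distributions converge under a common majorant. Their limit is that of `f₀`, so the
distances of the fields tend to zero along it. -/
theorem exists_delta_interaction_lt (hC₁ : 0 < C₁) (hF₀ : 0 < F₀) (hμ₁ : 0 < μ₁)
    (hμ₁' : μ₁ < 3 / 2) (hμ₂ : 0 < μ₂) (hμ₂' : μ₂ < 3 / 2) (hμ₃ : 0 < μ₃)
    (hQ : IsCasimirIntegrand Q) (hQ1 : Q1 Q C₁ F₀ μ₁) (hQ2 : Q2 Q C₂ F₀ μ₂) (hQ3 : Q3 Q μ₃)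
    (hQ4 : Q4 Q) (hM : 0 < M) {f₀ : Phase → ℝ} (hf₀ : IsMinimizer Q M f₀)
    (huniq : ∀ g : Phase → ℝ, IsMinimizer Q M g → g =ᵐ[volume] f₀) {ε : ℝ} (hε : 0 < ε) :
    ∃ δ, 0 < δ ∧ ∀ g : Phase → ℝ, MemFM Q M g →
      energyCasimir Q g < energyCasimir Q f₀ + δ → interaction (g - f₀) (g - f₀) < ε := by
  by_contra! hcon
  have hpos (n : ℕ) : (0 : ℝ) < 1 / ((n : ℝ) + 1) := by positivity
  choose g hg hgD hgε using fun n : ℕ => hcon (1 / ((n : ℝ) + 1)) (hpos n)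
  have hmin : Tendsto (fun n => energyCasimir Q (g n)) atTop (𝓝 (energyCasimir Q f₀)) := by
    refine tendsto_of_tendsto_of_tendsto_of_le_of_le tendsto_const_nhds
      (h := fun n : ℕ => energyCasimir Q f₀ + 1 / ((n : ℝ) + 1)) ?_ (fun n => hf₀.2 _ (hg n))
      fun n => (hgD n).le
    simpa using tendsto_const_nhds.add
      (tendsto_one_div_add_atTop_nhds_zero_nat (𝕜 := ℝ))
  obtain ⟨B, hBf⟩ := exists_J_le hC₁ hF₀ hμ₁ hμ₁' hQ hQ1 M (energyCasimir Q f₀ + 1)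
  have hB (n : ℕ) : J Q (g n) ≤ B := by
    refine hBf _ (hg n) ((hgD n).le.trans ?_)
    have : 1 / ((n : ℝ) + 1) ≤ 1 := by
      rw [div_le_one (by positivity)]; linarith [(Nat.cast_nonneg n : (0 : ℝ) ≤ n)]
    linarith
  obtain ⟨φ, hφ, m, hm⟩ := exists_subseq_cumMass hC₁ hF₀ hμ₁ hQ hQ1 B hg hB
  obtain ⟨C, hC, hCb⟩ := exists_cumMass_le hC₁ hF₀ hμ₁ hQ hQ1
  obtain ⟨hθ, hθ1⟩ := theta_bounds hμ₁ hμ₁'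
  set θ := 2 / (2 * μ₁ + 5)
  set b := fieldBound (C * (1 + B) ^ (1 - θ)) M (3 * θ) with hbdef
  have hb : IntegrableOn b (Ioi 0) := integrableOn_fieldBound _ _ (by linarith)
  have hgb (n : ℕ) : ∀ r > 0, cumMass (g n) r ^ 2 / r ^ 2 ≤ b r := by
    intro r hr
    have h0 := abs_of_nonneg ((hg n).cumMass_nonneg r)
    refine sq_div_sq_le_fieldBound hr (h0.trans_le ((hg n).cumMass_le r)) fun h1 =>
      h0.trans_le ((hCb M _ (hg n) r hr h1).trans ?_)
    have h2 := (hg n).J_nonneg hQ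
    have h3 := hB n
    gcongr
  have hlim := cumMass_limit_eq hC₁ hF₀ hμ₁ hμ₁' hμ₂ hμ₂' hμ₃ hQ hQ1 hQ2 hQ3 hQ4 hM hf₀ huniq
    (fun n => hg (φ n)) (hmin.comp hφ.tendsto_atTop) (fun n => hB (φ n)) hb (fun n => hgb (φ n)) hm
  obtain ⟨-, h0⟩ := tendsto_integral_sq_sub hb
    (fun n => (continuous_cumMass (hg (φ n)).integrable).measurable) (fun n => hgb (φ n))
    fun r _ => hm r
  obtain ⟨n, hn⟩ := (h0.eventually (gt_mem_nhds hε)).exists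
  have h1 := hgε (φ n)
  rw [interaction_self_eq] at h1
  simp_rw [cumMass_sub (hg (φ n)).integrable hf₀.1.integrable, ← hlim] at h1
  linarith

end VlasovPoisson

namespace VlasovPoisson

/-! ### First-order calculus along characteristics -/

theorem inner_gradient_eq_fderiv {g : E3 → ℝ} (x v : E3) :
    inner ℝ v (gradient g x) = fderiv ℝ g x v := by
  rw [real_inner_comm, gradient, InnerProductSpace.toDual_symm_apply]

theorem hasDerivAt_nonneg_of_max_left {φ : ℝ → ℝ} {d t a : ℝ} (hat : a < t)
    (hd : HasDerivAt φ d t) (hmax : ∀ s ∈ Icc a t, φ s ≤ φ t) : 0 ≤ d := by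
  have h := (hasDerivAt_iff_tendsto_slope.1 hd).mono_left
    (nhdsWithin_mono t (fun s (hs : s ∈ Iio t) => ne_of_lt hs))
  refine ge_of_tendsto h ?_
  filter_upwards [Ioo_mem_nhdsLT hat] with s hs
  rw [slope_def_field]
  exact div_nonneg_of_nonpos (sub_nonpos.2 (hmax s ⟨hs.1.le, hs.2.le⟩))
    (sub_nonpos.2 hs.2.le)

/-- A maximum principle: a function that is strictly decreasing in time at every spatial maximum
with a positive value stays nonpositive. -/
theorem nonpos_of_decreasing_at_max {w : ℝ → Phase → ℝ} {T : ℝ} {K : Set Phase}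
    (hK : IsCompact K) (hw : ContinuousOn (fun p : ℝ × Phase => w p.1 p.2) (Icc 0 T ×ˢ univ))
    (hout : ∀ t ∈ Icc 0 T, ∀ z ∉ K, w t z ≤ 0) (h0 : ∀ z, w 0 z ≤ 0)
    (hmax : ∀ t ∈ Ioc 0 T, ∀ z, 0 < w t z → (∀ z', w t z' ≤ w t z) →
      ∃ d < 0, HasDerivAt (fun s => w s z) d t) :
    ∀ t ∈ Icc 0 T, ∀ z, w t z ≤ 0 := by
  by_contra! hcon
  obtain ⟨t₀, ht₀, z₀, hz₀⟩ := hcon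
  have hz₀K : z₀ ∈ K := by
    by_contra h
    exact absurd (hout t₀ ht₀ z₀ h) (not_le.2 hz₀)
  obtain ⟨⟨t, z⟩, ⟨ht, hz⟩, hm⟩ := (isCompact_Icc.prod hK).exists_isMaxOn (f := fun p : ℝ × Phase =>
    w p.1 p.2) ⟨(t₀, z₀), ht₀, hz₀K⟩ (hw.mono (prod_mono_right (subset_univ _)))
  simp only at ht hz
  have hm' : ∀ y ∈ Icc 0 T ×ˢ K, w y.1 y.2 ≤ w t z := isMaxOn_iff.1 hm
  have hpos : 0 < w t z := hz₀.trans_le (hm' (t₀, z₀) ⟨ht₀, hz₀K⟩)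
  have hglob : ∀ s ∈ Icc 0 T, ∀ z', w s z' ≤ w t z := fun s hs z' => by
    by_cases hz' : z' ∈ K
    · exact hm' (s, z') ⟨hs, hz'⟩
    · exact (hout s hs z' hz').trans hpos.le
  have ht0 : 0 < t := by
    refine lt_of_le_of_ne ht.1 fun h => ?_
    rw [← h] at hpos
    exact absurd (h0 z) (not_le.2 hpos)
  obtain ⟨d, hd, hder⟩ := hmax t ⟨ht0, ht.2⟩ z hpos (hglob t ht)
  exact absurd (hasDerivAt_nonneg_of_max_left ht0 hder fun s hs =>
    hglob s ⟨hs.1, hs.2.trans ht.2⟩ z) (not_le.2 hd)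

/-- At a spatial maximum the time derivative can be computed along any direction `(1, X)`. -/
theorem hasDerivAt_time_of_spatial_max {G : ℝ × Phase → ℝ} {t c : ℝ} {z X : Phase}
    (hG : DifferentiableAt ℝ G (t, z)) (hmax : ∀ z', G (t, z') ≤ G (t, z))
    (hline : HasDerivAt (fun s : ℝ => G ((t, z) + s • ((1 : ℝ), X))) c 0) :
    HasDerivAt (fun s => G (s, z)) c t := by
  set L := fderiv ℝ G (t, z) with hL
  have hGd : HasFDerivAt G L (t, z) := hG.hasFDerivAt
  have h1 : HasFDerivAt (fun z' => G (t, z')) (L.comp (ContinuousLinearMap.inr ℝ ℝ Phase)) z :=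
    hGd.comp z (hasFDerivAt_prodMk_right t z)
  have h2 : L.comp (ContinuousLinearMap.inr ℝ ℝ Phase) = 0 :=
    (IsLocalMax.hasFDerivAt_eq_zero (Eventually.of_forall hmax) h1)
  have h3 : HasDerivAt (fun s : ℝ => G ((t, z) + s • ((1 : ℝ), X))) (L (1, X)) 0 := by
    have hl : HasDerivAt (fun s : ℝ => (t, z) + s • ((1 : ℝ), X)) ((1 : ℝ), X) 0 := by
      simpa using ((hasDerivAt_id (0 : ℝ)).smul_const ((1 : ℝ), X)).const_add (t, z)
    have hGd' : HasFDerivAt G L ((t, z) + (0 : ℝ) • ((1 : ℝ), X)) := by simpa using hGd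
    exact hGd'.comp_hasDerivAt 0 hl
  have h4 : c = L (1, 0) := by
    rw [hline.unique h3]
    have h5 : ((1 : ℝ), X) = (1, 0) + (0, X) := by simp
    have h6 : L (0, X) = 0 := by simpa using DFunLike.congr_fun h2 X
    rw [h5, map_add, h6, add_zero]
  rw [h4]
  have h7 : HasDerivAt (fun s : ℝ => ((s, z) : ℝ × Phase)) ((1 : ℝ), (0 : Phase)) t :=
    (hasDerivAt_id t).prodMk (hasDerivAt_const t z)
  exact hGd.comp_hasDerivAt t h7

theorem mem_nhds_Ici_prod {t : ℝ} (ht : 0 < t) (z : Phase) :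
    (Ici (0 : ℝ) ×ˢ (univ : Set Phase)) ∈ 𝓝 (t, z) :=
  prod_mem_nhds (Ici_mem_nhds ht) univ_mem

theorem hasDerivAt_line {G : ℝ × Phase → ℝ} {t : ℝ} {z X : Phase}
    (hG : DifferentiableAt ℝ G (t, z)) :
    HasDerivAt (fun s : ℝ => G ((t, z) + s • ((1 : ℝ), X))) (fderiv ℝ G (t, z) (1, X)) 0 := by
  have hl : HasDerivAt (fun s : ℝ => (t, z) + s • ((1 : ℝ), X)) ((1 : ℝ), X) 0 := by
    simpa using ((hasDerivAt_id (0 : ℝ)).smul_const ((1 : ℝ), X)).const_add (t, z)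
  have hGd' : HasFDerivAt G (fderiv ℝ G (t, z)) ((t, z) + (0 : ℝ) • ((1 : ℝ), X)) := by
    simpa using hG.hasFDerivAt
  exact hGd'.comp_hasDerivAt 0 hl

theorem fderiv_slice {G : ℝ × Phase → ℝ} {t : ℝ} {z : Phase}
    (hG : DifferentiableAt ℝ G (t, z)) (w : Phase) :
    fderiv ℝ (fun z' => G (t, z')) z w = fderiv ℝ G (t, z) (0, w) := by
  have h1 : HasFDerivAt (fun z' => G (t, z'))
      ((fderiv ℝ G (t, z)).comp (ContinuousLinearMap.inr ℝ ℝ Phase)) z :=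
    hG.hasFDerivAt.comp z (hasFDerivAt_prodMk_right t z)
  rw [h1.fderiv]; simp

theorem hasDerivAt_time {G : ℝ × Phase → ℝ} {t : ℝ} {z : Phase}
    (hG : DifferentiableAt ℝ G (t, z)) :
    HasDerivAt (fun s => G (s, z)) (fderiv ℝ G (t, z) (1, 0)) t := by
  have h7 : HasDerivAt (fun s : ℝ => ((s, z) : ℝ × Phase)) ((1 : ℝ), (0 : Phase)) t :=
    (hasDerivAt_id t).prodMk (hasDerivAt_const t z)
  exact hG.hasFDerivAt.comp_hasDerivAt t h7

namespace IsClassicalSolution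

variable {f : ℝ → Phase → ℝ}

theorem differentiableAt (hf : IsClassicalSolution f) {t : ℝ} (ht : 0 < t) (z : Phase) :
    DifferentiableAt ℝ (fun p : ℝ × Phase => f p.1 p.2) (t, z) :=
  (hf.contDiffOn.contDiffAt (mem_nhds_Ici_prod ht z)).differentiableAt one_ne_zero

theorem contDiff_slice (hf : IsClassicalSolution f) {t : ℝ} (ht : 0 ≤ t) : ContDiff ℝ 1 (f t) := by
  have h : ContDiff ℝ 1 fun z : Phase => ((t, z) : ℝ × Phase) := by fun_prop
  rw [← contDiffOn_univ] at h ⊢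
  exact hf.contDiffOn.comp h fun z _ => ⟨ht, mem_univ _⟩

theorem differentiable_potential (hf : IsClassicalSolution f) {t : ℝ} (ht : 0 ≤ t) :
    Differentiable ℝ (potential (f t)) :=
  (hf.contDiff_potential t ht).differentiable two_ne_zero

theorem continuous_gradPot (hf : IsClassicalSolution f) {t : ℝ} (ht : 0 ≤ t) :
    Continuous (gradPot (f t)) := by
  have h := (hf.contDiff_potential t ht).continuous_fderiv two_ne_zero
  exact (InnerProductSpace.toDual ℝ E3).symm.continuous.comp h

/-- The Vlasov equation: `f` is constant to first order along characteristics. -/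
theorem transport (hf : IsClassicalSolution f) {t : ℝ} (ht : 0 < t) (z : Phase) :
    fderiv ℝ (fun p : ℝ × Phase => f p.1 p.2) (t, z) (1, (z.2, -gradPot (f t) z.1)) = 0 := by
  have hd := hf.differentiableAt ht z
  obtain ⟨x, v⟩ := z
  have h := hf.vlasov t ht x v
  rw [(hasDerivAt_time hd).deriv, inner_gradient_eq_fderiv, inner_gradient_eq_fderiv] at h
  have hs : HasFDerivAt (f t) (fderiv ℝ (f t) (x, v)) (x, v) :=
    ((hf.contDiff_slice ht.le).differentiable one_ne_zero _).hasFDerivAt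
  have h1 : HasFDerivAt (fun y => f t (y, v))
      ((fderiv ℝ (f t) (x, v)).comp (ContinuousLinearMap.inl ℝ E3 E3)) x :=
    hs.comp x (hasFDerivAt_prodMk_left x v)
  have h2 : HasFDerivAt (fun w => f t (x, w))
      ((fderiv ℝ (f t) (x, v)).comp (ContinuousLinearMap.inr ℝ E3 E3)) v :=
    hs.comp v (hasFDerivAt_prodMk_right x v)
  rw [h1.fderiv, h2.fderiv] at h
  simp only [ContinuousLinearMap.comp_apply, ContinuousLinearMap.inl_apply,
    ContinuousLinearMap.inr_apply] at h
  have e : ((1 : ℝ), ((v, -gradPot (f t) x) : Phase)) =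
      (1, 0) + (0, (v, 0)) - (0, (0, gradPot (f t) x)) := by simp
  rw [e, map_sub, map_add]
  rw [← fderiv_slice hd, ← fderiv_slice hd]
  exact h

/-- Finite speed of propagation. -/
theorem eq_zero_of_cone (hf : IsClassicalSolution f) {t₀ C W : ℝ} (ht₀ : 0 < t₀) (hC : 0 ≤ C)
    (hfield : ∀ t, 0 ≤ t → t ≤ t₀ → ∀ x, ‖gradPot (f t) x‖ ≤ C) {z₀ : Phase}
    (hW : ‖z₀.2‖ + 1 + C * t₀ ≤ W)
    (h0 : ∀ z : Phase, ‖z.1 - z₀.1‖ < 1 + W * t₀ → ‖z.2 - z₀.2‖ < 1 + C * t₀ → f 0 z = 0) :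
    f t₀ z₀ = 0 := by
  have hW0 : 0 ≤ W := by have := norm_nonneg z₀.2; nlinarith
  -- `p` and `q` are positive on the backward cone with vertex region at `(t₀, z₀)`, where both
  -- equal `1`. Inside the cone they do not increase along characteristics, since forces are at most
  -- `C` and speeds at most `W`.
  set p : ℝ × Phase → ℝ := fun y => (1 + C * (t₀ - y.1)) ^ 2 - ‖y.2.2 - z₀.2‖ ^ 2 with hp
  set q : ℝ × Phase → ℝ := fun y => (1 + W * (t₀ - y.1)) ^ 2 - ‖y.2.1 - z₀.1‖ ^ 2 with hq
  have hpd : ContDiff ℝ 1 p := by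
    have : ContDiff ℝ 1 fun y : ℝ × Phase => ‖y.2.2 - z₀.2‖ ^ 2 :=
      ContDiff.norm_sq ℝ (by fun_prop)
    exact (by fun_prop : ContDiff ℝ 1 fun y : ℝ × Phase => (1 + C * (t₀ - y.1)) ^ 2).sub this
  have hqd : ContDiff ℝ 1 q := by
    have : ContDiff ℝ 1 fun y : ℝ × Phase => ‖y.2.1 - z₀.1‖ ^ 2 :=
      ContDiff.norm_sq ℝ (by fun_prop)
    exact (by fun_prop : ContDiff ℝ 1 fun y : ℝ × Phase => (1 + W * (t₀ - y.1)) ^ 2).sub this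
  have hpc := hpd.continuous
  have hqc := hqd.continuous
  suffices h : ∀ η : ℝ, 0 < η → f t₀ z₀ ≤ η * t₀ by
    refine le_antisymm (le_of_forall_pos_le_add fun η hη => ?_) (hf.nonneg _ ht₀.le _)
    have := h (η / t₀) (by positivity)
    rwa [div_mul_cancel₀ _ ht₀.ne', ← zero_add η] at this
  intro η hη
  -- The penalty `η t` makes the decrease at a positive maximum strict; at `(t₀, z₀)` the conclusion
  -- `w ≤ 0` reads `f ≤ η t₀`.
  set w : ℝ → Phase → ℝ := fun t z =>
    f t z * (max (p (t, z)) 0 * max (q (t, z)) 0) - η * t with hw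
  have hψ (y : ℝ × Phase) : 0 ≤ max (p y) 0 * max (q y) 0 :=
    mul_nonneg (le_max_right _ _) (le_max_right _ _)
  set K : Set Phase := Metric.closedBall z₀.1 (1 + W * t₀) ×ˢ Metric.closedBall z₀.2 (1 + C * t₀)
  have hK : IsCompact K := (isCompact_closedBall _ _).prod (isCompact_closedBall _ _)
  have habs {a b : ℝ} (ha : 0 ≤ a) (hb : 0 ≤ b) (h : ¬ a ^ 2 - b ^ 2 ≤ 0) : b < a := by
    by_contra! hcon
    exact h (sub_nonpos.2 (by gcongr))
  have main := nonpos_of_decreasing_at_max (w := w) (T := t₀) hK ?_ ?_ ?_ ?_ t₀ ⟨ht₀.le, le_rfl⟩ z₀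
  · simpa [hw, hp, hq] using main
  · refine ContinuousOn.sub (ContinuousOn.mul ?_ ?_) (by fun_prop)
    · exact hf.contDiffOn.continuousOn.mono (prod_mono_left Icc_subset_Ici_self)
    · exact (by fun_prop : Continuous fun y : ℝ × Phase =>
        max (p y) 0 * max (q y) 0).continuousOn
  · intro t ht z hz
    have h1 : max (p (t, z)) 0 * max (q (t, z)) 0 = 0 := by
      by_contra hne
      have hp0 : ¬ p (t, z) ≤ 0 := fun h => hne (by rw [max_eq_right h, zero_mul])
      have hq0 : ¬ q (t, z) ≤ 0 := fun h => hne (by rw [max_eq_right h, mul_zero])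
      have ht' : 0 ≤ t₀ - t := sub_nonneg.2 ht.2
      have e1 := habs (by positivity) (norm_nonneg _) hp0
      have e2 := habs (by positivity) (norm_nonneg _) hq0
      refine hz ⟨mem_closedBall_iff_norm.2 ?_, mem_closedBall_iff_norm.2 ?_⟩
      · simp only at e2; nlinarith [ht.1]
      · simp only at e1; nlinarith [ht.1]
    simp only [hw, h1, mul_zero, zero_sub]
    have := ht.1
    rw [neg_nonpos]; positivity
  · intro z
    have h1 : f 0 z * (max (p (0, z)) 0 * max (q (0, z)) 0) = 0 := by
      by_cases hp0 : p (0, z) ≤ 0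
      · rw [max_eq_right hp0]; ring
      by_cases hq0 : q (0, z) ≤ 0
      · rw [max_eq_right hq0]; ring
      have e1 := habs (by simp only [sub_zero]; positivity) (norm_nonneg _) hp0
      have e2 := habs (by simp only [sub_zero]; positivity) (norm_nonneg _) hq0
      simp only [sub_zero] at e1 e2
      rw [h0 z e2 e1, zero_mul]
    simp only [hw, h1]; simp
  · intro t ht z hpos hmax
    have hfn := hf.nonneg t ht.1.le z
    have hprod : 0 < f t z * (max (p (t, z)) 0 * max (q (t, z)) 0) := by
      have : 0 ≤ η * t := by have := ht.1; positivity
      simp only [hw] at hpos; linarith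
    have hp0 : ¬ p (t, z) ≤ 0 := fun h => by rw [max_eq_right h] at hprod; simp at hprod
    have hq0 : ¬ q (t, z) ≤ 0 := fun h => by rw [max_eq_right h] at hprod; simp at hprod
    have ht' : 0 ≤ t₀ - t := sub_nonneg.2 ht.2
    have e1 := habs (by positivity) (norm_nonneg _) hp0
    have e2 := habs (by positivity) (norm_nonneg _) hq0
    simp only at e1 e2
    push Not at hp0 hq0
    set G : ℝ × Phase → ℝ := fun y => f y.1 y.2 * (max (p y) 0 * max (q y) 0) with hG
    set G' : ℝ × Phase → ℝ := fun y => f y.1 y.2 * (p y * q y) with hG'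
    have hGG : G =ᶠ[𝓝 (t, z)] G' := by
      filter_upwards [hpc.continuousAt.eventually (lt_mem_nhds hp0),
        hqc.continuousAt.eventually (lt_mem_nhds hq0)] with y h1 h2
      simp only [hG, hG', max_eq_left h1.le, max_eq_left h2.le]
    set F := gradPot (f t) z.1
    have hF : ‖F‖ ≤ C := hfield t ht.1.le ht.2 z.1
    have hline0 := hasDerivAt_line (X := (z.2, -F)) (hf.differentiableAt ht.1 z)
    rw [hf.transport ht.1 z] at hline0
    have hpl : HasDerivAt (fun s : ℝ => p ((t, z) + s • ((1 : ℝ), ((z.2, -F) : Phase))))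
        (2 * (1 + C * (t₀ - t)) * (-C) - 2 * inner ℝ (z.2 - z₀.2) (-F)) 0 := by
      have k1 : HasDerivAt (fun s : ℝ => (1 + C * (t₀ - (t + s * 1))) ^ 2)
          (2 * (1 + C * (t₀ - t)) * (-C)) 0 := by
        have := (((((hasDerivAt_id (0 : ℝ)).mul_const 1).const_add t).const_sub
          t₀).const_mul C).const_add 1 |>.pow 2
        refine this.congr_deriv ?_
        simp
      have k2 : HasDerivAt (fun s : ℝ => z.2 + s • (-F) - z₀.2) (-F) 0 := by
        simpa using (((hasDerivAt_id (0 : ℝ)).smul_const (-F)).const_add z.2).sub_const z₀.2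
      have k3 := k2.norm_sq
      simp only [zero_smul, add_zero] at k3
      exact k1.sub k3
    have hql : HasDerivAt (fun s : ℝ => q ((t, z) + s • ((1 : ℝ), ((z.2, -F) : Phase))))
        (2 * (1 + W * (t₀ - t)) * (-W) - 2 * inner ℝ (z.1 - z₀.1) z.2) 0 := by
      have k1 : HasDerivAt (fun s : ℝ => (1 + W * (t₀ - (t + s * 1))) ^ 2)
          (2 * (1 + W * (t₀ - t)) * (-W)) 0 := by
        have := (((((hasDerivAt_id (0 : ℝ)).mul_const 1).const_add t).const_sub
          t₀).const_mul W).const_add 1 |>.pow 2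
        refine this.congr_deriv ?_
        simp
      have k2 : HasDerivAt (fun s : ℝ => z.1 + s • z.2 - z₀.1) z.2 0 := by
        simpa using (((hasDerivAt_id (0 : ℝ)).smul_const z.2).const_add z.1).sub_const z₀.1
      have k3 := k2.norm_sq
      simp only [zero_smul, add_zero] at k3
      exact k1.sub k3
    have hline := hline0.mul (hpl.mul hql)
    simp only [zero_smul, add_zero, zero_mul, zero_add] at hline
    have hGd : DifferentiableAt ℝ G (t, z) := by
      refine DifferentiableAt.congr_of_eventuallyEq ?_ hGG
      exact (hf.differentiableAt ht.1 z).mul ((hpd.differentiable one_ne_zero _).mul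
        (hqd.differentiable one_ne_zero _))
    have hcont : ContinuousAt (fun s : ℝ => (t, z) + s • ((1 : ℝ), ((z.2, -F) : Phase))) 0 := by
      fun_prop
    have hGG' : ∀ᶠ y in 𝓝 ((t, z) + (0 : ℝ) • ((1 : ℝ), ((z.2, -F) : Phase))), G y = G' y := by
      rw [zero_smul, add_zero]; exact hGG
    have hGline := HasDerivAt.congr_of_eventuallyEq hline (hcont.eventually hGG')
    have hder := hasDerivAt_time_of_spatial_max hGd (fun z' => by
      have := hmax z'
      simp only [hw] at this
      simp only [hG]; linarith) hGline
    refine ⟨_, ?_, hder.sub ((hasDerivAt_id t).const_mul η)⟩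
    have d1 : 2 * (1 + C * (t₀ - t)) * (-C) - 2 * inner ℝ (z.2 - z₀.2) (-F) ≤ 0 := by
      rw [inner_neg_right]
      have k1 := real_inner_le_norm (z.2 - z₀.2) F
      have k2 : ‖z.2 - z₀.2‖ * ‖F‖ ≤ (1 + C * (t₀ - t)) * C := by gcongr
      linarith
    have d2 : 2 * (1 + W * (t₀ - t)) * (-W) - 2 * inner ℝ (z.1 - z₀.1) z.2 ≤ 0 := by
      have k1 := (abs_le.1 (abs_real_inner_le_norm (z.1 - z₀.1) z.2)).1
      have k0 : ‖z.2‖ ≤ W := by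
        have l1 : ‖z.2‖ ≤ ‖z.2 - z₀.2‖ + ‖z₀.2‖ := by
          simpa using norm_add_le (z.2 - z₀.2) z₀.2
        have l2 : C * (t₀ - t) ≤ C * t₀ := by have := ht.1.le; gcongr; linarith
        linarith
      have k2 : ‖z.1 - z₀.1‖ * ‖z.2‖ ≤ (1 + W * (t₀ - t)) * W := by gcongr
      linarith
    have d3 := mul_nonpos_of_nonpos_of_nonneg d1 hq0.le
    have d4 := mul_nonpos_of_nonneg_of_nonpos hp0.le d2
    have d5 := mul_nonpos_of_nonneg_of_nonpos hfn (add_nonpos d3 d4)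
    simp only [mul_one]
    linarith

/-- Velocities are bounded first: there the spatial speed `W` of the cone may depend on the point,
because only the velocity leaves the initial support. Once velocities are bounded, one `W` works for
all points and bounds the positions. -/
theorem exists_support_radius (hf : IsClassicalSolution f) (hc : HasCompactSupport (f 0)) (T : ℝ) :
    ∃ R, 0 < R ∧ ∀ t ∈ Icc 0 T, ∀ z : Phase, R < ‖z.1‖ ∨ R < ‖z.2‖ → f t z = 0 := by
  obtain ⟨R₀, hR₀⟩ := hc.isCompact.isBounded.subset_closedBall 0
  have hR (z : Phase) (hz : R₀ < ‖z.1‖ ∨ R₀ < ‖z.2‖) : f 0 z = 0 := by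
    by_contra h
    have h1 := hR₀ (subset_tsupport _ h)
    rw [mem_closedBall_zero_iff, Prod.norm_def, max_le_iff] at h1
    rcases hz with hz | hz
    · exact absurd h1.1 (not_le.2 hz)
    · exact absurd h1.2 (not_le.2 hz)
  obtain ⟨C₀, hC₀⟩ := hf.bounded_field T
  set C := max C₀ 0 with hC
  have hC0 : 0 ≤ C := le_max_right _ _
  set T' := max T 0
  have hT' : 0 ≤ T' := le_max_right _ _
  set R₁ := max R₀ 0
  have hR₁ : 0 ≤ R₁ := le_max_right _ _
  set W := R₁ + 2 * (C * T') + 2 with hWdef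
  refine ⟨R₁ + C * T' + 1 + (W * T'), by positivity, fun t ht z hz => ?_⟩
  have htT' : t ≤ T' := ht.2.trans (le_max_left _ _)
  rcases eq_or_lt_of_le ht.1 with rfl | ht0
  · refine hR z (hz.imp ?_ ?_) <;>
    · intro h
      have : 0 ≤ C * T' := by positivity
      have : 0 ≤ W * T' := by positivity
      linarith [le_max_left R₀ 0]
  have hCt : C * t ≤ C * T' := by gcongr
  have hWt : W * t ≤ W * T' := by gcongr
  have hWT : 0 ≤ W * T' := by positivity
  have hfield : ∀ s, 0 ≤ s → s ≤ t → ∀ x, ‖gradPot (f s) x‖ ≤ C := fun s hs hst x =>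
    (hC₀ s hs (hst.trans ht.2) x).trans (le_max_left _ _)
  rcases lt_or_ge (R₁ + C * T' + 1) ‖z.2‖ with hv | hv
  · refine hf.eq_zero_of_cone ht0 hC0 hfield (W := ‖z.2‖ + 1 + C * t) le_rfl fun y _ hy2 => ?_
    refine hR y (Or.inr ?_)
    have : ‖z.2‖ ≤ ‖y.2‖ + ‖y.2 - z.2‖ := by
      have := norm_sub_le y.2 (y.2 - z.2); simpa using this
    linarith [le_max_left R₀ 0]
  · have hx : R₁ + C * T' + 1 + W * T' < ‖z.1‖ := by
      rcases hz with h | h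
      · exact h
      · linarith
    refine hf.eq_zero_of_cone ht0 hC0 hfield (W := W) (by linarith) fun y hy1 _ => ?_
    refine hR y (Or.inl ?_)
    have : ‖z.1‖ ≤ ‖y.1‖ + ‖y.1 - z.1‖ := by
      have := norm_sub_le y.1 (y.1 - z.1); simpa using this
    have : 0 ≤ C * T' := by positivity
    linarith [le_max_left R₀ 0]

end IsClassicalSolution

end VlasovPoisson

namespace VlasovPoisson

/-! ### Lipschitz bound for Newtonian potentials -/

/-- The convention `1 / 0 = 0` is harmless: if `a = 0` then `b ≤ d`, hence `1/b ≤ d/b²`. -/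
theorem abs_one_div_sub_le {a b d : ℝ} (ha : 0 ≤ a) (hb : 0 ≤ b) (hd : |a - b| ≤ d) :
    |1 / a - 1 / b| ≤ d * (1 / a ^ 2 + 1 / b ^ 2) := by
  rcases eq_or_lt_of_le ha with rfl | ha'
  · rcases eq_or_lt_of_le hb with rfl | hb'
    · simp
    · simp only [zero_sub, abs_neg, abs_of_pos hb', div_zero, ne_eq, OfNat.ofNat_ne_zero,
        not_false_eq_true, zero_pow, zero_add] at hd ⊢
      rw [abs_of_pos (by positivity), mul_one_div, div_le_div_iff₀ hb' (by positivity)]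
      nlinarith
  rcases eq_or_lt_of_le hb with rfl | hb'
  · simp only [sub_zero, abs_of_pos ha', div_zero, ne_eq, OfNat.ofNat_ne_zero,
        not_false_eq_true, zero_pow, add_zero] at hd ⊢
    rw [abs_of_pos (by positivity), mul_one_div, div_le_div_iff₀ ha' (by positivity)]
    nlinarith
  have hd0 : 0 ≤ d := (abs_nonneg _).trans hd
  have e : 1 / a - 1 / b = -(a - b) * (1 / a * (1 / b)) := by field_simp; ring
  rw [e, abs_mul, abs_neg, abs_of_pos (a := 1 / a * (1 / b)) (by positivity)]
  have h1 : 1 / a * (1 / b) ≤ 1 / a ^ 2 + 1 / b ^ 2 := by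
    rw [← one_div_pow, ← one_div_pow]
    nlinarith [sq_nonneg (1 / a - 1 / b), sq_nonneg (1 / a), sq_nonneg (1 / b)]
  gcongr

theorem integrableOn_ball_inv_norm_sq :
    IntegrableOn (fun u : E3 => 1 / ‖u‖ ^ 2) (Metric.ball 0 1) := by
  rw [← integrable_indicator_iff measurableSet_ball]
  have h : (Metric.ball (0 : E3) 1).indicator (fun u => 1 / ‖u‖ ^ 2) =
      fun u => (Iio (1 : ℝ)).indicator (fun r => 1 / r ^ 2) ‖u‖ := by
    ext u
    simp only [indicator, mem_ball_zero_iff, mem_Iio]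
  rw [h, integrable_fun_norm_addHaar volume (f := (Iio (1 : ℝ)).indicator fun r => 1 / r ^ 2)]
  have h2 : IntegrableOn ((Iio (1 : ℝ)).indicator fun _ => (1 : ℝ)) (Ioi 0) := by
    rw [IntegrableOn, integrable_indicator_iff measurableSet_Iio, IntegrableOn,
      Measure.restrict_restrict measurableSet_Iio, Iio_inter_Ioi]
    exact integrableOn_const (by simp)
  refine h2.congr_fun (fun r (hr : 0 < r) => ?_) measurableSet_Ioi
  simp only [indicator, mem_Iio, finrank_euclideanSpace, Fintype.card_fin, smul_eq_mul]
  split_ifs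
  · field_simp
  · simp

/-- Newtonian potentials of bounded densities on a ball are Lipschitz, uniformly. -/
theorem exists_lipschitz_newton (R : ℝ) : ∃ κ : ℝ, 0 ≤ κ ∧ ∀ (σ : E3 → ℝ) (c : ℝ),
    0 ≤ c → (∀ y, |σ y| ≤ c) → (∀ y, R < ‖y‖ → σ y = 0) →
    (∀ x, Integrable fun y => σ y / ‖x - y‖) → ∀ x x' : E3,
    |(∫ y, σ y / ‖x - y‖) - ∫ y, σ y / ‖x' - y‖| ≤ κ * c * ‖x - x'‖ := by
  -- On the support of `σ`, each kernel `1/‖x - y‖²` is at most `k (x - y) + 1`, with `k` integrable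
  -- in dimension three. The two centres `x`, `x'` account for the factors `2` in `κ`.
  set k : E3 → ℝ := (Metric.ball (0 : E3) 1).indicator fun u => 1 / ‖u‖ ^ 2 with hk
  have hki : Integrable k := integrableOn_ball_inv_norm_sq.integrable_indicator measurableSet_ball
  set b : E3 → ℝ := (Metric.closedBall (0 : E3) R).indicator fun _ => 1 with hb
  have hbi : Integrable b := by
    rw [hb, integrable_indicator_iff measurableSet_closedBall]
    exact integrableOn_const measure_closedBall_lt_top.ne
  have hk0 (u : E3) : 0 ≤ k u := indicator_nonneg (fun u _ => by positivity) u
  have hb0 (u : E3) : 0 ≤ b u := indicator_nonneg (fun u _ => zero_le_one) u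
  have hkle (u : E3) : 1 / ‖u‖ ^ 2 ≤ k u + 1 := by
    by_cases hu : u ∈ Metric.ball (0 : E3) 1
    · simp [hk, indicator_of_mem hu]
    · rw [hk, indicator_of_notMem hu, zero_add]
      have : 1 ≤ ‖u‖ := by simpa using hu
      rw [div_le_one (by positivity)]
      exact one_le_pow₀ this
  refine ⟨2 * (∫ u, k u) + 2 * ∫ u, b u,
    add_nonneg (by have : 0 ≤ ∫ u, k u := integral_nonneg fun u => hk0 u
                   positivity)
      (by have : 0 ≤ ∫ u, b u := integral_nonneg fun u => hb0 u
          positivity), fun σ c hc hσ hσR hσi x x' => ?_⟩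
  have hint (x : E3) : Integrable fun y => k (x - y) := hki.comp_sub_left x
  rw [← integral_sub (hσi x) (hσi x')]
  have hbound : Integrable fun y => c * ‖x - x'‖ * (k (x - y) + k (x' - y) + 2 * b y) :=
    (((hint x).add (hint x')).add (hbi.const_mul 2)).const_mul _
  have h1 := norm_integral_le_of_norm_le (f := fun y => σ y / ‖x - y‖ - σ y / ‖x' - y‖) hbound
    (Eventually.of_forall fun y => ?_)
  · rw [Real.norm_eq_abs] at h1
    refine h1.trans (le_of_eq ?_)
    have hadd : Integrable fun y => k (x - y) + k (x' - y) := (hint x).add (hint x')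
    rw [integral_const_mul, integral_add hadd (hbi.const_mul 2),
      integral_add (hint x) (hint x'), integral_sub_left_eq_self k volume x,
      integral_sub_left_eq_self k volume x', integral_const_mul]
    ring
  · have hkk := add_nonneg (hk0 (x - y)) (hk0 (x' - y))
    by_cases hy : y ∈ Metric.closedBall (0 : E3) R
    · have hby : b y = 1 := indicator_of_mem hy _
      have e : σ y / ‖x - y‖ - σ y / ‖x' - y‖ = σ y * (1 / ‖x - y‖ - 1 / ‖x' - y‖) := by ring
      have hd : |‖x - y‖ - ‖x' - y‖| ≤ ‖x - x'‖ := by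
        have := abs_norm_sub_norm_le (x - y) (x' - y); simpa using this
      have h2 := abs_one_div_sub_le (norm_nonneg _) (norm_nonneg _) hd
      rw [Real.norm_eq_abs, e, abs_mul, hby, mul_assoc]
      refine mul_le_mul (hσ y) (h2.trans ?_) (abs_nonneg _) hc
      refine mul_le_mul_of_nonneg_left ?_ (norm_nonneg _)
      linarith [hkle (x - y), hkle (x' - y)]
    · have hy' : R < ‖y‖ := by simpa using hy
      rw [hσR y hy']
      simp only [zero_div, sub_self, norm_zero]
      have := hb0 y
      positivity

/-- The field is almost equivariant under a rotation if the density is almost invariant. -/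
theorem exists_field_rotate_le (R : ℝ) : ∃ C : ℝ, 0 ≤ C ∧
    ∀ (g : Phase → ℝ) (A : E3 ≃ₗᵢ[ℝ] E3) (c : ℝ), Differentiable ℝ (potential g) →
      (∀ z : Phase, R < ‖z.1‖ ∨ R < ‖z.2‖ → g z = 0) →
      (∀ x : E3, Integrable fun v => g (x, v)) →
      (∀ x : E3, Integrable fun y => density g y / ‖x - y‖) →
      0 ≤ c → (∀ z : Phase, |g z - g (A z.1, A z.2)| ≤ c) →
      ∀ x, ‖gradPot g (A x) - A (gradPot g x)‖ ≤ C * c := by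
  obtain ⟨κ, hκ0, hκ⟩ := exists_lipschitz_newton R
  set vol := volume.real (Metric.closedBall (0 : E3) R)
  refine ⟨κ * vol, mul_nonneg hκ0 measureReal_nonneg,
    fun g A c hU hR hgi hρi hc hgc x => ?_⟩
  have hAm : MeasurePreserving A := A.measurePreserving
  have hAe : MeasurableEmbedding A := A.toHomeomorph.measurableEmbedding
  -- `U ∘ A - U` is, up to sign, the potential of the small density `σ`, so its Lipschitz constant
  -- bounds the difference of the fields.
  set σ : E3 → ℝ := fun y => density g y - density g (A y) with hσ
  have hρA (y : E3) : density g (A y) = ∫ v, g (A y, A v) :=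
    (hAm.integral_comp hAe fun v => g (A y, v)).symm
  have hgAi (y : E3) : Integrable fun v => g (A y, A v) :=
    (hAm.integrable_comp_emb (g := fun v => g (A y, v)) hAe).2 (hgi (A y))
  have hσc (y : E3) : |σ y| ≤ c * vol := by
    have e : σ y = ∫ v in Metric.closedBall (0 : E3) R, (g (y, v) - g (A y, A v)) := by
      have h1 : ∀ v, v ∉ Metric.closedBall (0 : E3) R → g (y, v) - g (A y, A v) = 0 := by
        intro v hv
        have hv' : R < ‖v‖ := by simpa using hv
        have hv'' : R < ‖A v‖ := by rwa [A.norm_map]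
        rw [hR (y, v) (Or.inr hv'), hR (A y, A v) (Or.inr hv''), sub_zero]
      rw [setIntegral_eq_integral_of_forall_compl_eq_zero h1, integral_sub (hgi y) (hgAi y)]
      change density g y - density g (A y) = _
      rw [hρA, density]
    rw [e, ← Real.norm_eq_abs]
    exact norm_setIntegral_le_of_norm_le_const measure_closedBall_lt_top fun v _ => hgc (y, v)
  have hσR (y : E3) (hy : R < ‖y‖) : σ y = 0 := by
    have h1 : density g y = 0 := by
      simp only [density]
      rw [integral_congr_ae (Eventually.of_forall fun v => hR (y, v) (Or.inl hy)), integral_zero]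
    have h2 : density g (A y) = 0 := by
      simp only [density]
      rw [integral_congr_ae (Eventually.of_forall fun v => hR (A y, v) (Or.inl (by simpa using hy))),
        integral_zero]
    simp only [hσ, h1, h2, sub_zero]
  have hρAi (x : E3) : Integrable fun y => density g (A y) / ‖x - y‖ := by
    have h := (hAm.integrable_comp_emb hAe).2 (hρi (A x))
    refine h.congr (Eventually.of_forall fun y => ?_)
    simp only [Function.comp, ← map_sub, A.norm_map]
  have hσi (x : E3) : Integrable fun y => σ y / ‖x - y‖ :=
    ((hρi x).sub (hρAi x)).congr (Eventually.of_forall fun y => by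
      simp only [Pi.sub_apply, hσ]; ring)
  have hV (x : E3) : potential g (A x) - potential g x = ∫ y, σ y / ‖x - y‖ := by
    have e1 : potential g (A x) = -∫ y, density g (A y) / ‖x - y‖ := by
      rw [potential, ← hAm.integral_comp hAe]
      simp only [← map_sub, A.norm_map]
    rw [e1, potential, ← sub_eq_zero]
    have : ∫ y, σ y / ‖x - y‖ = (∫ y, density g y / ‖x - y‖) - ∫ y, density g (A y) / ‖x - y‖ := by
      rw [← integral_sub (hρi x) (hρAi x)]
      congr 1; ext y; simp only [hσ]; ring
    rw [this]; ring
  have hVd : HasFDerivAt (fun x => potential g (A x) - potential g x)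
      ((fderiv ℝ (potential g) (A x)).comp (A : E3 →L[ℝ] E3) - fderiv ℝ (potential g) x) x :=
    ((hU (A x)).hasFDerivAt.comp x (A : E3 →L[ℝ] E3).hasFDerivAt).sub (hU x).hasFDerivAt
  have hlip := hVd.le_of_lip' (C := κ * (c * vol)) (by
      have : 0 ≤ vol := measureReal_nonneg
      positivity) (Eventually.of_forall fun y => by
    rw [hV, hV, Real.norm_eq_abs]
    exact hκ σ (c * vol) (mul_nonneg hc measureReal_nonneg) hσc hσR hσi y x)
  set D := gradPot g (A x) - A (gradPot g x) with hD
  have h1 := (ContinuousLinearMap.le_of_opNorm_le _ hlip (A.symm D))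
  -- Testing the derivative on `A⁻¹ D` produces `‖D‖²`.
  have h2 : ((fderiv ℝ (potential g) (A x)).comp (A : E3 →L[ℝ] E3) -
      fderiv ℝ (potential g) x) (A.symm D) = ‖D‖ ^ 2 := by
    simp only [_root_.sub_apply, ContinuousLinearMap.comp_apply]
    rw [← inner_gradient_eq_fderiv, ← inner_gradient_eq_fderiv,
      ← A.inner_map_map (A.symm D) (gradient (potential g) x)]
    simp only [ContinuousLinearEquiv.coe_coe, LinearIsometryEquiv.coe_toContinuousLinearEquiv,
      LinearIsometryEquiv.apply_symm_apply]
    rw [← inner_sub_right, ← real_inner_self_eq_norm_sq]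
    rfl
  rw [h2, Real.norm_eq_abs, abs_of_nonneg (by positivity), A.symm.norm_map] at h1
  by_contra! hcon
  have hpos : 0 ≤ κ * vol * c := by
    have : 0 ≤ vol := measureReal_nonneg
    positivity
  nlinarith

/-! ### Families of functions with locally uniform compact support -/

/-- `C¹` families on `[0,∞)` whose supports stay in a fixed compact set on bounded time
intervals. -/
structure IsCompactFamily (H : ℝ → Phase → ℝ) : Prop where
  contDiffOn : ContDiffOn ℝ 1 (fun p : ℝ × Phase => H p.1 p.2) (Ici 0 ×ˢ univ)
  support : ∀ T : ℝ, ∃ R, 0 < R ∧ ∀ t ∈ Icc 0 T, ∀ z : Phase, R < ‖z.1‖ ∨ R < ‖z.2‖ → H t z = 0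

namespace IsCompactFamily

variable {H : ℝ → Phase → ℝ}

theorem differentiableAt (hH : IsCompactFamily H) {t : ℝ} (ht : 0 < t) (z : Phase) :
    DifferentiableAt ℝ (fun p : ℝ × Phase => H p.1 p.2) (t, z) :=
  (hH.contDiffOn.contDiffAt (mem_nhds_Ici_prod ht z)).differentiableAt one_ne_zero

theorem exists_fderiv_le (hH : IsCompactFamily H) (T : ℝ) : ∃ C, 0 ≤ C ∧ ∀ t ∈ Ioo 0 T, ∀ z,
    ‖fderiv ℝ (fun p : ℝ × Phase => H p.1 p.2) (t, z)‖ ≤ C := by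
  obtain ⟨R, hR, hsupp⟩ := hH.support T
  set K : Set Phase := Metric.closedBall 0 R ×ˢ Metric.closedBall 0 R with hKdef
  have hK : IsCompact K := (isCompact_closedBall _ _).prod (isCompact_closedBall _ _)
  have hu : UniqueDiffOn ℝ (Ici (0 : ℝ) ×ˢ (univ : Set Phase)) :=
    (uniqueDiffOn_Ici 0).prod uniqueDiffOn_univ
  have hcont := hH.contDiffOn.continuousOn_fderivWithin hu le_rfl
  obtain ⟨C, hC⟩ := ((isCompact_Icc (a := (0 : ℝ)) (b := T)).prod hK).exists_bound_of_continuousOn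
    (hcont.mono (prod_mono Icc_subset_Ici_self (subset_univ _)))
  refine ⟨max C 0, le_max_right _ _, fun t ht z => ?_⟩
  by_cases hz : z ∈ K
  · have h := hC (t, z) ⟨Ioo_subset_Icc_self ht, hz⟩
    rw [fderivWithin_of_mem_nhds (mem_nhds_Ici_prod ht.1 z)] at h
    exact h.trans (le_max_left _ _)
  · have hev : (fun p : ℝ × Phase => H p.1 p.2) =ᶠ[𝓝 (t, z)] fun _ => 0 := by
      filter_upwards [prod_mem_nhds (Ioo_mem_nhds ht.1 ht.2)
        (hK.isClosed.isOpen_compl.mem_nhds hz)] with p hp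
      refine hsupp p.1 (Ioo_subset_Icc_self hp.1) p.2 ?_
      by_contra! hcon
      exact hp.2 ⟨mem_closedBall_zero_iff.2 hcon.1, mem_closedBall_zero_iff.2 hcon.2⟩
    rw [hev.fderiv_eq]
    simp

end IsCompactFamily

namespace IsClassicalSolution

variable {f : ℝ → Phase → ℝ}

theorem isCompactFamily (hf : IsClassicalSolution f) (hc : HasCompactSupport (f 0)) :
    IsCompactFamily f :=
  ⟨hf.contDiffOn, hf.exists_support_radius hc⟩

/-- Spherical symmetry is preserved. -/
theorem rotate_eq (hf : IsClassicalSolution f) (hc : HasCompactSupport (f 0))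
    (hs : IsSphericallySymmetric (f 0)) {A : E3 ≃ₗᵢ[ℝ] E3}
    (hA : LinearMap.det (A.toLinearEquiv : E3 →ₗ[ℝ] E3) = 1) {t : ℝ} (ht : 0 ≤ t) (z : Phase) :
    f t (A z.1, A z.2) = f t z := by
  set a : Phase → Phase := fun z => (A z.1, A z.2) with ha
  have hac : Continuous a := by fun_prop
  have h0 (z : Phase) : f 0 (a z) = f 0 z := by
    have hcont := (hf.contDiff_slice le_rfl).continuous
    exact congrFun (((hcont.comp hac).ae_eq_iff_eq volume hcont).1 (hs A hA)) z
  -- The time interval is enlarged so that `t` lies in its interior, where the derivative bound is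
  -- available.
  set T := t + 1
  obtain ⟨R, hR, hsupp⟩ := hf.exists_support_radius hc T
  obtain ⟨C₁, hC₁, hder⟩ := (hf.isCompactFamily hc).exists_fderiv_le T
  obtain ⟨C₂, hC₂, hfield⟩ := exists_field_rotate_le R
  -- A Gronwall weight. At a spatial maximum of the asymmetry `c = |f - f ∘ a|`, the field fails to
  -- be equivariant by at most `C₂ c`, so `f ∘ a` changes along the characteristic at rate at most
  -- `C₁ C₂ c`. The weight `exp(-2 lam s)` outweighs this and makes `w` strictly decrease.
  set lam := C₁ * C₂ + 1 with hlam
  set w : ℝ → Phase → ℝ := fun s z => Real.exp (-2 * lam * s) * (f s z - f s (a z)) ^ 2 with hw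
  set K : Set Phase := Metric.closedBall 0 R ×ˢ Metric.closedBall 0 R
  have hK : IsCompact K := (isCompact_closedBall _ _).prod (isCompact_closedBall _ _)
  have hfc := hf.contDiffOn.continuousOn
  have hwc : ContinuousOn (fun p : ℝ × Phase => w p.1 p.2) (Icc 0 t ×ˢ univ) := by
    refine ContinuousOn.mul (by fun_prop) (ContinuousOn.pow (ContinuousOn.sub ?_ ?_) 2)
    · exact hfc.mono (prod_mono_left Icc_subset_Ici_self)
    · have h1 : ContinuousOn (fun p : ℝ × Phase => (p.1, a p.2)) (Icc 0 t ×ˢ univ) := by fun_prop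
      exact hfc.comp h1 fun p hp => ⟨hp.1.1, mem_univ _⟩
  have main := nonpos_of_decreasing_at_max (w := w) (T := t) hK hwc ?_ ?_ ?_ t ⟨ht, le_rfl⟩ z
  · have h1 : (f t z - f t (a z)) ^ 2 ≤ 0 := by
      have := Real.exp_pos (-2 * lam * t)
      by_contra! hcon
      exact absurd main (not_le.2 (mul_pos this hcon))
    have h2 := pow_eq_zero_iff two_ne_zero |>.1 (le_antisymm h1 (sq_nonneg _))
    exact (sub_eq_zero.1 h2).symm
  · intro s hs z hz
    have hz' : R < ‖z.1‖ ∨ R < ‖z.2‖ := by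
      by_contra! hcon
      exact hz ⟨mem_closedBall_zero_iff.2 hcon.1, mem_closedBall_zero_iff.2 hcon.2⟩
    have hsT : s ∈ Icc 0 T := ⟨hs.1, hs.2.trans (by simp [T])⟩
    simp only [hw]
    rw [hsupp s hsT z hz', hsupp s hsT (a z) (by simpa [ha] using hz')]
    simp
  · intro z
    simp [hw, h0]
  · intro s hs z hpos hmax
    have hsT : s ∈ Icc 0 T := ⟨hs.1.le, hs.2.trans (by simp [T])⟩
    have hsT' : s ∈ Ioo 0 T := ⟨hs.1, hs.2.trans_lt (by simp [T])⟩
    set c := |f s z - f s (a z)| with hcdef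
    have hcz : ∀ z', |f s z' - f s (a z')| ≤ c := fun z' => by
      have := hmax z'
      simp only [hw] at this
      exact sq_le_sq.1 (le_of_mul_le_mul_left this (Real.exp_pos _))
    have hcpos : 0 < c ^ 2 := by
      rw [hcdef, sq_abs]
      simp only [hw] at hpos
      exact (mul_pos_iff_of_pos_left (Real.exp_pos _)).1 hpos
    have hF := hfield (f s) A c (hf.differentiable_potential hs.1.le) (hsupp s hsT)
      (hf.density_exists s hs.1.le) (hf.potential_exists s hs.1.le) (abs_nonneg _) hcz z.1
    set F := gradPot (f s) z.1
    set D := gradPot (f s) (A z.1) - A F with hD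
    have hl1 := hasDerivAt_line (X := (z.2, -F)) (hf.differentiableAt hs.1 z)
    rw [hf.transport hs.1 z] at hl1
    have hl2 := hasDerivAt_line (X := (A z.2, -A F)) (hf.differentiableAt hs.1 (a z))
    set e := fderiv ℝ (fun p : ℝ × Phase => f p.1 p.2) (s, a z) (1, (A z.2, -A F)) with he
    have hebound : |e| ≤ C₁ * (C₂ * c) := by
      have e1 : ((1 : ℝ), ((A z.2, -A F) : Phase)) =
          (1, ((a z).2, -gradPot (f s) (a z).1)) + (0, (0, D)) := by
        simp only [ha, hD, Prod.mk_add_mk, add_zero]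
        congr 2; abel
      rw [he, e1, map_add, hf.transport hs.1 (a z), zero_add, ← Real.norm_eq_abs]
      refine (ContinuousLinearMap.le_of_opNorm_le _ (hder s hsT' (a z)) _).trans ?_
      gcongr
      simpa [Prod.norm_def] using hF
    have had : DifferentiableAt ℝ (fun p : ℝ × Phase => f p.1 (a p.2)) (s, z) := by
      have h1 : DifferentiableAt ℝ (fun p : ℝ × Phase => (p.1, a p.2)) (s, z) := by fun_prop
      exact DifferentiableAt.comp (s, z) (hf.differentiableAt hs.1 (a z)) h1
    have hl2' : HasDerivAt (fun τ : ℝ => (fun p : ℝ × Phase => f p.1 (a p.2))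
        ((s, z) + τ • ((1 : ℝ), ((z.2, -F) : Phase)))) e 0 := by
      refine hl2.congr_of_eventuallyEq (Eventually.of_forall fun τ => ?_)
      simp [ha]
    have hexp : HasDerivAt (fun τ : ℝ => Real.exp (-2 * lam * (s + τ * 1)))
        (Real.exp (-2 * lam * s) * (-2 * lam)) 0 := by
      have := ((((hasDerivAt_id (0 : ℝ)).mul_const 1).const_add s).const_mul (-2 * lam)).exp
      refine this.congr_deriv ?_
      simp
    have hline := hexp.mul ((hl1.sub hl2').pow 2)
    simp only [zero_smul, add_zero, mul_one, Pi.sub_apply] at hline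
    have hGd : DifferentiableAt ℝ (fun p : ℝ × Phase => w p.1 p.2) (s, z) :=
      DifferentiableAt.mul (by fun_prop) (((hf.differentiableAt hs.1 z).sub had).pow 2)
    have hfin := hasDerivAt_time_of_spatial_max (X := (z.2, -F)) hGd hmax (by
      refine hline.congr_of_eventuallyEq (Eventually.of_forall fun τ => ?_)
      simp [hw])
    refine ⟨_, ?_, hfin⟩
    have hexp0 := Real.exp_pos (-2 * lam * s)
    have hce : -(f s z - f s (a z)) * e ≤ C₁ * C₂ * c ^ 2 := by
      refine (le_abs_self _).trans ?_
      rw [abs_mul, abs_neg]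
      calc c * |e| ≤ c * (C₁ * (C₂ * c)) := by gcongr
        _ = C₁ * C₂ * c ^ 2 := by ring
    have hc2 : c ^ 2 = (f s z - f s (a z)) ^ 2 := sq_abs _
    have key : Real.exp (-2 * lam * s) * (-2 * lam * c ^ 2 +
        2 * (-(f s z - f s (a z)) * e)) < 0 := by
      refine mul_neg_of_pos_of_neg hexp0 ?_
      rw [hlam]; nlinarith
    rw [hc2] at key
    refine lt_of_eq_of_lt ?_ key
    simp only [Pi.pow_apply, Pi.sub_apply, zero_smul, add_zero, Nat.cast_ofNat,
      Nat.add_one_sub_one, pow_one]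
    ring

end IsClassicalSolution

end VlasovPoisson

namespace VlasovPoisson

/-! ### Integrals along the flow -/

theorem integral_fderiv_apply_eq_zero {u : E3 → ℝ} (hu : ContDiff ℝ 1 u) (hc : HasCompactSupport u)
    (w : E3) : ∫ x, fderiv ℝ u x w = 0 := by
  have hi : Integrable fun x => fderiv ℝ u x w :=
    ((hu.continuous_fderiv one_ne_zero).clm_apply continuous_const).integrable_of_hasCompactSupport
      (hc.fderiv_apply ℝ w)
  have h := integral_mul_fderiv_eq_neg_fderiv_mul_of_integrable (μ := (volume : Measure E3))
    (f := fun _ => (1 : ℝ)) (g := u) (v := w) (by simp) (by simpa using hi)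
    (by simpa using hu.continuous.integrable_of_hasCompactSupport hc)
    (fun x _ => differentiableAt_const _) (fun x _ => hu.differentiable one_ne_zero x)
  simpa using h

/-- The vector field `(v, F(x))` is divergence free. -/
theorem integral_fderiv_field_eq_zero {g : Phase → ℝ} (hg : ContDiff ℝ 1 g)
    (hc : HasCompactSupport g) {F : E3 → E3} (hF : Continuous F) :
    ∫ z : Phase, fderiv ℝ g z (z.2, F z.1) = 0 := by
  have hgc := hg.continuous_fderiv one_ne_zero
  have hdiff := hg.differentiable one_ne_zero
  have hint {X : Phase → Phase} (hX : Continuous X) : Integrable fun z => fderiv ℝ g z (X z) := by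
    refine (hgc.clm_apply hX).integrable_of_hasCompactSupport ?_
    refine HasCompactSupport.intro (hc.fderiv (𝕜 := ℝ)).isCompact fun z hz => ?_
    rw [image_eq_zero_of_notMem_tsupport hz]; rfl
  have h1 : Integrable fun z : Phase => fderiv ℝ g z (z.2, 0) := hint (by fun_prop)
  have h2 : Integrable fun z : Phase => fderiv ℝ g z (0, F z.1) := hint (by fun_prop)
  have hsplit (z : Phase) : fderiv ℝ g z (z.2, F z.1) =
      fderiv ℝ g z (z.2, 0) + fderiv ℝ g z (0, F z.1) := by
    rw [← map_add]; simp
  have hinl (x v : E3) : HasFDerivAt (fun y => g (y, v))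
      ((fderiv ℝ g (x, v)).comp (ContinuousLinearMap.inl ℝ E3 E3)) x :=
    (hdiff (x, v)).hasFDerivAt.comp x (hasFDerivAt_prodMk_left x v)
  have hinr (x v : E3) : HasFDerivAt (fun w => g (x, w))
      ((fderiv ℝ g (x, v)).comp (ContinuousLinearMap.inr ℝ E3 E3)) v :=
    (hdiff (x, v)).hasFDerivAt.comp v (hasFDerivAt_prodMk_right x v)
  have hz1 : ∫ z : Phase, fderiv ℝ g z (z.2, 0) = 0 := by
    rw [Measure.volume_eq_prod, integral_prod_symm _ (by rwa [← Measure.volume_eq_prod])]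
    refine (integral_congr_ae (Eventually.of_forall fun v => ?_)).trans (integral_zero _ _)
    have hcv : HasCompactSupport fun y => g (y, v) :=
      HasCompactSupport.intro (hc.isCompact.image continuous_fst) fun y hy =>
        image_eq_zero_of_notMem_tsupport fun h => hy ⟨_, h, rfl⟩
    have := integral_fderiv_apply_eq_zero
      (hg.comp (by fun_prop : ContDiff ℝ 1 fun y : E3 => (y, v))) hcv v
    refine Eq.trans (integral_congr_ae (Eventually.of_forall fun x => ?_)) this
    simp only [Function.comp_def]
    rw [(hinl x v).fderiv]; simp
  have hz2 : ∫ z : Phase, fderiv ℝ g z (0, F z.1) = 0 := by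
    rw [Measure.volume_eq_prod, integral_prod _ (by rwa [← Measure.volume_eq_prod])]
    refine (integral_congr_ae (Eventually.of_forall fun x => ?_)).trans (integral_zero _ _)
    have hcv : HasCompactSupport fun w => g (x, w) :=
      HasCompactSupport.intro (hc.isCompact.image continuous_snd) fun y hy =>
        image_eq_zero_of_notMem_tsupport fun h => hy ⟨_, h, rfl⟩
    have := integral_fderiv_apply_eq_zero
      (hg.comp (by fun_prop : ContDiff ℝ 1 fun w : E3 => (x, w))) hcv (F x)
    refine Eq.trans (integral_congr_ae (Eventually.of_forall fun v => ?_)) this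
    simp only [Function.comp_def]
    rw [(hinr x v).fderiv]; simp
  simp_rw [hsplit]
  rw [integral_add h1 h2, hz1, hz2, add_zero]

namespace IsCompactFamily

variable {H : ℝ → Phase → ℝ}

theorem contDiff_slice (hH : IsCompactFamily H) {t : ℝ} (ht : 0 ≤ t) : ContDiff ℝ 1 (H t) := by
  have h : ContDiff ℝ 1 fun z : Phase => ((t, z) : ℝ × Phase) := by fun_prop
  rw [← contDiffOn_univ] at h ⊢
  exact hH.contDiffOn.comp h fun z _ => ⟨ht, mem_univ _⟩

theorem hasCompactSupport_slice (hH : IsCompactFamily H) {t : ℝ} (ht : 0 ≤ t) :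
    HasCompactSupport (H t) := by
  obtain ⟨R, -, hR⟩ := hH.support t
  refine HasCompactSupport.intro
    ((isCompact_closedBall (0 : E3) R).prod (isCompact_closedBall (0 : E3) R)) fun z hz => ?_
  refine hR t ⟨ht, le_rfl⟩ z ?_
  by_contra! hcon
  exact hz ⟨mem_closedBall_zero_iff.2 hcon.1, mem_closedBall_zero_iff.2 hcon.2⟩

theorem integrable_slice (hH : IsCompactFamily H) {t : ℝ} (ht : 0 ≤ t) : Integrable (H t) :=
  (hH.contDiff_slice ht).continuous.integrable_of_hasCompactSupport (hH.hasCompactSupport_slice ht)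

theorem continuousOn_integral (hH : IsCompactFamily H) :
    ContinuousOn (fun t => ∫ z, H t z) (Ici 0) := by
  intro t ht
  obtain ⟨R, -, hR⟩ := hH.support (t + 1)
  have h : ContinuousOn (fun t => ∫ z, H t z) (Icc 0 (t + 1)) := by
    refine continuousOn_integral_of_compact_support
      ((isCompact_closedBall (0 : E3) R).prod (isCompact_closedBall (0 : E3) R))
      (hH.contDiffOn.continuousOn.mono (prod_mono_left Icc_subset_Ici_self)) fun s z hs hz => ?_
    refine hR s hs z ?_
    by_contra! hcon
    exact hz ⟨mem_closedBall_zero_iff.2 hcon.1, mem_closedBall_zero_iff.2 hcon.2⟩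
  refine (h t ⟨ht, by linarith⟩).mono_of_mem_nhdsWithin ?_
  rw [← Ici_inter_Iic]
  exact inter_mem_nhdsWithin _ (Iic_mem_nhds (by linarith))

theorem hasDerivAt_integral_time (hH : IsCompactFamily H) {t : ℝ} (ht : 0 < t) :
    Integrable (fun z => fderiv ℝ (fun p : ℝ × Phase => H p.1 p.2) (t, z) (1, 0)) ∧
    HasDerivAt (fun s => ∫ z, H s z)
      (∫ z, fderiv ℝ (fun p : ℝ × Phase => H p.1 p.2) (t, z) (1, 0)) t := by
  obtain ⟨R, -, hR⟩ := hH.support (t + 1)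
  obtain ⟨C, hC, hder⟩ := hH.exists_fderiv_le (t + 1)
  set K : Set Phase := Metric.closedBall 0 R ×ˢ Metric.closedBall 0 R
  have hK : IsCompact K := (isCompact_closedBall _ _).prod (isCompact_closedBall _ _)
  have hnhds : Ioo 0 (t + 1) ∈ 𝓝 t := Ioo_mem_nhds ht (by linarith)
  have hd (s : ℝ) (hs : s ∈ Ioo 0 (t + 1)) (z : Phase) : HasDerivAt (fun s => H s z)
      (fderiv ℝ (fun p : ℝ × Phase => H p.1 p.2) (s, z) (1, 0)) s :=
    hasDerivAt_time (hH.differentiableAt hs.1 z)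
  have hcont : Continuous fun z => fderiv ℝ (fun p : ℝ × Phase => H p.1 p.2) (t, z) (1, 0) := by
    have h1 : ContinuousOn (fderiv ℝ fun p : ℝ × Phase => H p.1 p.2) (Ioi 0 ×ˢ univ) :=
      (hH.contDiffOn.mono (prod_mono_left Ioi_subset_Ici_self)).continuousOn_fderiv_of_isOpen
        (isOpen_Ioi.prod isOpen_univ) le_rfl
    exact (h1.comp_continuous (f := fun z : Phase => (t, z)) (by fun_prop)
      fun z => ⟨ht, mem_univ _⟩).clm_apply continuous_const
  refine hasDerivAt_integral_of_dominated_loc_of_deriv_le hnhds ?_ (hH.integrable_slice ht.le)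
    (F' := fun s z => fderiv ℝ (fun p : ℝ × Phase => H p.1 p.2) (s, z) (1, 0))
    (bound := K.indicator fun _ => C) hcont.aestronglyMeasurable ?_ ?_ ?_
  · filter_upwards [hnhds] with s hs
    exact (hH.contDiff_slice hs.1.le).continuous.aestronglyMeasurable
  · refine Eventually.of_forall fun z s hs => ?_
    by_cases hz : z ∈ K
    · rw [indicator_of_mem hz]
      refine (ContinuousLinearMap.le_of_opNorm_le _ (hder s hs z) _).trans ?_
      simp [Prod.norm_def]
    · rw [indicator_of_notMem hz]
      have hz' : R < ‖z.1‖ ∨ R < ‖z.2‖ := by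
        by_contra! hcon
        exact hz ⟨mem_closedBall_zero_iff.2 hcon.1, mem_closedBall_zero_iff.2 hcon.2⟩
      have hev : (fun s => H s z) =ᶠ[𝓝 s] fun _ => 0 := by
        filter_upwards [Ioo_mem_nhds hs.1 hs.2] with τ hτ
        exact hR τ (Ioo_subset_Icc_self hτ) z hz'
      rw [((hasDerivAt_const s (0 : ℝ)).congr_of_eventuallyEq hev).unique (hd s hs z) |>.symm]
      simp
  · rw [integrable_indicator_iff hK.measurableSet]
    exact integrableOn_const hK.measure_lt_top.ne
  · exact Eventually.of_forall fun z s hs => hd s hs z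

/-- Since `(v, F(x))` is divergence free, its transport term integrates to zero and may be added to
the time derivative; the integrand can thus be computed along characteristics. -/
theorem hasDerivAt_integral (hH : IsCompactFamily H) {t : ℝ} (ht : 0 < t) {F : E3 → E3}
    (hF : Continuous F) : HasDerivAt (fun s => ∫ z, H s z)
      (∫ z : Phase, fderiv ℝ (fun p : ℝ × Phase => H p.1 p.2) (t, z) (1, (z.2, F z.1))) t := by
  obtain ⟨hi, hd⟩ := hH.hasDerivAt_integral_time ht
  refine hd.congr_deriv ?_
  have hg := hH.contDiff_slice ht.le
  have hc := hH.hasCompactSupport_slice ht.le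
  have h0 := integral_fderiv_field_eq_zero hg hc hF
  have hi2 : Integrable fun z : Phase => fderiv ℝ (H t) z (z.2, F z.1) := by
    refine ((hg.continuous_fderiv one_ne_zero).clm_apply
      (by fun_prop : Continuous fun z : Phase => (z.2, F z.1))).integrable_of_hasCompactSupport ?_
    refine HasCompactSupport.intro (hc.fderiv (𝕜 := ℝ)).isCompact fun z hz => ?_
    rw [image_eq_zero_of_notMem_tsupport hz]; rfl
  have hsplit (z : Phase) :
      fderiv ℝ (fun p : ℝ × Phase => H p.1 p.2) (t, z) (1, (z.2, F z.1)) =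
      fderiv ℝ (fun p : ℝ × Phase => H p.1 p.2) (t, z) (1, 0) + fderiv ℝ (H t) z (z.2, F z.1) := by
    rw [show H t = fun z' => (fun p : ℝ × Phase => H p.1 p.2) (t, z') from rfl,
      fderiv_slice (hH.differentiableAt ht z), ← map_add]
    simp
  simp_rw [hsplit]
  rw [integral_add hi hi2, h0, add_zero]

end IsCompactFamily

theorem eq_of_hasDerivAt_zero {φ : ℝ → ℝ} (hc : ContinuousOn φ (Ici 0))
    (hd : ∀ t, 0 < t → HasDerivAt φ 0 t) {t : ℝ} (ht : 0 ≤ t) : φ t = φ 0 := by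
  rcases eq_or_lt_of_le ht with rfl | ht
  · rfl
  obtain ⟨c, -, h⟩ := exists_hasDerivAt_eq_slope φ (fun _ => 0) ht
    (hc.mono Icc_subset_Ici_self) fun s hs => hd s hs.1
  have := (div_eq_zero_iff.1 h.symm).resolve_right (by linarith)
  linarith

/-- The integral of a family that is constant along a Hamiltonian flow is conserved. -/
theorem IsCompactFamily.integral_eq {H : ℝ → Phase → ℝ} (hH : IsCompactFamily H)
    {F : ℝ → E3 → E3} (hF : ∀ t, 0 < t → Continuous (F t))
    (hconst : ∀ t, 0 < t → ∀ z : Phase,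
      fderiv ℝ (fun p : ℝ × Phase => H p.1 p.2) (t, z) (1, (z.2, F t z.1)) = 0)
    {t : ℝ} (ht : 0 ≤ t) : ∫ z, H t z = ∫ z, H 0 z := by
  refine eq_of_hasDerivAt_zero (φ := fun t => ∫ z, H t z) hH.continuousOn_integral
    (fun s hs => ?_) ht
  refine (hH.hasDerivAt_integral hs (hF s hs)).congr_deriv ?_
  simp [hconst s hs]

end VlasovPoisson

namespace VlasovPoisson

/-! ### Conservation of mass and Casimirs -/

theorem contDiff_angMom : ContDiff ℝ 1 angMom := by
  have h1 : ContDiff ℝ 1 fun z : Phase => ‖z.1‖ ^ 2 := contDiff_fst.norm_sq ℝ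
  have h2 : ContDiff ℝ 1 fun z : Phase => ‖z.2‖ ^ 2 := contDiff_snd.norm_sq ℝ
  have h3 : ContDiff ℝ 1 fun z : Phase => inner ℝ z.1 z.2 := contDiff_fst.inner ℝ contDiff_snd
  exact (h1.mul h2).sub (h3.pow 2)

/-- Angular momentum is constant along trajectories in a central field. -/
theorem hasDerivAt_angMom_line {x v F : E3} (hF : x ≠ 0 → ∃ k : ℝ, F = k • x) :
    HasDerivAt (fun s : ℝ => angMom (x + s • v, v + s • (-F))) 0 0 := by
  have h1 : HasDerivAt (fun s : ℝ => x + s • v) v 0 := by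
    simpa using ((hasDerivAt_id (0 : ℝ)).smul_const v).const_add x
  have h2 : HasDerivAt (fun s : ℝ => v + s • (-F)) (-F) 0 := by
    simpa using ((hasDerivAt_id (0 : ℝ)).smul_const (-F)).const_add v
  have h := (h1.norm_sq.mul h2.norm_sq).sub ((h1.inner ℝ h2).pow 2)
  refine h.congr_deriv ?_
  simp only [zero_smul, add_zero, Nat.cast_ofNat, Nat.add_one_sub_one, pow_one, inner_neg_right,
    real_inner_self_eq_norm_sq]
  by_cases hx : x = 0
  · simp [hx]
  · obtain ⟨k, rfl⟩ := hF hx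
    simp only [inner_smul_right, real_inner_self_eq_norm_sq, real_inner_comm x v]
    ring

namespace IsClassicalSolution

variable {f : ℝ → Phase → ℝ}

theorem isSymmetricDensity (hf : IsClassicalSolution f) (hc : HasCompactSupport (f 0))
    (hs : IsSphericallySymmetric (f 0)) {t : ℝ} (ht : 0 ≤ t) : IsSymmetricDensity (f t) :=
  ⟨(hf.isCompactFamily hc).integrable_slice ht, Eventually.of_forall (hf.nonneg t ht),
    fun _ hA => Eventually.of_forall fun z => hf.rotate_eq hc hs hA ht z⟩

theorem isCompactFamily_comp (hf : IsClassicalSolution f) (hc : HasCompactSupport (f 0))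
    {φ : ℝ × ℝ → ℝ} (hφ : ContDiff ℝ 1 φ) (h0 : ∀ L, φ (0, L) = 0) :
    IsCompactFamily fun t z => φ (f t z, angMom z) := by
  refine ⟨hφ.comp_contDiffOn (hf.contDiffOn.prodMk
    (contDiff_angMom.comp contDiff_snd).contDiffOn), fun T => ?_⟩
  obtain ⟨R, hR, h⟩ := hf.exists_support_radius hc T
  exact ⟨R, hR, fun t ht z hz => by rw [h t ht z hz, h0]⟩

/-- Both arguments of `φ` are constant to first order along characteristics: `f` by the Vlasov
equation, `L` because symmetry makes the force central. The condition `φ (0, L) = 0` keeps the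
support compact. -/
theorem integral_comp_eq (hf : IsClassicalSolution f) (hc : HasCompactSupport (f 0))
    (hs : IsSphericallySymmetric (f 0)) {φ : ℝ × ℝ → ℝ} (hφ : ContDiff ℝ 1 φ)
    (h0 : ∀ L, φ (0, L) = 0) {t : ℝ} (ht : 0 ≤ t) :
    ∫ z, φ (f t z, angMom z) = ∫ z, φ (f 0 z, angMom z) := by
  have hH := hf.isCompactFamily_comp hc hφ h0
  refine hH.integral_eq (F := fun t x => -gradPot (f t) x)
    (fun s hs => (hf.continuous_gradPot hs.le).neg) (fun s hs' z => ?_) ht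
  set F := gradPot (f s) z.1 with hFdef
  have hl := hasDerivAt_line (X := (z.2, -F)) (hf.differentiableAt hs' z)
  rw [hf.transport hs' z] at hl
  have hL := hasDerivAt_angMom_line (x := z.1) (v := z.2) (F := F) fun hx =>
    ⟨_, (hf.isSymmetricDensity hc hs hs'.le).gradPot_eq hx⟩
  have hd := (hφ.differentiable one_ne_zero (f s z, angMom z)).hasFDerivAt
  have hd' : HasFDerivAt φ (fderiv ℝ φ (f s z, angMom z))
      (f ((s, z) + (0 : ℝ) • ((1 : ℝ), ((z.2, -F) : Phase))).1
        ((s, z) + (0 : ℝ) • ((1 : ℝ), ((z.2, -F) : Phase))).2,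
        angMom (z.1 + (0 : ℝ) • z.2, z.2 + (0 : ℝ) • (-F))) := by simpa using hd
  have hcomp := hd'.comp_hasDerivAt (0 : ℝ) (hl.prodMk hL)
  rw [Prod.mk_zero_zero, map_zero] at hcomp
  exact (hasDerivAt_line (X := (z.2, -F)) (hH.differentiableAt hs' z)).unique hcomp

theorem integral_eq (hf : IsClassicalSolution f) (hc : HasCompactSupport (f 0))
    (hs : IsSphericallySymmetric (f 0)) {t : ℝ} (ht : 0 ≤ t) : ∫ z, f t z = ∫ z, f 0 z :=
  hf.integral_comp_eq hc hs contDiff_fst (fun _ => rfl) ht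

/-- The joint law of `f` and `L` under the measure `f dx dv` is conserved. -/
theorem map_withDensity_eq (hf : IsClassicalSolution f) (hc : HasCompactSupport (f 0))
    (hs : IsSphericallySymmetric (f 0)) {t : ℝ} (ht : 0 ≤ t) :
    (volume.withDensity fun z => ENNReal.ofReal (f t z)).map (fun z => (f t z, angMom z)) =
      (volume.withDensity fun z => ENNReal.ofReal (f 0 z)).map fun z => (f 0 z, angMom z) := by
  have hfin {s : ℝ} (hs : 0 ≤ s) :
      IsFiniteMeasure (volume.withDensity fun z => ENNReal.ofReal (f s z)) := by
    refine isFiniteMeasure_withDensity_ofReal ?_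
    exact ((hf.isCompactFamily hc).integrable_slice hs).2
  have := hfin ht
  have := hfin le_rfl
  have hm {s : ℝ} (hs : 0 ≤ s) : Measurable (f s) := (hf.contDiff_slice hs).continuous.measurable
  refine Measure.ext_of_charFunDual ?_
  ext ℓ
  set a := ℓ (1, 0)
  set b := ℓ (0, 1)
  have hℓ (p : ℝ × ℝ) : ℓ p = a * p.1 + b * p.2 := by
    have : p = p.1 • (1, 0) + p.2 • (0, 1) := by simp
    conv_lhs => rw [this, map_add, map_smul, map_smul]
    simp only [smul_eq_mul, a, b]; ring
  -- Real and imaginary parts of the characteristic function's integrand. The factor `p.1` comes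
  -- from the weight `f` and makes them vanish at `f = 0`.
  set φ : ℝ × ℝ → ℝ := fun p => p.1 * Real.cos (a * p.1 + b * p.2) with hφ
  set ψ : ℝ × ℝ → ℝ := fun p => p.1 * Real.sin (a * p.1 + b * p.2) with hψ
  have hφc : ContDiff ℝ 1 φ := by fun_prop
  have hψc : ContDiff ℝ 1 ψ := by fun_prop
  have hφ0 (L : ℝ) : φ (0, L) = 0 := by simp [hφ]
  have hψ0 (L : ℝ) : ψ (0, L) = 0 := by simp [hψ]
  have key {s : ℝ} (hs : 0 ≤ s) : charFunDual
      ((volume.withDensity fun z => ENNReal.ofReal (f s z)).map (fun z => (f s z, angMom z))) ℓ =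
      ((∫ z, φ (f s z, angMom z) : ℝ) : ℂ) + (∫ z, ψ (f s z, angMom z) : ℝ) * Complex.I := by
    rw [charFunDual_apply, integral_map ((hm hs).prodMk continuous_angMom.measurable).aemeasurable
      (by fun_prop), integral_withDensity_eq_integral_toReal_smul (hm hs).ennreal_ofReal
      (Eventually.of_forall fun _ => ENNReal.ofReal_lt_top)]
    have e (z : Phase) : (ENNReal.ofReal (f s z)).toReal •
        Complex.exp (((ℓ (f s z, angMom z) : ℝ) : ℂ) * Complex.I) =
        ((φ (f s z, angMom z) : ℝ) : ℂ) + ((ψ (f s z, angMom z) : ℝ) : ℂ) * Complex.I := by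
      rw [ENNReal.toReal_ofReal (hf.nonneg s hs z), hℓ, Complex.exp_mul_I, Complex.real_smul]
      simp only [hφ, hψ]
      push_cast
      ring
    simp_rw [e]
    rw [integral_add ((hf.isCompactFamily_comp hc hφc hφ0).integrable_slice hs).ofReal
      (((hf.isCompactFamily_comp hc hψc hψ0).integrable_slice hs).ofReal.mul_const _),
      integral_mul_const, integral_complex_ofReal, integral_complex_ofReal]
  rw [key ht, key le_rfl, hf.integral_comp_eq hc hs hφc hφ0 ht,
    hf.integral_comp_eq hc hs hψc hψ0 ht]

theorem integrable_casimir (hf : IsClassicalSolution f) (hc : HasCompactSupport (f 0))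
    {Q : ℝ → ℝ → ℝ} (hQ : IsCasimirIntegrand Q) (hQ0 : ∀ L, 0 ≤ L → Q 0 L = 0) {t : ℝ}
    (ht : 0 ≤ t) : Integrable fun z => Q (f t z) (angMom z) := by
  have hcont : Continuous fun z => Q (f t z) (angMom z) :=
    hQ.continuousOn.comp_continuous (f := fun z => (f t z, angMom z))
      ((hf.contDiff_slice ht).continuous.prodMk continuous_angMom)
      fun z => ⟨hf.nonneg t ht z, angMom_nonneg z⟩
  refine hcont.integrable_of_hasCompactSupport ?_
  refine HasCompactSupport.intro ((hf.isCompactFamily hc).hasCompactSupport_slice ht).isCompact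
    fun z hz => ?_
  rw [image_eq_zero_of_notMem_tsupport hz, hQ0 _ (angMom_nonneg z)]

theorem integral_casimir_eq (hf : IsClassicalSolution f) (hc : HasCompactSupport (f 0))
    (hs : IsSphericallySymmetric (f 0)) {Q : ℝ → ℝ → ℝ} (hQ : IsCasimirIntegrand Q)
    (hQ0 : ∀ L, 0 ≤ L → Q 0 L = 0) {t : ℝ} (ht : 0 ≤ t) :
    ∫ z, Q (f t z) (angMom z) = ∫ z, Q (f 0 z) (angMom z) := by
  -- `∬ Q(f, L)` is the integral of `Q/f` against the conserved law, which needs only measurability.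
  -- The quotient at `f = 0` is irrelevant: the weight vanishes there, and so does `Q`.
  set q : ℝ × ℝ → ℝ := fun p => Q (max p.1 0) (max p.2 0) / p.1 with hq
  have hqm : Measurable q := hQ.continuous_max.measurable.div measurable_fst
  have key {s : ℝ} (hs : 0 ≤ s) : ∫ p, q p ∂((volume.withDensity fun z =>
      ENNReal.ofReal (f s z)).map (fun z => (f s z, angMom z))) =
      ∫ z, Q (f s z) (angMom z) := by
    have hm : Measurable (f s) := (hf.contDiff_slice hs).continuous.measurable
    rw [integral_map (hm.prodMk continuous_angMom.measurable).aemeasurable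
      hqm.aestronglyMeasurable, integral_withDensity_eq_integral_toReal_smul hm.ennreal_ofReal
      (Eventually.of_forall fun _ => ENNReal.ofReal_lt_top)]
    congr 1; ext z
    have h0 := hf.nonneg s hs z
    have hL := angMom_nonneg z
    rw [ENNReal.toReal_ofReal h0, smul_eq_mul]
    simp only [hq, max_eq_left h0, max_eq_left hL]
    by_cases hz : f s z = 0
    · rw [hz, zero_mul, hQ0 _ hL]
    · field_simp
  rw [← key ht, ← key le_rfl, hf.map_withDensity_eq hc hs ht]

end IsClassicalSolution

end VlasovPoisson

namespace VlasovPoisson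

/-! ### Conservation of energy -/

namespace IsCompactFamily

variable {H : ℝ → Phase → ℝ}

theorem mul_left (hH : IsCompactFamily H) {G : ℝ → Phase → ℝ}
    (hG : ContDiffOn ℝ 1 (fun p : ℝ × Phase => G p.1 p.2) (Ici 0 ×ˢ univ)) :
    IsCompactFamily fun t z => G t z * H t z := by
  refine ⟨hG.mul hH.contDiffOn, fun T => ?_⟩
  obtain ⟨R, hR, h⟩ := hH.support T
  exact ⟨R, hR, fun t ht z hz => by rw [h t ht z hz, mul_zero]⟩

theorem const_slice (hH : IsCompactFamily H) {t₀ : ℝ} (ht₀ : 0 ≤ t₀) :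
    IsCompactFamily fun _ => H t₀ := by
  refine ⟨((hH.contDiff_slice ht₀).comp contDiff_snd).contDiffOn, fun T => ?_⟩
  obtain ⟨R, hR, h⟩ := hH.support t₀
  exact ⟨R, hR, fun t _ z hz => h t₀ ⟨ht₀, le_rfl⟩ z hz⟩

end IsCompactFamily

namespace IsClassicalSolution

variable {f : ℝ → Phase → ℝ}

theorem isCompactFamily_kinetic (hf : IsClassicalSolution f) (hc : HasCompactSupport (f 0)) :
    IsCompactFamily fun t z => ‖z.2‖ ^ 2 * f t z :=
  (hf.isCompactFamily hc).mul_left (G := fun _ z => ‖z.2‖ ^ 2)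
    ((contDiff_snd.comp contDiff_snd).norm_sq ℝ).contDiffOn

theorem memFM (hf : IsClassicalSolution f) (hc : HasCompactSupport (f 0)) {Q : ℝ → ℝ → ℝ}
    (hQ : IsCasimirIntegrand Q) (hQ0 : ∀ L, 0 ≤ L → Q 0 L = 0) {M : ℝ} (h0 : MemFM Q M (f 0))
    {t : ℝ} (ht : 0 ≤ t) : MemFM Q M (f t) where
  integrable := (hf.isCompactFamily hc).integrable_slice ht
  nonneg := Eventually.of_forall (hf.nonneg t ht)
  mass := (hf.integral_eq hc h0.symmetric ht).trans h0.mass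
  integrable_casimir := hf.integrable_casimir hc hQ hQ0 ht
  integrable_kinetic := (hf.isCompactFamily_kinetic hc).integrable_slice ht
  symmetric := (hf.isSymmetricDensity hc h0.symmetric ht).symmetric

theorem hasDerivAt_kinetic (hf : IsClassicalSolution f) (hc : HasCompactSupport (f 0)) {t : ℝ}
    (ht : 0 < t) : HasDerivAt (fun s => ∫ z : Phase, ‖z.2‖ ^ 2 * f s z)
      (-2 * ∫ z : Phase, inner ℝ z.2 (gradPot (f t) z.1) * f t z) t := by
  have hH := hf.isCompactFamily_kinetic hc
  refine (hH.hasDerivAt_integral ht (hf.continuous_gradPot ht.le).neg).congr_deriv ?_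
  rw [← integral_const_mul]
  congr 1; ext z
  have hl := hasDerivAt_line (X := (z.2, -gradPot (f t) z.1)) (hf.differentiableAt ht z)
  rw [hf.transport ht z] at hl
  have h2 : HasDerivAt (fun s : ℝ => z.2 + s • (-gradPot (f t) z.1)) (-gradPot (f t) z.1) 0 := by
    simpa using ((hasDerivAt_id (0 : ℝ)).smul_const (-gradPot (f t) z.1)).const_add z.2
  refine ((hasDerivAt_line (X := (z.2, -gradPot (f t) z.1)) (hH.differentiableAt ht z)).unique
    (h2.norm_sq.mul hl)).trans ?_
  simp only [zero_smul, add_zero, inner_neg_right]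
  ring

theorem hasDerivAt_frozen_potential (hf : IsClassicalSolution f) (hc : HasCompactSupport (f 0))
    {t : ℝ} (ht : 0 < t) : HasDerivAt (fun s => ∫ z : Phase, potential (f t) z.1 * f s z)
      (∫ z : Phase, inner ℝ z.2 (gradPot (f t) z.1) * f t z) t := by
  have hU : ContDiff ℝ 1 (potential (f t)) := (hf.contDiff_potential t ht.le).of_le one_le_two
  have hH : IsCompactFamily fun s z => potential (f t) z.1 * f s z :=
    (hf.isCompactFamily hc).mul_left (G := fun _ z => potential (f t) z.1)
      (hU.comp (contDiff_fst.comp contDiff_snd)).contDiffOn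
  refine (hH.hasDerivAt_integral ht (hf.continuous_gradPot ht.le).neg).congr_deriv ?_
  congr 1; ext z
  have hl := hasDerivAt_line (X := (z.2, -gradPot (f t) z.1)) (hf.differentiableAt ht z)
  rw [hf.transport ht z] at hl
  have h1 : HasDerivAt (fun s : ℝ => z.1 + s • z.2) z.2 0 := by
    simpa using ((hasDerivAt_id (0 : ℝ)).smul_const z.2).const_add z.1
  have hUd : HasFDerivAt (potential (f t)) (fderiv ℝ (potential (f t)) z.1)
      (z.1 + (0 : ℝ) • z.2) := by
    simpa using (hU.differentiable one_ne_zero z.1).hasFDerivAt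
  refine ((hasDerivAt_line (X := (z.2, -gradPot (f t) z.1)) (hH.differentiableAt ht z)).unique
    ((hUd.comp_hasDerivAt (0 : ℝ) h1).mul hl)).trans ?_
  rw [← inner_gradient_eq_fderiv]
  simp [gradPot]

theorem isCompactFamily_potential (hf : IsClassicalSolution f) {H : ℝ → Phase → ℝ}
    (hH : IsCompactFamily H) : IsCompactFamily fun s z => potential (f s) z.1 * H s z := by
  refine hH.mul_left (G := fun s z => potential (f s) z.1) ?_
  have h : ContDiff ℝ 1 fun p : ℝ × Phase => (p.1, p.2.1) := by fun_prop
  exact hf.contDiffOn_potential.comp h.contDiffOn fun p hp => ⟨hp.1, mem_univ _⟩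

/-- By the product rule the derivative is `∫ ∂ₜU f + ∫ U ∂ₜf`. Reciprocity, `∫ U_s f_t = ∫ U_t f_s`,
identifies the two terms, so the result is twice the derivative with frozen potential and cancels
that of `∫ |v|² f`. -/
theorem hasDerivAt_potential_energy (hf : IsClassicalSolution f) (hc : HasCompactSupport (f 0))
    (hs : IsSphericallySymmetric (f 0)) (hff : ∀ t, 0 ≤ t → FiniteField (f t)) {t : ℝ}
    (ht : 0 < t) : HasDerivAt (fun s => ∫ z : Phase, potential (f s) z.1 * f s z)
      (2 * ∫ z : Phase, inner ℝ z.2 (gradPot (f t) z.1) * f t z) t := by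
  have hfam := hf.isCompactFamily hc
  have hU : ContDiff ℝ 1 (potential (f t)) := (hf.contDiff_potential t ht.le).of_le one_le_two
  have H1 := hf.isCompactFamily_potential hfam
  have H2 := hf.isCompactFamily_potential (hfam.const_slice ht.le)
  have H3 : IsCompactFamily fun s z => potential (f t) z.1 * f s z :=
    hfam.mul_left (G := fun _ z => potential (f t) z.1)
      (hU.comp (contDiff_fst.comp contDiff_snd)).contDiffOn
  obtain ⟨-, d1⟩ := H1.hasDerivAt_integral_time ht
  obtain ⟨i2, d2⟩ := H2.hasDerivAt_integral_time ht
  obtain ⟨i3, d3⟩ := H3.hasDerivAt_integral_time ht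
  have hd := hf.hasDerivAt_frozen_potential hc ht
  have e3 := d3.unique hd
  have hsymm : (fun s => ∫ z : Phase, potential (f s) z.1 * f t z) =ᶠ[𝓝 t]
      fun s => ∫ z : Phase, potential (f t) z.1 * f s z := by
    filter_upwards [Ioi_mem_nhds ht] with s hs'
    have hst := hf.isSymmetricDensity hc hs ht.le
    have hss := hf.isSymmetricDensity hc hs (le_of_lt hs')
    rw [(integral_potential_mul hss hst (hff s (le_of_lt hs')) (hff t ht.le)).2,
      (integral_potential_mul hst hss (hff t ht.le) (hff s (le_of_lt hs'))).2, interaction_comm]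
  have e2 := d2.unique (hd.congr_of_eventuallyEq hsymm)
  refine d1.congr_deriv ?_
  rw [two_mul]
  nth_rewrite 1 [← e2]
  rw [← e3, ← integral_add i2 i3]
  congr 1; ext z
  have hUt : HasDerivAt (fun s => potential (f s) z.1)
      (deriv (fun s => potential (f s) z.1) t) t := by
    have h1 : DifferentiableAt ℝ (fun p : ℝ × E3 => potential (f p.1) p.2) (t, z.1) :=
      (hf.contDiffOn_potential.contDiffAt
        (prod_mem_nhds (Ici_mem_nhds ht) univ_mem)).differentiableAt one_ne_zero
    have h2 : DifferentiableAt ℝ (fun s : ℝ => (s, z.1)) t := by fun_prop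
    exact (DifferentiableAt.comp t h1 h2).hasDerivAt
  have hft := hasDerivAt_time (hf.differentiableAt ht z)
  have k1 := (hasDerivAt_time (H1.differentiableAt ht z)).unique (hUt.mul hft)
  have k2 := (hasDerivAt_time (H2.differentiableAt ht z)).unique (hUt.mul_const (f t z))
  have k3 := (hasDerivAt_time (H3.differentiableAt ht z)).unique
    (hft.const_mul (potential (f t) z.1))
  rw [k1, k2, k3]

theorem energy_eq (hf : IsClassicalSolution f) (hc : HasCompactSupport (f 0))
    (hs : IsSphericallySymmetric (f 0)) (hff : ∀ t, 0 ≤ t → FiniteField (f t)) {t : ℝ}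
    (ht : 0 ≤ t) :
    (∫ z : Phase, ‖z.2‖ ^ 2 * f t z) - interaction (f t) (f t) =
      (∫ z : Phase, ‖z.2‖ ^ 2 * f 0 z) - interaction (f 0) (f 0) := by
  have hint {s : ℝ} (hs' : 0 ≤ s) : -interaction (f s) (f s) =
      ∫ z : Phase, potential (f s) z.1 * f s z := by
    have h := hf.isSymmetricDensity hc hs hs'
    exact (integral_potential_mul h h (hff s hs') (hff s hs')).2.symm
  rw [sub_eq_add_neg, sub_eq_add_neg, hint ht, hint le_rfl]
  refine eq_of_hasDerivAt_zero (φ := fun t => (∫ z : Phase, ‖z.2‖ ^ 2 * f t z) +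
    ∫ z : Phase, potential (f t) z.1 * f t z) ?_ (fun s hs' => ?_) ht
  · exact (hf.isCompactFamily_kinetic hc).continuousOn_integral.add
      (hf.isCompactFamily_potential (hf.isCompactFamily hc)).continuousOn_integral
  · exact ((hf.hasDerivAt_kinetic hc hs').add
      (hf.hasDerivAt_potential_energy hc hs hff hs')).congr_deriv (by ring)

/-- The energy-Casimir functional is conserved. -/
theorem energyCasimir_conserved (hf : IsClassicalSolution f) (hc : HasCompactSupport (f 0))
    (hs : IsSphericallySymmetric (f 0)) (hff : ∀ t, 0 ≤ t → FiniteField (f t)) {Q : ℝ → ℝ → ℝ}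
    (hQ : IsCasimirIntegrand Q) (hQ0 : ∀ L, 0 ≤ L → Q 0 L = 0) {t : ℝ} (ht : 0 ≤ t) :
    energyCasimir Q (f t) = energyCasimir Q (f 0) := by
  rw [energyCasimir_eq (hf.isSymmetricDensity hc hs ht),
    energyCasimir_eq (hf.isSymmetricDensity hc hs le_rfl), J, J,
    hf.integral_casimir_eq hc hs hQ hQ0 ht]
  have := hf.energy_eq hc hs hff ht
  linarith

end IsClassicalSolution

end VlasovPoisson

theorem mainTheorem3
    (Q : ℝ → ℝ → ℝ) (C₁ C₂ C₃ C₄ F₀ μ₁ μ₂ μ₃ : ℝ)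
    (hC₁ : 0 < C₁) (hC₂ : 0 < C₂) (hC₃ : 0 < C₃) (hC₄ : 0 < C₄) (hF₀ : 0 < F₀)
    (hμ₁ : 0 < μ₁ ∧ μ₁ < 3 / 2) (hμ₂ : 0 < μ₂ ∧ μ₂ < 3 / 2) (hμ₃ : 0 < μ₃ ∧ μ₃ < 3 / 2)
    (hQ : VlasovPoisson.IsCasimirIntegrand Q)
    (hQ1 : VlasovPoisson.Q1 Q C₁ F₀ μ₁) (hQ2 : VlasovPoisson.Q2 Q C₂ F₀ μ₂)
    (hQ3 : VlasovPoisson.Q3 Q μ₃) (hQ4 : VlasovPoisson.Q4 Q) (hQ5 : VlasovPoisson.Q5 Q C₃ C₄)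
    (M : ℝ) (hM : 0 < M)
    (f₀ : VlasovPoisson.Phase → ℝ) (hf₀ : VlasovPoisson.IsMinimizer Q M f₀)
    (huniq : ∀ g : VlasovPoisson.Phase → ℝ, VlasovPoisson.IsMinimizer Q M g →
      g =ᵐ[volume] f₀) :
    (∀ f : VlasovPoisson.Phase → ℝ, VlasovPoisson.MemFM Q M f →
      Integrable (VlasovPoisson.casimirDistIntegrand Q M f f₀) ∧
      MemLp (fun x => VlasovPoisson.gradPot f x - VlasovPoisson.gradPot f₀ x) 2 ∧
      0 ≤ VlasovPoisson.casimirDist Q M f f₀) ∧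
    ∀ ε : ℝ, 0 < ε → ∃ δ : ℝ, 0 < δ ∧
      ∀ f : ℝ → VlasovPoisson.Phase → ℝ, VlasovPoisson.IsClassicalSolution f →
        ContDiff ℝ 1 (f 0) → HasCompactSupport (f 0) → VlasovPoisson.MemFM Q M (f 0) →
        VlasovPoisson.stabilityDist Q M (f 0) f₀ < δ →
        ∀ t : ℝ, 0 ≤ t →
          VlasovPoisson.MemFM Q M (f t) ∧ VlasovPoisson.stabilityDist Q M (f t) f₀ < ε := by
  have hFF {g : VlasovPoisson.Phase → ℝ} (hg : VlasovPoisson.MemFM Q M g) :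
      VlasovPoisson.FiniteField g := hg.finiteField hC₁ hF₀ hμ₁.1 hμ₁.2 hQ hQ1
  refine ⟨fun f hf => ⟨(VlasovPoisson.integrable_casimirDistIntegrand hf hf₀.1 (hFF hf)
    (hFF hf₀.1)).1, VlasovPoisson.memLp_gradPot_sub hf.isSymmetricDensity
    hf₀.1.isSymmetricDensity (hFF hf) (hFF hf₀.1),
    VlasovPoisson.casimirDist_nonneg hC₁ hF₀ hμ₁.1 hμ₁.2 hQ hQ1 hQ4 hf₀ hf⟩, fun ε hε => ?_⟩
  obtain ⟨δ, hδ, hδε⟩ := VlasovPoisson.exists_delta_interaction_lt hC₁ hF₀ hμ₁.1 hμ₁.2 hμ₂.1 hμ₂.2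
    hμ₃.1 hQ hQ1 hQ2 hQ3 hQ4 hM hf₀ huniq (half_pos hε)
  -- The stability distance equals `𝒟(f) - 𝒟(f₀) + I(f - f₀)`. The excess of `𝒟` is conserved and at
  -- most the initial distance, hence below both `δ` and `ε/2`; being below `δ`, it forces `I(f(t) -
  -- f₀) < ε/2`.
  refine ⟨min δ (ε / 2), lt_min hδ (half_pos hε), fun f hf _ hc h0 hdist t ht => ?_⟩
  have hQ0 (L : ℝ) (hL : 0 ≤ L) : Q 0 L = 0 := VlasovPoisson.casimir_zero hQ hF₀ hμ₂.1 hQ2 hL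
  have hmem {s : ℝ} (hs : 0 ≤ s) := hf.memFM hc hQ hQ0 h0 hs
  have hcons := hf.energyCasimir_conserved hc h0.symmetric (fun s hs => hFF (hmem hs)) hQ hQ0 ht
  refine ⟨hmem ht, ?_⟩
  have e0 := VlasovPoisson.energyCasimir_sub_eq h0 hf₀.1 (hFF h0) (hFF hf₀.1)
  have et := VlasovPoisson.energyCasimir_sub_eq (hmem ht) hf₀.1 (hFF (hmem ht)) (hFF hf₀.1)
  have i0 := VlasovPoisson.interaction_self_nonneg (f 0 - f₀)
  rw [VlasovPoisson.stabilityDist_eq h0 hf₀.1, lt_min_iff] at hdist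
  rw [VlasovPoisson.stabilityDist_eq (hmem ht) hf₀.1]
  have it := hδε (f t) (hmem ht) (by linarith)
  linarith
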